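/- Let $S\subset\mathbb R^3$ be a spherical surface of revolution, obtained by rotating about the $z$-axis a simple smooth unit-speed curve $r\mapsto(f(r),0,g(r))$, $r\in[r_N,r_S]$, with $f\ge 0$ and $f(r)=0$ exactly for $r=r_N$ (north pole) and $r=r_S$ (south pole). Suppose that $S$ has constant Gaussian curvature $-f''/f=K>0$ away from the poles, and that $S$ is an orbifold of revolution: the tangent cone at each pole (the tangent half-line of the profile curve, rotated about the axis, with its intrinsic metric) is isometric to the metric quotient of the flat plane by a finite cyclic group of rotations, say to $\mathbb R^2/\mathbb Z_n$ at the north pole and to $\mathbb R^2/\mathbb Z_k$ at the south pole, $n,k\ge1$. Then there are real numbers $\beta$ with $-ff''+(f')^2=\beta^2$ on $[r_N,r_S]$, and each of them satisfies $$|\beta|=f'(r_N)=\frac1n=\frac{2}{2n}.$$ Moreover, consider the Kepler problem on $S$ for a particle of mass $1$ with potential $V=\gamma\Theta(r)$, where $\gamma>0$ and $\Theta$ is an antiderivative of $1/f^2$ on $(r_N,r_S)$. In the coordinates $v=p_r/\sqrt{|\Theta|}$, $u=p_\theta/(f\sqrt{|\Theta|})$, the equations of motion are $$\begin{aligned}\dot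 r&=v\sqrt{|\Theta|},&\dot v&=\Big(u^2f'-\frac{v^2}{2f\Theta}-\frac{\gamma}{f|\Theta|}\Big)\frac{\sqrt{|\Theta|}}{f},\\ \dot\theta&=u\frac{\sqrt{|\Theta|}}{f},&\dot u&=-uv\Big(f'+\frac1{2f\Theta}\Big)\frac{\sqrt{|\Theta|}}{f}.\end{aligned}$$ For $h\in\mathbb R$ let $\mathbf M(h)$ be the energy manifold of the states $(r,\theta,u,v)$, $\theta$ modulo $2\pi$, with $\operatorname{sgn}(\Theta)\frac{u^2+v^2}2+\gamma=\frac h{\Theta}$, where at $r=r_N$ this relation is read as its limit $u^2+v^2=2\gamma$, and let $\mathbf N=\{x\in\mathbf M(h): r=r_N\}$ be the set of north-pole collision states. Then, for every $h\in\mathbb R$, the singularity set $\mathbf N$ is block regularizable. Here block regularizable means the following. For a compact set $\mathbf B\subset\mathbf M(h)$ with non-empty interior, whose boundary $\mathbf b$ in $\mathbf M(h)$ is a smooth hypersurface disjoint from $\mathbf N$, let $\phi$ be the flow on $\mathbf M(h)\setminus\mathbf N$ (not necessarily defined for all times). Let $\mathbf b^+$ (respectively $\mathbf b^-$) be the set of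 the points of $\mathbf b$ whose orbits lie outside $\mathbf B$ for all small negative (respectively positive) times, and let $\mathbf a^+\subset\mathbf b^+$ be the set of those points whose orbit stays in $\mathbf B$ for all positive times for which it is defined. $\mathbf B$ is an isolating block if the set of points of $\mathbf b$ at which the vector field is tangent to $\mathbf b$ equals $\mathbf b^+\cap\mathbf b^-$ and is a smooth submanifold of codimension one of $\mathbf b$. $\mathbf B$ isolates $\mathbf N$ if $\mathbf N\subset\operatorname{int}\mathbf B$ and no orbit through a point of $\mathbf B\setminus\mathbf N$ is contained in $\mathbf B$. $\mathbf B$ is trivializable if the map across the block $x\mapsto\phi(x,T(x))$, $T(x)=\inf\{t>0:\phi(x,t)\notin\mathbf B\}$, defined on $\mathbf b^+\setminus\mathbf a^+$, extends uniquely to a diffeomorphism $\mathbf b^+\to\mathbf b^-$. $\mathbf N$ is block regularizable if there is a trivializable isolating block which isolates $\mathbf N$. -/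

import Mathlib

open Set Filter Topology
open scoped ContDiff

noncomputable section

/-! ## Spherical surfaces of revolution -/

/-- A spherical surface of revolution, given by its unit speed profile curve
`r ↦ (f r, 0, g r)`, `r ∈ [rN, rS]`, which is rotated about the `z`-axis. -/
structure SphericalSurface where
  /-- parameter of the north pole -/
  rN : ℝ
  /-- parameter of the south pole -/
  rS : ℝ
  /-- distance of the profile curve from the axis -/
  f : ℝ → ℝ
  /-- height of the profile curve -/
  g : ℝ → ℝ
  rN_lt_rS : rN < rS
  smooth_f : ContDiffOn ℝ ∞ f (Icc rN rS)
  smooth_g : ContDiffOn ℝ ∞ g (Icc rN rS)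
  f_nonneg : ∀ r ∈ Icc rN rS, 0 ≤ f r
  f_eq_zero_iff : ∀ r ∈ Icc rN rS, (f r = 0 ↔ r = rN ∨ r = rS)
  simple : InjOn (fun r => (f r, g r)) (Icc rN rS)
  unit_speed : ∀ r ∈ Icc rN rS,
    derivWithin f (Icc rN rS) r ^ 2 + derivWithin g (Icc rN rS) r ^ 2 = 1

namespace SphericalSurface

/-- The derivative `f'` on the closed interval (one-sided at the poles). -/
def f' (S : SphericalSurface) (r : ℝ) : ℝ := derivWithin S.f (Icc S.rN S.rS) r

/-- The derivative `g'` on the closed interval (one-sided at the poles). -/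
def g' (S : SphericalSurface) (r : ℝ) : ℝ := derivWithin S.g (Icc S.rN S.rS) r

/-- The second derivative `f''` on the closed interval. -/
def f'' (S : SphericalSurface) (r : ℝ) : ℝ := derivWithin S.f' (Icc S.rN S.rS) r

/-- The parametrization of the surface in `ℝ³`. -/
def param (S : SphericalSurface) (r θ : ℝ) : EuclideanSpace ℝ (Fin 3) :=
  !₂[S.f r * Real.cos θ, S.f r * Real.sin θ, S.g r]

/-- The Gaussian curvature `-f''/f` of the metric `dr² + f(r)² dθ²`. -/
def gaussianCurvature (S : SphericalSurface) (r : ℝ) : ℝ := -(S.f'' r) / S.f r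

/-- The surface has constant Gaussian curvature `K` away from the poles. -/
def HasConstantCurvature (S : SphericalSurface) (K : ℝ) : Prop :=
  ∀ r ∈ Ioo S.rN S.rS, S.gaussianCurvature r = K

/-- `β` is a parameter of the surface: `-f f'' + (f')² = β²`. -/
def IsBeta (S : SphericalSurface) (β : ℝ) : Prop :=
  ∀ r ∈ Icc S.rN S.rS, -(S.f r) * S.f'' r + S.f' r ^ 2 = β ^ 2

end SphericalSurface

/-! ## Tangent cones and orbifolds of revolution -/

/-- The cone with apex `p` obtained by rotating the half-line from `p` in the direction
`(a, 0, b)` about the vertical axis through `p`. -/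
def coneOfRevolution (p : EuclideanSpace ℝ (Fin 3)) (a b : ℝ) :
    Set (EuclideanSpace ℝ (Fin 3)) :=
  {x | ∃ ρ θ : ℝ, 0 ≤ ρ ∧ x = p + ρ • !₂[a * Real.cos θ, a * Real.sin θ, b]}

/-- The intrinsic (length) distance in a subset `X` of `ℝ³`: the infimum of the lengths of the
continuous curves in `X` from `p` to `q`. -/
def intrinsicEDist (X : Set (EuclideanSpace ℝ (Fin 3))) (p q : EuclideanSpace ℝ (Fin 3)) :
    ENNReal :=
  ⨅ (c : ℝ → EuclideanSpace ℝ (Fin 3)) (_ : ContinuousOn c (Icc 0 1))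
    (_ : MapsTo c (Icc 0 1) X) (_ : c 0 = p) (_ : c 1 = q), eVariationOn c (Icc 0 1)

/-- The orbit space `ℝ²/ℤₙ`: the plane `ℂ` modulo the group of the `n`-th roots of unity, which
acts by multiplication, that is by the rotations about the origin through multiples of
`2π/n`. -/
abbrev PlaneQuotient (n : ℕ) : Type := MulAction.orbitRel.Quotient (rootsOfUnity n ℂ) ℂ

/-- The quotient metric on `ℝ²/ℤₙ`: the distance between two orbits. -/
def quotientEDist {n : ℕ} (a b : PlaneQuotient n) : ENNReal :=
  ⨅ (z ∈ a.orbit) (w ∈ b.orbit), edist z w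

/-- The set `X ⊆ ℝ³` with its intrinsic metric is isometric to the metric quotient `ℝ²/ℤₙ`. -/
def IsIsometricToPlaneQuotient (X : Set (EuclideanSpace ℝ (Fin 3))) (n : ℕ) : Prop :=
  ∃ e : X ≃ PlaneQuotient n, ∀ p q : X,
    quotientEDist (e p) (e q) = intrinsicEDist X (p : EuclideanSpace ℝ (Fin 3)) q

namespace SphericalSurface

/-- The tangent cone at the north pole: the tangent half-line of the profile curve there,
rotated about the axis. -/
def tangentConeNorth (S : SphericalSurface) : Set (EuclideanSpace ℝ (Fin 3)) :=
  coneOfRevolution (S.param S.rN 0) (S.f' S.rN) (S.g' S.rN)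

/-- The tangent cone at the south pole. The curve ends there, so the half-line that points into
the surface has direction `-(f', g')`. -/
def tangentConeSouth (S : SphericalSurface) : Set (EuclideanSpace ℝ (Fin 3)) :=
  coneOfRevolution (S.param S.rS 0) (-(S.f' S.rS)) (-(S.g' S.rS))

/-- Spherical orbifolds of revolution: the tangent cone at each pole is isometric to the metric
quotient of the flat plane by a finite cyclic group of rotations (the orders of the groups at the
two poles are not assumed to agree). -/
def IsOrbifold (S : SphericalSurface) : Prop :=
  (∃ n : ℕ, 0 < n ∧ IsIsometricToPlaneQuotient S.tangentConeNorth n) ∧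
    (∃ k : ℕ, 0 < k ∧ IsIsometricToPlaneQuotient S.tangentConeSouth k)

end SphericalSurface

/-! ## Isolating blocks and block regularization

Manifolds are subsets of a finite-dimensional real normed space `E`. -/

section Blocks

variable {E : Type*} [NormedAddCommGroup E] [NormedSpace ℝ E]

/-- `S` is a smooth embedded submanifold of `E` of dimension `k`: locally it is the zero set of a
smooth submersion to a space of complementary dimension. -/
def IsSmoothSubmanifold (k : ℕ) (S : Set E) : Prop :=
  ∀ x ∈ S, ∃ U : Set E, IsOpen U ∧ x ∈ U ∧
    ∃ (m : ℕ) (G : E → (Fin m → ℝ)), Module.finrank ℝ E = k + m ∧ ContDiffOn ℝ ∞ G U ∧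
      (∀ y ∈ S ∩ U, Function.Surjective (fderiv ℝ G y)) ∧ S ∩ U = {y ∈ U | G y = 0}

/-- `w` is tangent to `S` at `x`: it is the velocity at `x` of a curve in `S`. -/
def IsTangentTo (S : Set E) (x w : E) : Prop :=
  ∃ c : ℝ → E, c 0 = x ∧ HasDerivAt c w 0 ∧ ∀ᶠ t in 𝓝 (0 : ℝ), c t ∈ S

/-- A map between subsets of `E` is smooth if it extends near each point to a smooth map on an
open set (on submanifolds, with or without boundary, this is the usual smoothness). -/
def IsSmoothMap {X Y : Set E} (φ : X → Y) : Prop :=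
  ∀ x : X, ∃ (U : Set E) (G : E → E), IsOpen U ∧ (x : E) ∈ U ∧ ContDiffOn ℝ ∞ G U ∧
    ∀ y : X, (y : E) ∈ U → G y = φ y

/-- `c` is, on the open interval `J ∋ 0`, an integral curve of the vector field `F` which stays
in `D`. -/
structure IsTrajectory (F : E → E) (D : Set E) (J : Set ℝ) (c : ℝ → E) : Prop where
  isOpen : IsOpen J
  ordConnected : J.OrdConnected
  zero_mem : (0 : ℝ) ∈ J
  mem : ∀ t ∈ J, c t ∈ D
  deriv : ∀ t ∈ J, HasDerivAt c (F (c t)) t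

/-- `FlowsTo F D x t y`: the (partially defined) flow `φ` of the vector field `F` on `D` is
defined at `(x, t)`, and `φ(x, t) = y`. -/
def FlowsTo (F : E → E) (D : Set E) (x : E) (t : ℝ) (y : E) : Prop :=
  ∃ (J : Set ℝ) (c : ℝ → E), IsTrajectory F D J c ∧ t ∈ J ∧ c 0 = x ∧ c t = y

/-- The interior of `B` relative to `M`. -/
def relInterior (M B : Set E) : Set E := {x ∈ B | B ∈ 𝓝[M] x}

/-- The boundary `b` of a compact set `B ⊆ M` relative to `M`. -/
def relBoundary (M B : Set E) : Set E := B \ relInterior M B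

/-- The set `b⁺` of ingress points. The vector field `F` is defined on `M \ N`. -/
def ingress (F : E → E) (M N B : Set E) : Set E :=
  {x ∈ relBoundary M B | ∃ ε > 0, ∀ t ∈ Ioo (-ε) (0 : ℝ), ∀ y, FlowsTo F (M \ N) x t y → y ∉ B}

/-- The set `b⁻` of egress points. -/
def egress (F : E → E) (M N B : Set E) : Set E :=
  {x ∈ relBoundary M B | ∃ ε > 0, ∀ t ∈ Ioo (0 : ℝ) ε, ∀ y, FlowsTo F (M \ N) x t y → y ∉ B}

/-- The set `t` of tangency points. -/
def tangency (F : E → E) (M B : Set E) : Set E :=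
  {x ∈ relBoundary M B | IsTangentTo (relBoundary M B) x (F x)}

/-- The set `a⁺` of the ingress points whose forward orbit never leaves `B`. -/
def asymptoticIngress (F : E → E) (M N B : Set E) : Set E :=
  {x ∈ ingress F M N B | ∀ t, 0 ≤ t → ∀ y, FlowsTo F (M \ N) x t y → y ∈ B}

/-- The time spent in the block, `inf {t > 0 | φ(x, t) ∉ B}`. -/
def exitTime (F : E → E) (M N B : Set E) (x : E) : ℝ :=
  sInf {t : ℝ | 0 < t ∧ ∃ y, FlowsTo F (M \ N) x t y ∧ y ∉ B}

/-- `B` is an isolating block for the vector field `F` on `M \ N`, where `M` has dimension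
`k + 2`: `B ⊆ M` is compact with non-empty interior, its boundary `b` is a smooth hypersurface of
`M` that does not meet `N`, and `t = b⁺ ∩ b⁻` is a smooth submanifold of codimension one
of `b`. -/
structure IsIsolatingBlock (k : ℕ) (F : E → E) (M N B : Set E) : Prop where
  subset : B ⊆ M
  isCompact : IsCompact B
  nonempty_interior : (relInterior M B).Nonempty
  smooth_boundary : IsSmoothSubmanifold (k + 1) (relBoundary M B)
  disjoint : Disjoint (relBoundary M B) N
  tangency_eq : tangency F M B = ingress F M N B ∩ egress F M N B
  smooth_tangency : IsSmoothSubmanifold k (tangency F M B)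

/-- `B` isolates the singularity set `N`: `N` lies in the interior of `B`, and no orbit is
contained in `B`. -/
def Isolates (F : E → E) (M N B : Set E) : Prop :=
  N ⊆ relInterior M B ∧ ∀ x ∈ B \ N, ∃ t y, FlowsTo F (M \ N) x t y ∧ y ∉ B

/-- `B` is trivializable: the map across the block, `x ↦ φ(x, T(x))` with `T` the time spent in
the block, which is defined on `b⁺ \ a⁺`, extends uniquely to a diffeomorphism from `b⁺`
to `b⁻`. -/
def IsTrivializable (F : E → E) (M N B : Set E) : Prop :=
  ∃! e : ingress F M N B ≃ egress F M N B, IsSmoothMap e ∧ IsSmoothMap e.symm ∧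
    ∀ x : ingress F M N B, (x : E) ∉ asymptoticIngress F M N B →
      FlowsTo F (M \ N) x (exitTime F M N B x) (e x)

/-- The singularity set `N` of the vector field `F` on the `(k + 2)`-dimensional `M` is block
regularizable: there is a trivializable isolating block which isolates it. -/
def IsBlockRegularizable (k : ℕ) (F : E → E) (M N : Set E) : Prop :=
  ∃ B : Set E, IsIsolatingBlock k F M N B ∧ Isolates F M N B ∧ IsTrivializable F M N B

end Blocks

/-! ## The Kepler problem on a spherical surface of revolution -/

/-- Ambient space of the states `(r, θ, u, v)`. The angle `θ`, which is taken modulo `2π`, is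
represented by the point `ζ = e^{iθ}` of the unit circle, so a state is `(r, ζ, u, v)`. -/
abbrev KeplerState : Type := ℝ × ℂ × ℝ × ℝ

namespace SphericalSurface

/-- `Θ` is an antiderivative of `1/f²` between the poles; the potential is `V = γ Θ`. -/
def IsPotentialShape (S : SphericalSurface) (Θ : ℝ → ℝ) : Prop :=
  ∀ r ∈ Ioo S.rN S.rS, HasDerivAt Θ (1 / S.f r ^ 2) r

/-- The equations of motion (particle of mass one) in the coordinates
`v = p_r / √|Θ|`, `u = p_θ / (f √|Θ|)`. The equation `dθ/dt = u √|Θ| / f` becomes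
`dζ/dt = i (u √|Θ| / f) ζ` for `ζ = e^{iθ}`. -/
def keplerField (S : SphericalSurface) (Θ : ℝ → ℝ) (γ : ℝ) : KeplerState → KeplerState :=
  fun (r, ζ, u, v) =>
    (v * √|Θ r|,
      ((u * (√|Θ r| / S.f r) : ℝ) : ℂ) * Complex.I * ζ,
      -u * v * (S.f' r + 1 / (2 * S.f r * Θ r)) * (√|Θ r| / S.f r),
      (u ^ 2 * S.f' r - v ^ 2 / (2 * S.f r * Θ r) - γ / (S.f r * |Θ r|)) * (√|Θ r| / S.f r))

/-- The energy manifold `M(h)`: the energy relation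
`sgn(Θ) (u² + v²)/2 + γ = h/Θ`, extended by continuity to the pole `r = rN`, where
`Θ → -∞`, as `u² + v² = 2γ`. (At `r = rS`, where `Θ → ∞`, the limiting relation
`(u² + v²)/2 + γ = 0` has no solutions. The coordinates `u, v` do not exist where
`Θ = 0`.) -/
def energyManifold (S : SphericalSurface) (Θ : ℝ → ℝ) (γ h : ℝ) : Set KeplerState :=
  {x | ∃ (r : ℝ) (ζ : ℂ) (u v : ℝ), x = (r, ζ, u, v) ∧ ‖ζ‖ = 1 ∧
    ((r = S.rN ∧ u ^ 2 + v ^ 2 = 2 * γ) ∨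
      (r ∈ Ioo S.rN S.rS ∧ Θ r ≠ 0 ∧
        (SignType.sign (Θ r) : ℝ) * ((u ^ 2 + v ^ 2) / 2) + γ = h / Θ r))}

/-- The singularity set `N` at the north pole (the states of collision). -/
def northSingularity (S : SphericalSurface) (Θ : ℝ → ℝ) (γ h : ℝ) : Set KeplerState :=
  {x ∈ S.energyManifold Θ γ h | x.1 = S.rN}

end SphericalSurface

end

/-! Geometry. Write κ = √K. The equation f'' = -κ² f together with f = 0 at the north pole gives f =
(β/κ) sin κ(r - r_N) with β = f'(r_N) > 0, and the south pole sits at the first zero of the sine.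
Hence -f f'' + f'² is the constant f'(r_N)², which fixes |β|. The tangent cone at the north pole is
the round cone whose generators have horizontal slope β; developed in the plane it is a sector of
angle 2πβ. Opposite points of its circle of radius R about the apex are 2R sin(πβ/2) apart, while in
ℝ²/ℤₙ the largest distance on such a circle is 2R sin(π/(2n)). An isometry need not be known to
preserve the apex, but it moves the radii by at most a constant, so letting R grow forces the two
sines, hence β and 1/n, to agree (`HasOpening.le_of_isometry`, `cone_slope_eq_of_isometric`).

Dynamics. Take q = Θ(r) as position and σ with dt = f² dσ as time. Since dq/dr = 1/f², the radial
momentum p is dq/dσ, the angular momentum l is constant, dθ/dσ = l, and p' = -(βl)²(q - C) - γ: a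
harmonic oscillator of frequency Ω = βl (`KeplerData.Models.hasDerivAt_state`). The north pole is q
= -∞. The block is {q ≤ q₀} on the energy manifold, with q₀ very negative. There every critical
point of q along an orbit is a strict minimum (`KeplerData.exists_threshold`). So boundary points
with v ≤ 0 enter, those with v ≥ 0 leave, tangency is v = 0, and no orbit remains inside: an
oscillator orbit always has a maximum of q. An orbit with l ≠ 0 entering with momentum p returns to
height q₀ with momentum -p after a time T satisfying exp(iΩT) = conj Z / Z, where Z = Ω²(q₀ - C) + γ
- i p Ω (`exists_orbit_return`). The longitude turns by lT = ΩT/β, which for β = 1/n means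
multiplication of ζ by (conj Z / Z)ⁿ. Z is polynomial in the velocities and has no zero on the
boundary, even for collision orbits, where Ω = 0 and Z = γ. Thus the map across the block extends
smoothly; reversing v conjugates Z, so the same formula gives the inverse, and the extension is
unique because u ≠ 0 is dense. -/

open Set Filter Topology
open scoped ContDiff

noncomputable section

/-! ### Uniqueness and time changes for partially defined flows. -/

section Flow

variable {E : Type*} [NormedAddCommGroup E] [NormedSpace ℝ E]

/-- A C¹ field is locally Lipschitz, so curves that meet agree near the meeting time. The times at
which the two germs agree therefore form a set that is open, and closed in the interval `J ∩ J'`;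
connectedness does the rest. -/
theorem IsTrajectory.eqOn_inter {F : E → E} {D : Set E} (hF : ∀ x ∈ D, ContDiffAt ℝ 1 F x)
    {J J' : Set ℝ} {c c' : ℝ → E} (h : IsTrajectory F D J c) (h' : IsTrajectory F D J' c')
    (h0 : c 0 = c' 0) : EqOn c c' (J ∩ J') := by
  have hopen : IsOpen (J ∩ J') := h.isOpen.inter h'.isOpen
  have hconn : IsPreconnected (J ∩ J') := (h.ordConnected.inter h'.ordConnected).isPreconnected
  have hcont : ContinuousOn c (J ∩ J') := fun t ht =>
    (h.deriv t ht.1).continuousAt.continuousWithinAt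
  have hcont' : ContinuousOn c' (J ∩ J') := fun t ht =>
    (h'.deriv t ht.2).continuousAt.continuousWithinAt
  let U : Set ℝ := {t | c =ᶠ[𝓝 t] c'}
  have hU : IsOpen U := by
    rw [isOpen_iff_mem_nhds]
    intro t ht
    exact eventually_eventually_nhds.2 ht
  have step : ∀ t ∈ J ∩ J', c t = c' t → t ∈ U := by
    intro t ht hct
    obtain ⟨K, s, hs, hL⟩ := (hF (c t) (h.mem t ht.1)).exists_lipschitzOnWith
    have hJ := hopen.mem_nhds ht
    have hcs : ∀ᶠ x in 𝓝 t, c x ∈ s := (h.deriv t ht.1).continuousAt hs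
    have hcs' : ∀ᶠ x in 𝓝 t, c' x ∈ s := (h'.deriv t ht.2).continuousAt (hct ▸ hs)
    refine ODE_solution_unique_of_eventually (v := fun _ => F) (s := fun _ => s)
      (Eventually.of_forall fun _ => hL) ?_ ?_ hct
    · filter_upwards [hJ, hcs] with x hx hx'
      exact ⟨h.deriv x hx.1, hx'⟩
    · filter_upwards [hJ, hcs'] with x hx hx'
      exact ⟨h'.deriv x hx.2, hx'⟩
  have hsub : J ∩ J' ⊆ U := by
    refine hconn.subset_of_closure_inter_subset hU
      ⟨0, ⟨h.zero_mem, h'.zero_mem⟩, step 0 ⟨h.zero_mem, h'.zero_mem⟩ h0⟩ ?_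
    rintro t ⟨htU, ht⟩
    refine step t ht ?_
    have hne : (𝓝[U] t).NeBot := mem_closure_iff_nhdsWithin_neBot.1 htU
    have h1 : Tendsto c (𝓝[U] t) (𝓝 (c t)) := (h.deriv t ht.1).continuousAt.mono_left inf_le_left
    have h2 : Tendsto c' (𝓝[U] t) (𝓝 (c' t)) :=
      (h'.deriv t ht.2).continuousAt.mono_left inf_le_left
    refine tendsto_nhds_unique h1 (h2.congr' ?_)
    filter_upwards [self_mem_nhdsWithin] with x hx
    exact (EventuallyEq.eq_of_nhds hx).symm
  intro t ht
  exact EventuallyEq.eq_of_nhds (hsub ht)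

theorem FlowsTo.unique {F : E → E} {D : Set E} (hF : ∀ x ∈ D, ContDiffAt ℝ 1 F x)
    {x y y' : E} {t : ℝ} (h : FlowsTo F D x t y) (h' : FlowsTo F D x t y') : y = y' := by
  obtain ⟨J, c, hc, ht, h0, rfl⟩ := h
  obtain ⟨J', c', hc', ht', h0', rfl⟩ := h'
  exact hc.eqOn_inter hF hc' (h0.trans h0'.symm) ⟨ht, ht'⟩

/-- The time change of a curve along which the velocity is a positive multiple of the field. -/
theorem exists_flowsTo_of_reparametrization {F : E → E} {D : Set E} {l : ℝ → ℝ}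
    (hl : Continuous l) (hpos : ∀ s, 0 < l s) :
    ∃ τ : ℝ → ℝ, StrictMono τ ∧ Continuous τ ∧ τ 0 = 0 ∧
      ∀ (G : ℝ → E) (I : Set ℝ), IsOpen I → I.OrdConnected → (0 : ℝ) ∈ I →
        (∀ s ∈ I, G s ∈ D ∧ HasDerivAt G (l s • F (G s)) s) →
        ∀ s ∈ I, FlowsTo F D (G 0) (τ s) (G s) := by
  let τ : ℝ → ℝ := fun s => ∫ x in (0 : ℝ)..s, l x
  have hder : ∀ s, HasStrictDerivAt τ (l s) s := fun s =>
    intervalIntegral.integral_hasStrictDerivAt_right (hl.intervalIntegrable _ _)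
      (hl.stronglyMeasurableAtFilter _ _) hl.continuousAt
  have hmono : StrictMono τ := strictMono_of_deriv_pos fun s => by
    rw [(hder s).hasDerivAt.deriv]; exact hpos s
  have hcont : Continuous τ := continuous_iff_continuousAt.2 fun s =>
    (hder s).hasDerivAt.continuousAt
  have hτ0 : τ 0 = 0 := intervalIntegral.integral_same
  refine ⟨τ, hmono, hcont, hτ0, ?_⟩
  intro G I hI hIc h0 hG s hs
  -- τ need not be onto ℝ (a collision may occur after finite time), so only a left inverse is
  -- available. It suffices: its derivative is needed at the points `τ x` alone.
  have hinv : ∀ x, Function.invFun τ (τ x) = x := Function.leftInverse_invFun hmono.injective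
  have hdinv : ∀ x, HasStrictDerivAt (Function.invFun τ) (l x)⁻¹ (τ x) := fun x =>
    (hder x).to_local_left_inverse (hpos x).ne' (Eventually.of_forall hinv)
  refine ⟨τ '' I, G ∘ Function.invFun τ, ⟨?_, ?_, ⟨0, h0, hτ0⟩, ?_, ?_⟩, ⟨s, hs, rfl⟩, ?_, ?_⟩
  · rw [isOpen_iff_mem_nhds]
    rintro _ ⟨x, hx, rfl⟩
    rw [← (hder x).map_nhds_eq (hpos x).ne']
    exact image_mem_map (hI.mem_nhds hx)
  · exact (hIc.isPreconnected.image τ hcont.continuousOn).ordConnected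
  · rintro _ ⟨x, hx, rfl⟩
    simpa [hinv] using (hG x hx).1
  · rintro _ ⟨x, hx, rfl⟩
    have h1 : HasDerivAt G (l x • F (G x)) (Function.invFun τ (τ x)) := by
      rw [hinv]; exact (hG x hx).2
    have h2 := h1.scomp (τ x) (hdinv x).hasDerivAt
    rw [smul_smul, inv_mul_cancel₀ (hpos x).ne', one_smul] at h2
    simpa [hinv] using h2
  · have := hinv 0
    rw [hτ0] at this
    simp [this]
  · simp [hinv]

end Flow

/-! ### A coarse invariant that distinguishes cones. -/

section Opening

/-- `d` behaves like the distance of a planar cone whose large circles of radius `R` about the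
apex have diameter `2 R s`; `ρ` plays the role of the distance from the apex. -/
def HasOpening {X : Type*} (d : X → X → ENNReal) (s : ℝ) : Prop :=
  ∃ ρ : X → ℝ, (∀ x, 0 ≤ ρ x) ∧ (∃ o, ρ o = 0) ∧
    (∀ x y, ENNReal.ofReal |ρ x - ρ y| ≤ d x y) ∧
    (∀ x y, d x y ≤ ENNReal.ofReal (ρ x + ρ y)) ∧
    (∀ x y, d x y ≤ ENNReal.ofReal (|ρ x - ρ y| + 2 * ρ y * s)) ∧
    ∀ R : ℝ, 0 ≤ R → ∃ x y, ρ x = R ∧ ρ y = R ∧ ENNReal.ofReal (2 * R * s) ≤ d x y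

/-- The image of the apex lies at some distance `c` from the other apex, so radii change by at most
`c`. Two points at radius R and distance at least 2Rs are sent to points at distance at most 2c +
2(R + c)s', which is impossible for large R if s' < s. -/
theorem HasOpening.le_of_isometry {X Y : Type*} {d : X → X → ENNReal} {d' : Y → Y → ENNReal}
    {s s' : ℝ} (h : HasOpening d s) (h' : HasOpening d' s') (hs' : 0 ≤ s') (e : X → Y)
    (he : ∀ p q, d' (e p) (e q) = d p q) : s ≤ s' := by
  obtain ⟨ρ, hρ0, ⟨o, ho⟩, hlow, hupp, -, hdiam⟩ := h
  obtain ⟨σ, hσ0, -, hlow', hupp', hopen', -⟩ := h'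
  by_contra! hlt
  set c := σ (e o) with hc
  have hc0 : 0 ≤ c := hσ0 _
  -- Large enough that R(s - s') exceeds c + cs', the bound that the comparison would impose.
  set R := (c + c * s' + 1) / (s - s') with hR
  have hsub : 0 < s - s' := by linarith
  have hR0 : 0 ≤ R := by positivity
  obtain ⟨x, y, hx, hy, hxy⟩ := hdiam R hR0
  have key : ∀ z, ρ z = R → |σ (e z) - c| ≤ R ∧ R ≤ σ (e z) + c := by
    intro z hz
    have h1 := (hlow' (e z) (e o)).trans ((he z o).le.trans (hupp z o))
    have h2 := (hlow z o).trans ((he z o).ge.trans (hupp' (e z) (e o)))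
    rw [ho, hz, add_zero, ENNReal.ofReal_le_ofReal_iff hR0] at h1
    rw [ho, hz, sub_zero, abs_of_nonneg hR0,
      ENNReal.ofReal_le_ofReal_iff (add_nonneg (hσ0 _) hc0)] at h2
    exact ⟨h1, h2⟩
  obtain ⟨hx1, hx2⟩ := key x hx
  obtain ⟨hy1, hy2⟩ := key y hy
  have h3 := hxy.trans ((he x y).ge.trans (hopen' (e x) (e y)))
  rw [ENNReal.ofReal_le_ofReal_iff
    (add_nonneg (abs_nonneg _) (mul_nonneg (mul_nonneg zero_le_two (hσ0 _)) hs'))] at h3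
  rw [abs_le] at hx1 hy1
  have h4 : |σ (e x) - σ (e y)| ≤ 2 * c := by rw [abs_le]; constructor <;> linarith
  have h5 : σ (e y) * s' ≤ (R + c) * s' := mul_le_mul_of_nonneg_right (by linarith) hs'
  have h6 : R * (s - s') = c + c * s' + 1 := div_mul_cancel₀ _ hsub.ne'
  nlinarith

end Opening

/-! ### The opening of ℝ²/ℤₙ is sin(π/(2n)). -/

section PlaneQuotient

theorem norm_sub_sq_polar (ρ ρ' α α' : ℝ) :
    ‖(ρ : ℂ) * Complex.exp (α * Complex.I) - ρ' * Complex.exp (α' * Complex.I)‖ ^ 2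
      = (ρ - ρ') ^ 2 + 4 * (ρ * ρ') * Real.sin ((α - α') / 2) ^ 2 := by
  have hre : ((ρ : ℂ) * Complex.exp (α * Complex.I) - ρ' * Complex.exp (α' * Complex.I)).re
      = ρ * Real.cos α - ρ' * Real.cos α' := by simp [Complex.exp_ofReal_mul_I_re]
  have him : ((ρ : ℂ) * Complex.exp (α * Complex.I) - ρ' * Complex.exp (α' * Complex.I)).im
      = ρ * Real.sin α - ρ' * Real.sin α' := by simp [Complex.exp_ofReal_mul_I_im]
  rw [← Complex.normSq_eq_norm_sq, Complex.normSq_apply, hre, him]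
  have h := Real.cos_sub α α'
  have h2 : Real.cos (α - α') = 1 - 2 * Real.sin ((α - α') / 2) ^ 2 := by
    rw [← Real.cos_two_mul_eq_one_sub]; ring_nf
  linear_combination ρ ^ 2 * Real.sin_sq_add_cos_sq α + ρ' ^ 2 * Real.sin_sq_add_cos_sq α'
    - 2 * ρ * ρ' * (h2 - h)

theorem norm_sub_polar_le_add {ρ ρ' : ℝ} (hρ : 0 ≤ ρ) (hρ' : 0 ≤ ρ') (α α' : ℝ) :
    ‖(ρ : ℂ) * Complex.exp (α * Complex.I) - ρ' * Complex.exp (α' * Complex.I)‖ ≤ ρ + ρ' := by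
  refine (norm_sub_le _ _).trans ?_
  simp [Complex.norm_exp_ofReal_mul_I, abs_of_nonneg, hρ, hρ']

/-- Path of two pieces: move radially to the circle of radius ρ', then along a chord of that circle.
-/
theorem norm_sub_polar_le {ρ ρ' α α' s : ℝ} (hρ' : 0 ≤ ρ')
    (hs : |Real.sin ((α - α') / 2)| ≤ s) :
    ‖(ρ : ℂ) * Complex.exp (α * Complex.I) - ρ' * Complex.exp (α' * Complex.I)‖
      ≤ |ρ - ρ'| + 2 * ρ' * s := by
  have h1 : (ρ : ℂ) * Complex.exp (α * Complex.I) - ρ' * Complex.exp (α' * Complex.I)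
      = ((ρ - ρ' : ℝ) : ℂ) * Complex.exp (α * Complex.I)
        + (ρ' * Complex.exp (α * Complex.I) - ρ' * Complex.exp (α' * Complex.I)) := by
    push_cast; ring
  rw [h1]
  refine (norm_add_le _ _).trans (add_le_add ?_ ?_)
  · rw [norm_mul, Complex.norm_exp_ofReal_mul_I, mul_one, Complex.norm_real, Real.norm_eq_abs]
  · have h0 : 0 ≤ s := (abs_nonneg _).trans hs
    refine le_of_sq_le_sq ?_ (by positivity)
    rw [norm_sub_sq_polar]
    have h2 : Real.sin ((α - α') / 2) ^ 2 ≤ s ^ 2 := by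
      rw [← sq_abs]; exact pow_le_pow_left₀ (abs_nonneg _) hs 2
    nlinarith [sq_nonneg ρ', mul_le_mul_of_nonneg_left h2 (sq_nonneg ρ')]

theorem norm_polar (z : ℂ) : (‖z‖ : ℂ) * Complex.exp (z.arg * Complex.I) = z :=
  Complex.norm_mul_exp_arg_mul_I z

theorem norm_smul_rootsOfUnity {n : ℕ} (hn : 0 < n) (ξ : rootsOfUnity n ℂ) (z : ℂ) :
    ‖ξ • z‖ = ‖z‖ := by
  have : NeZero n := ⟨hn.ne'⟩
  have h : ξ • z = (ξ : ℂˣ) * z := rfl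
  rw [h, norm_mul, Complex.norm_eq_one_of_mem_rootsOfUnity ξ.2, one_mul]

theorem PlaneQuotient.norm_eq {n : ℕ} (hn : 0 < n) {x : PlaneQuotient n} {z w : ℂ}
    (hz : z ∈ x.orbit) (hw : w ∈ x.orbit) : ‖z‖ = ‖w‖ := by
  rw [MulAction.orbitRel.Quotient.mem_orbit] at hz hw
  obtain ⟨ξ, rfl⟩ := MulAction.orbitRel_apply.1 (Quotient.exact (hz.trans hw.symm))
  exact norm_smul_rootsOfUnity hn ξ w

theorem PlaneQuotient.out_mem {n : ℕ} (x : PlaneQuotient n) : x.out ∈ x.orbit := by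
  rw [MulAction.orbitRel.Quotient.mem_orbit]
  exact Quotient.out_eq x

/-- An argument smaller than π/n would give zⁿ an argument strictly between -π and π, while that of
-1 is π. -/
theorem le_abs_arg_of_pow_eq_neg_one {n : ℕ} (hn : 0 < n) {z : ℂ} (hz : z ^ n = -1) :
    Real.pi / n ≤ |z.arg| := by
  have hn' : (0 : ℝ) < n := by exact_mod_cast hn
  by_contra! h
  have hnorm : ‖z‖ = 1 := by
    have h1 : ‖z‖ ^ n = 1 := by rw [← norm_pow, hz]; simp
    exact (pow_eq_one_iff_of_nonneg (norm_nonneg _) hn.ne').1 h1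
  have h1 : Complex.exp ((n * z.arg : ℝ) * Complex.I) = -1 := by
    have h2 : z = Complex.exp (z.arg * Complex.I) := by
      conv_lhs => rw [← norm_polar z, hnorm, Complex.ofReal_one, one_mul]
    calc Complex.exp ((n * z.arg : ℝ) * Complex.I)
        = Complex.exp (z.arg * Complex.I) ^ n := by
          rw [← Complex.exp_nat_mul]; push_cast; ring_nf
      _ = -1 := by rw [← h2, hz]
  have h2 : Real.cos (n * z.arg) = -1 := by
    have := congrArg Complex.re h1
    rwa [Complex.exp_ofReal_mul_I_re] at this
  have h3 : |n * z.arg| < Real.pi := by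
    rw [abs_mul, abs_of_pos hn']
    rwa [lt_div_iff₀' hn'] at h
  rw [← Real.cos_abs, ← Real.cos_pi] at h2
  exact h3.ne (Real.injOn_cos ⟨abs_nonneg _, h3.le⟩ ⟨Real.pi_pos.le, le_rfl⟩ h2)

/-- For the upper bound, a representative of the second orbit is turned until its angle to the first
is at most π/n. The bound is attained by R and R exp(iπ/n): any two representatives of these differ
by a factor whose n-th power is -1. -/
theorem hasOpening_quotientEDist {n : ℕ} (hn : 0 < n) :
    HasOpening (quotientEDist (n := n)) (Real.sin (Real.pi / (2 * n))) := by
  have hn' : (0 : ℝ) < n := by exact_mod_cast hn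
  have hn1 : (1 : ℝ) ≤ n := by exact_mod_cast hn
  have hpi := Real.pi_pos
  have hle : Real.pi / (2 * n) ≤ Real.pi / 2 := by
    apply div_le_div_of_nonneg_left hpi.le two_pos; linarith
  have hout : ∀ (x : PlaneQuotient n) (z : ℂ), z ∈ x.orbit → ‖z‖ = ‖x.out‖ := fun x z hz =>
    PlaneQuotient.norm_eq hn hz x.out_mem
  have hmk : ∀ z : ℂ, z ∈ MulAction.orbitRel.Quotient.orbit (Quotient.mk'' z : PlaneQuotient n) :=
    fun z => by rw [MulAction.orbitRel.Quotient.mem_orbit]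
  refine ⟨fun x => ‖x.out‖, fun x => norm_nonneg _, ⟨Quotient.mk'' 0, ?_⟩, ?_, ?_, ?_, ?_⟩
  · exact (hout _ 0 (hmk 0)).symm.trans norm_zero
  · intro x y
    simp only [quotientEDist, le_iInf_iff]
    intro z hz w hw
    rw [← hout x z hz, ← hout y w hw, edist_dist, dist_eq_norm]
    exact ENNReal.ofReal_le_ofReal (abs_norm_sub_norm_le z w)
  · intro x y
    refine (iInf₂_le_of_le _ x.out_mem (iInf₂_le _ y.out_mem)).trans ?_
    rw [edist_dist, dist_eq_norm]
    exact ENNReal.ofReal_le_ofReal (norm_sub_le _ _)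
  · intro x y
    set z := x.out
    set w := y.out
    -- The multiple of 2π/n nearest to the angle between the representatives; the remaining angle is
    -- at most π/n.
    let k : ℤ := round ((z.arg - w.arg) * n / (2 * Real.pi))
    let ξ : ℂ := Complex.exp ((2 * Real.pi * k / n : ℝ) * Complex.I)
    have hξ : ξ ^ n = 1 := by
      rw [← Complex.exp_nat_mul, Complex.exp_eq_one_iff]
      refine ⟨k, ?_⟩
      have : (n : ℂ) ≠ 0 := by exact_mod_cast hn.ne'
      push_cast
      field_simp
    have : NeZero n := ⟨hn.ne'⟩
    have hw : ξ * w ∈ y.orbit := by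
      rw [MulAction.orbitRel.Quotient.mem_orbit]
      have h1 : Quotient.mk'' w = y := Quotient.out_eq y
      rw [← h1]
      exact Quotient.sound ⟨rootsOfUnity.mkOfPowEq ξ hξ, rfl⟩
    refine (iInf₂_le_of_le _ x.out_mem (iInf₂_le _ hw)).trans ?_
    rw [edist_dist, dist_eq_norm]
    refine ENNReal.ofReal_le_ofReal ?_
    have h2 : ξ * w = (‖w‖ : ℂ) * Complex.exp ((2 * Real.pi * k / n + w.arg : ℝ) * Complex.I) := by
      conv_lhs => rw [← norm_polar w]
      rw [Complex.ofReal_add, add_mul, Complex.exp_add]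
      ring
    rw [h2]
    change ‖z - _‖ ≤ |‖z‖ - ‖w‖| + 2 * ‖w‖ * _
    conv_lhs => rw [← norm_polar z]
    refine norm_sub_polar_le (norm_nonneg _) ?_
    have h3 : |(z.arg - (2 * Real.pi * k / n + w.arg)) / 2| ≤ Real.pi / (2 * n) := by
      have h4 := abs_sub_round ((z.arg - w.arg) * n / (2 * Real.pi))
      have h5 : (z.arg - (2 * Real.pi * k / n + w.arg)) / 2
          = ((z.arg - w.arg) * n / (2 * Real.pi) - k) * (Real.pi / n) := by
        field_simp
        ring
      rw [h5, abs_mul, abs_of_pos (div_pos hpi hn')]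
      calc _ ≤ 1 / 2 * (Real.pi / n) := mul_le_mul_of_nonneg_right h4 (by positivity)
        _ = _ := by field_simp
    rw [Real.abs_sin_eq_sin_abs_of_abs_le_pi (by linarith)]
    have h6 := abs_nonneg ((z.arg - (2 * Real.pi * k / n + w.arg)) / 2)
    exact Real.sin_le_sin_of_le_of_le_pi_div_two (by linarith) hle h3
  · intro R hR
    refine ⟨Quotient.mk'' (R : ℂ), Quotient.mk'' (R * Complex.exp ((Real.pi / n : ℝ) * Complex.I)),
      ?_, ?_, ?_⟩
    · exact (hout _ _ (hmk _)).symm.trans (by simp [abs_of_nonneg hR])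
    · refine (hout _ _ (hmk _)).symm.trans ?_
      rw [norm_mul, Complex.norm_exp_ofReal_mul_I]
      simp [abs_of_nonneg hR]
    · simp only [quotientEDist, le_iInf_iff]
      intro z hz w hw
      rw [MulAction.orbitRel.Quotient.mem_orbit] at hz hw
      obtain ⟨ξ, rfl⟩ := MulAction.orbitRel_apply.1 (Quotient.exact hz)
      obtain ⟨η, rfl⟩ := MulAction.orbitRel_apply.1 (Quotient.exact hw)
      have : NeZero n := ⟨hn.ne'⟩
      have hξ : ((ξ : ℂˣ) : ℂ) ^ n = 1 := by exact_mod_cast (mem_rootsOfUnity' n _).1 ξ.2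
      have hη : ((η : ℂˣ) : ℂ) ^ n = 1 := by exact_mod_cast (mem_rootsOfUnity' n _).1 η.2
      have hξ1 : ‖((ξ : ℂˣ) : ℂ)‖ = 1 := Complex.norm_eq_one_of_mem_rootsOfUnity ξ.2
      have hξ0 : ((ξ : ℂˣ) : ℂ) ≠ 0 := (ξ : ℂˣ).ne_zero
      -- The quotient of the two representatives. The roots of unity disappear in its n-th power.
      set ζ : ℂ := ((η : ℂˣ) : ℂ) * Complex.exp ((Real.pi / n : ℝ) * Complex.I) / ((ξ : ℂˣ) : ℂ) with hζ
      have hζn : ζ ^ n = -1 := by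
        rw [hζ, div_pow, mul_pow, hξ, hη, ← Complex.exp_nat_mul, one_mul, div_one,
          ← Complex.exp_pi_mul_I]
        congr 1
        have : (n : ℂ) ≠ 0 := by exact_mod_cast hn.ne'
        push_cast
        field_simp
      have hζ1 : ‖ζ‖ = 1 := by
        have h1 : ‖ζ‖ ^ n = 1 := by rw [← norm_pow, hζn]; simp
        exact (pow_eq_one_iff_of_nonneg (norm_nonneg _) hn.ne').1 h1
      have hd : ξ • (R : ℂ) - η • ((R : ℂ) * Complex.exp ((Real.pi / n : ℝ) * Complex.I))
          = ((ξ : ℂˣ) : ℂ) * (R * (1 - ζ)) := by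
        change ((ξ : ℂˣ) : ℂ) * R - ((η : ℂˣ) : ℂ) * _ = _
        rw [hζ]
        field_simp
      rw [edist_dist, dist_eq_norm, hd, norm_mul, hξ1, one_mul, norm_mul, Complex.norm_real,
        Real.norm_of_nonneg hR]
      refine ENNReal.ofReal_le_ofReal ?_
      have h1 := norm_sub_sq_polar 1 ‖ζ‖ 0 ζ.arg
      rw [norm_polar, hζ1] at h1
      have h2 := le_abs_arg_of_pow_eq_neg_one hn hζn
      have h3 := Complex.abs_arg_le_pi ζ
      have h4 : Real.sin (Real.pi / (2 * n)) ≤ Real.sin (|ζ.arg| / 2) := by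
        refine Real.sin_le_sin_of_le_of_le_pi_div_two (by linarith [div_pos hpi (mul_pos two_pos hn')])
          (by linarith) ?_
        calc Real.pi / (2 * n) = Real.pi / n / 2 := by field_simp
          _ ≤ _ := by linarith
      have h5 : 0 ≤ Real.sin (Real.pi / (2 * n)) :=
        Real.sin_nonneg_of_nonneg_of_le_pi (by positivity) (by linarith)
      have h6 : Real.sin ((0 - ζ.arg) / 2) ^ 2 = Real.sin (|ζ.arg| / 2) ^ 2 := by
        rcases abs_cases ζ.arg with h | h
        · rw [h.1, zero_sub, neg_div, Real.sin_neg, neg_sq]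
        · rw [h.1, zero_sub]
      have h7 : 2 * Real.sin (Real.pi / (2 * n)) ≤ ‖1 - ζ‖ := by
        refine le_of_sq_le_sq ?_ (norm_nonneg _)
        simp only [Complex.ofReal_one, Complex.ofReal_zero, zero_mul, Complex.exp_zero,
          mul_one] at h1
        rw [h1, h6]
        nlinarith
      nlinarith

end PlaneQuotient

/-! ### The opening of a cone of revolution of slope a is sin(πa/2). -/

section Cone

/-- Concavity of the sine on [0, π]. Geometrically, with half-angles, chords in ℝ³ are no longer
than the corresponding chords in the developed sector, so rolling up the sector does not increase
distances. -/
theorem mul_sin_sq_le_sin_mul_sq {a t : ℝ} (ha0 : 0 ≤ a) (ha1 : a ≤ 1) (ht : |t| ≤ Real.pi) :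
    a ^ 2 * Real.sin t ^ 2 ≤ Real.sin (a * t) ^ 2 := by
  have key : ∀ t, 0 ≤ t → t ≤ Real.pi → a ^ 2 * Real.sin t ^ 2 ≤ Real.sin (a * t) ^ 2 := by
    intro t h0 h1
    have h2 := strictConcaveOn_sin_Icc.concaveOn.2 ⟨h0, h1⟩ ⟨le_rfl, Real.pi_pos.le⟩ ha0
      (sub_nonneg.2 ha1) (by ring)
    simp only [smul_eq_mul, Real.sin_zero, mul_zero, add_zero] at h2
    rw [← mul_pow]
    exact pow_le_pow_left₀ (mul_nonneg ha0 (Real.sin_nonneg_of_nonneg_of_le_pi h0 h1)) h2 2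
  rcases abs_cases t with ⟨h, h'⟩ | ⟨h, h'⟩
  · exact key t h' (h ▸ ht)
  · have := key (-t) (by linarith) (h ▸ ht)
    simpa [Real.sin_neg] using this

/-- A combination of `1` and `exp (i α)` with nonnegative coefficients lies in the sector between
them. -/
theorem arg_mem_Icc_of_sector {x y α : ℝ} (hx : 0 ≤ x) (hy : 0 ≤ y) (hα0 : 0 ≤ α)
    (hα : α ≤ Real.pi) :
    ((x : ℂ) + y * Complex.exp (α * Complex.I)).arg ∈ Icc 0 α := by
  set z := (x : ℂ) + y * Complex.exp (α * Complex.I) with hz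
  have hre : z.re = x + y * Real.cos α := by simp [hz, Complex.exp_ofReal_mul_I_re]
  have him : z.im = y * Real.sin α := by simp [hz, Complex.exp_ofReal_mul_I_im]
  have hsin := Real.sin_nonneg_of_nonneg_of_le_pi hα0 hα
  have h0 : 0 ≤ z.arg := Complex.arg_nonneg_iff.2 (by rw [him]; positivity)
  refine ⟨h0, ?_⟩
  by_contra! hlt
  have hpi := Complex.arg_le_pi z
  have hz0 : z ≠ 0 := by
    rintro h
    rw [h, Complex.arg_zero] at hlt
    linarith
  have h1 : ‖z‖ * Real.sin (z.arg - α) = -(x * Real.sin α) := by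
    rw [Real.sin_sub]
    have e1 := Complex.norm_mul_cos_arg z
    have e2 := Complex.norm_mul_sin_arg z
    have : ‖z‖ * (Real.sin z.arg * Real.cos α - Real.cos z.arg * Real.sin α)
        = (‖z‖ * Real.sin z.arg) * Real.cos α - (‖z‖ * Real.cos z.arg) * Real.sin α := by ring
    rw [this, e1, e2, hre, him]
    ring
  have h2 : 0 ≤ Real.sin (z.arg - α) :=
    Real.sin_nonneg_of_nonneg_of_le_pi (by linarith) (by linarith)
  have h3 : Real.sin (z.arg - α) = 0 := by
    have h4 : ‖z‖ * Real.sin (z.arg - α) ≤ 0 := by rw [h1]; nlinarith [mul_nonneg hx hsin]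
    have h5 : 0 < ‖z‖ := norm_pos_iff.2 hz0
    nlinarith
  have h4 : z.arg - α = Real.pi := by
    by_contra hne
    have : z.arg - α < Real.pi := lt_of_le_of_ne (by linarith) hne
    exact (Real.sin_pos_of_pos_of_lt_pi (by linarith) this).ne' h3
  have h5 : α = 0 := by linarith
  have h6 : z.arg = Real.pi := by linarith
  have h7 := (Complex.arg_eq_pi_iff.1 h6).1
  rw [hre, h5, Real.cos_zero] at h7
  linarith

/-- The point of the cone of revolution at distance `ρ` from the apex and longitude `θ`. -/
def conePoint (p : EuclideanSpace ℝ (Fin 3)) (a b ρ θ : ℝ) : EuclideanSpace ℝ (Fin 3) :=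
  p + ρ • !₂[a * Real.cos θ, a * Real.sin θ, b]

variable {p : EuclideanSpace ℝ (Fin 3)} {a b : ℝ}

theorem dist_conePoint_sq (hab : a ^ 2 + b ^ 2 = 1) (ρ ρ' θ θ' : ℝ) :
    dist (conePoint p a b ρ θ) (conePoint p a b ρ' θ') ^ 2
      = (ρ - ρ') ^ 2 + 4 * (ρ * ρ') * (a ^ 2 * Real.sin ((θ - θ') / 2) ^ 2) := by
  rw [EuclideanSpace.dist_eq, Real.sq_sqrt (Finset.sum_nonneg fun i _ => sq_nonneg _)]
  simp only [Fin.sum_univ_three, Real.dist_eq, sq_abs, conePoint]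
  have h := Real.cos_sub θ θ'
  have h2 : Real.cos (θ - θ') = 1 - 2 * Real.sin ((θ - θ') / 2) ^ 2 := by
    rw [← Real.cos_two_mul_eq_one_sub]; ring_nf
  simp
  linear_combination a ^ 2 * ρ ^ 2 * Real.sin_sq_add_cos_sq θ
    + a ^ 2 * ρ' ^ 2 * Real.sin_sq_add_cos_sq θ'
    - 2 * a ^ 2 * ρ * ρ' * (h2 - h) + (ρ - ρ') ^ 2 * hab

theorem dist_conePoint_apex (hab : a ^ 2 + b ^ 2 = 1) {ρ : ℝ} (hρ : 0 ≤ ρ) (θ : ℝ) :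
    dist (conePoint p a b ρ θ) p = ρ := by
  have h := dist_conePoint_sq (p := p) hab ρ 0 θ 0
  have h0 : conePoint p a b 0 0 = p := by simp [conePoint]
  rw [h0] at h
  have : dist (conePoint p a b ρ θ) p ^ 2 = ρ ^ 2 := by rw [h]; ring
  exact (pow_left_inj₀ dist_nonneg hρ two_ne_zero).1 this

theorem mem_cone_iff {x : EuclideanSpace ℝ (Fin 3)} :
    x ∈ coneOfRevolution p a b ↔ ∃ ρ θ : ℝ, 0 ≤ ρ ∧ x = conePoint p a b ρ θ := Iff.rfl

theorem conePoint_eq (ha0 : 0 < a) (hab : a ^ 2 + b ^ 2 = 1) {ρ ρ' θ θ' : ℝ} (hρ : 0 ≤ ρ)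
    (hρ' : 0 < ρ') (h : conePoint p a b ρ θ = conePoint p a b ρ' θ') :
    ρ' = ρ ∧ Real.cos θ' = Real.cos θ := by
  have h1 := dist_conePoint_apex (p := p) hab hρ θ
  rw [h, dist_conePoint_apex hab hρ'.le] at h1
  subst h1
  refine ⟨rfl, ?_⟩
  have h2 := congrArg (fun x : EuclideanSpace ℝ (Fin 3) => x 0) h
  simp [conePoint, hρ'.ne', ha0.ne'] at h2
  exact h2.symm

theorem intrinsicEDist_le {X : Set (EuclideanSpace ℝ (Fin 3))} {x y : EuclideanSpace ℝ (Fin 3)}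
    {c : ℝ → EuclideanSpace ℝ (Fin 3)} (hc : ContinuousOn c (Icc 0 1)) (hX : MapsTo c (Icc 0 1) X)
    (h0 : c 0 = x) (h1 : c 1 = y) : intrinsicEDist X x y ≤ eVariationOn c (Icc 0 1) := by
  unfold intrinsicEDist
  exact iInf_le_of_le c <| iInf_le_of_le hc <| iInf_le_of_le hX <| iInf_le_of_le h0 <|
    iInf_le_of_le h1 le_rfl

theorem edist_le_intrinsicEDist (X : Set (EuclideanSpace ℝ (Fin 3)))
    (x y : EuclideanSpace ℝ (Fin 3)) : edist x y ≤ intrinsicEDist X x y := by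
  simp only [intrinsicEDist, le_iInf_iff]
  rintro c - - rfl rfl
  exact eVariationOn.edist_le c (left_mem_Icc.2 zero_le_one) (right_mem_Icc.2 zero_le_one)

/-- The straight segment in the developed sector of angle aδ ≤ π is rolled up onto the cone. It
stays in the sector by convexity, and rolling up is a contraction for the distance of ℝ³, so the
length of the resulting curve is at most that of the segment. -/
theorem intrinsicEDist_conePoint_le (ha0 : 0 < a) (ha1 : a ≤ 1) (hab : a ^ 2 + b ^ 2 = 1)
    {ρ ρ' : ℝ} (hρ : 0 ≤ ρ) (hρ' : 0 ≤ ρ') (θ : ℝ) {ε : ℝ} (hε : ε = 1 ∨ ε = -1) {δ : ℝ}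
    (hδ0 : 0 ≤ δ) (hδ : δ ≤ Real.pi) :
    intrinsicEDist (coneOfRevolution p a b) (conePoint p a b ρ θ) (conePoint p a b ρ' (θ + ε * δ))
      ≤ ENNReal.ofReal ‖(ρ : ℂ) * Complex.exp ((0 : ℝ) * Complex.I)
          - ρ' * Complex.exp ((a * δ : ℝ) * Complex.I)‖ := by
  have hpi := Real.pi_pos
  have haδ0 : 0 ≤ a * δ := by positivity
  have haδ : a * δ ≤ Real.pi := by nlinarith
  let z : ℝ → ℂ := fun t => ((1 - t) * ρ : ℝ) + (t * ρ' : ℝ) * Complex.exp ((a * δ : ℝ) * Complex.I)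
  -- Angles in the development are `a` times longitudes, hence the division by `a`; ε is the sense
  -- of rotation.
  let c : ℝ → EuclideanSpace ℝ (Fin 3) := fun t => conePoint p a b ‖z t‖ (θ + ε * ((z t).arg / a))
  have harg : ∀ t ∈ Icc (0 : ℝ) 1, (z t).arg ∈ Icc 0 (a * δ) := fun t ht =>
    arg_mem_Icc_of_sector (mul_nonneg (by linarith [ht.2]) hρ) (mul_nonneg ht.1 hρ') haδ0 haδ
  set L : ℝ := ‖(ρ : ℂ) * Complex.exp ((0 : ℝ) * Complex.I)
          - ρ' * Complex.exp ((a * δ : ℝ) * Complex.I)‖ with hL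
  have hLip : ∀ t ∈ Icc (0 : ℝ) 1, ∀ t' ∈ Icc (0 : ℝ) 1, dist (c t) (c t') ≤ L * dist t t' := by
    intro t ht t' ht'
    have h1 : dist (c t) (c t') ≤ ‖z t - z t'‖ := by
      refine le_of_sq_le_sq ?_ (norm_nonneg _)
      have h2 := norm_sub_sq_polar ‖z t‖ ‖z t'‖ (z t).arg (z t').arg
      rw [norm_polar, norm_polar] at h2
      rw [h2, dist_conePoint_sq hab]
      have h3 : |((z t).arg / a - (z t').arg / a) / 2| ≤ Real.pi := by
        have e1 : ∀ t ∈ Icc (0 : ℝ) 1, 0 ≤ (z t).arg / a ∧ (z t).arg / a ≤ δ := fun t ht =>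
          ⟨div_nonneg (harg t ht).1 ha0.le, by
            rw [div_le_iff₀ ha0]; linarith [(harg t ht).2]⟩
        have e2 := e1 t ht
        have e3 := e1 t' ht'
        rw [abs_le]; constructor <;> linarith [e2.1, e2.2, e3.1, e3.2]
      have h4 := mul_sin_sq_le_sin_mul_sq ha0.le ha1 h3
      have h5 : a * (((z t).arg / a - (z t').arg / a) / 2) = ((z t).arg - (z t').arg) / 2 := by
        field_simp
      rw [h5] at h4
      have h6 : Real.sin ((θ + ε * ((z t).arg / a) - (θ + ε * ((z t').arg / a))) / 2) ^ 2
          = Real.sin (((z t).arg / a - (z t').arg / a) / 2) ^ 2 := by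
        have h7 : (θ + ε * ((z t).arg / a) - (θ + ε * ((z t').arg / a))) / 2
            = ε * (((z t).arg / a - (z t').arg / a) / 2) := by ring
        rw [h7]
        rcases hε with h | h
        · rw [h, one_mul]
        · rw [h, neg_one_mul, Real.sin_neg, neg_sq]
      rw [h6]
      gcongr
    refine h1.trans (le_of_eq ?_)
    have h2 : z t - z t' = ((t' - t : ℝ) : ℂ) * ((ρ : ℂ) * Complex.exp ((0 : ℝ) * Complex.I)
          - ρ' * Complex.exp ((a * δ : ℝ) * Complex.I)) := by
      simp only [z]
      push_cast
      simp
      ring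
    rw [h2, norm_mul, Complex.norm_real, mul_comm, Real.norm_eq_abs, dist_comm, Real.dist_eq]
  have hLip' : LipschitzOnWith (Real.toNNReal L) c (Icc 0 1) := by
    refine LipschitzOnWith.of_dist_le_mul fun t ht t' ht' => ?_
    rw [Real.coe_toNNReal _ (norm_nonneg _)]
    exact hLip t ht t' ht'
  have hc0 : c 0 = conePoint p a b ρ θ := by
    simp [c, z, Complex.arg_ofReal_of_nonneg hρ, abs_of_nonneg hρ]
  have hc1 : c 1 = conePoint p a b ρ' (θ + ε * δ) := by
    -- At the apex the argument is the default value 0 rather than aδ, but the longitude is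
    -- irrelevant there.
    rcases hρ'.eq_or_lt with h | h
    · simp [c, z, ← h, conePoint]
    · have h1 : (z 1).arg = a * δ := by
        simp only [z, sub_self, zero_mul, one_mul, Complex.ofReal_zero, zero_add]
        rw [Complex.arg_real_mul _ h, Complex.arg_exp_mul_I, toIocMod_eq_self]
        constructor <;> linarith
      have h2 : ‖z 1‖ = ρ' := by
        simp only [z, sub_self, zero_mul, one_mul, Complex.ofReal_zero, zero_add]
        rw [norm_mul, Complex.norm_exp_ofReal_mul_I, Complex.norm_real, mul_one,
          Real.norm_of_nonneg hρ']
      simp only [c, h1, h2]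
      rw [mul_div_cancel_left₀ _ ha0.ne']
  have hmaps : MapsTo c (Icc 0 1) (coneOfRevolution p a b) := fun t _ =>
    mem_cone_iff.2 ⟨_, _, norm_nonneg _, rfl⟩
  refine (intrinsicEDist_le hLip'.continuousOn hmaps hc0 hc1).trans ?_
  have h1 := hLip'.comp_eVariationOn_le (g := id) (s := Icc 0 1) (mapsTo_id _)
  have h2 := (monotone_id.monotoneOn (Icc (0 : ℝ) 1)).eVariationOn_eq
    (left_mem_Icc.2 zero_le_one) (right_mem_Icc.2 zero_le_one)
  rw [inter_self, id, id, sub_zero, ENNReal.ofReal_one] at h2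
  rw [h2, mul_one] at h1
  exact h1

/-- The fold of the cone onto a half-plane sector does not increase short distances away from the
apex by more than a factor close to one. -/
theorem fold_dist_le (ha0 : 0 < a) (ha1 : a ≤ 1) (hab : a ^ 2 + b ^ 2 = 1) {ρ ρ' m : ℝ}
    (hm : 0 < m) (hρ : m ≤ ρ) (hρ' : m ≤ ρ') (θ θ' : ℝ) {κ : ℝ} (hκ0 : 0 < κ) (hκ1 : κ ≤ 1)
    (hd : dist (conePoint p a b ρ θ) (conePoint p a b ρ' θ') ≤ a * m * κ) :
    (1 - κ ^ 2) * dist ((ρ : ℂ) * Complex.exp ((a * Real.arccos (Real.cos θ) : ℝ) * Complex.I))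
        (ρ' * Complex.exp ((a * Real.arccos (Real.cos θ') : ℝ) * Complex.I))
      ≤ dist (conePoint p a b ρ θ) (conePoint p a b ρ' θ') := by
  set φ := Real.arccos (Real.cos θ) with hφ
  set φ' := Real.arccos (Real.cos θ') with hφ'
  set D := dist (conePoint p a b ρ θ) (conePoint p a b ρ' θ') with hD
  have hpi := Real.pi_pos
  set η := |φ - φ'| / 2 with hη
  have hη0 : 0 ≤ η := by positivity
  have hη1 : η ≤ Real.pi / 2 := by
    have : |φ - φ'| ≤ Real.pi := by
      rw [abs_le]
      constructor <;> linarith [Real.arccos_nonneg (Real.cos θ), Real.arccos_le_pi (Real.cos θ),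
        Real.arccos_nonneg (Real.cos θ'), Real.arccos_le_pi (Real.cos θ')]
    linarith
  have hcos : ∀ θ, Real.cos (Real.arccos (Real.cos θ)) = Real.cos θ := fun θ =>
    Real.cos_arccos (Real.neg_one_le_cos θ) (Real.cos_le_one θ)
  have hsin : ∀ θ, Real.sin (Real.arccos (Real.cos θ)) = |Real.sin θ| := fun θ => by
    rw [Real.sin_arccos, ← Real.abs_sin_eq_sqrt_one_sub_cos_sq]
  have hsq : ∀ x : ℝ, Real.sin (|x| / 2) ^ 2 = Real.sin (x / 2) ^ 2 := fun x => by
    rcases abs_cases x with h | h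
    · rw [h.1]
    · rw [h.1, neg_div, Real.sin_neg, neg_sq]
  -- Folding replaces sin θ by its absolute value, and sin θ sin θ' ≤ |sin θ sin θ'|, so the cosine
  -- of the angle between the two longitudes can only grow.
  have hfold : Real.sin η ^ 2 ≤ Real.sin ((θ - θ') / 2) ^ 2 := by
    rw [hη, hsq]
    have e : ∀ x y : ℝ, Real.cos (x - y) = 1 - 2 * Real.sin ((x - y) / 2) ^ 2 := fun x y => by
      rw [← Real.cos_two_mul_eq_one_sub]; ring_nf
    have e1 := e φ φ'
    have e2 := e θ θ'
    rw [Real.cos_sub] at e1 e2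
    rw [hφ, hφ', hcos, hcos, hsin, hsin, ← abs_mul] at e1
    have := le_abs_self (Real.sin θ * Real.sin θ')
    linarith
  have hDsq := dist_conePoint_sq (p := p) hab ρ ρ' θ θ'
  rw [← hD] at hDsq
  have hρ0 : 0 < ρ := hm.trans_le hρ
  have hρ0' : 0 < ρ' := hm.trans_le hρ'
  have hmm : m * m ≤ ρ * ρ' := mul_le_mul hρ hρ' hm.le hρ0.le
  have hsinη : 0 ≤ Real.sin η := Real.sin_nonneg_of_nonneg_of_le_pi hη0 (by linarith)
  have hD0 : 0 ≤ D := dist_nonneg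
  have hlow : (ρ - ρ') ^ 2 + 4 * (ρ * ρ') * (a ^ 2 * Real.sin η ^ 2) ≤ D ^ 2 := by
    rw [hDsq]; gcongr
  -- Away from the apex a small distance in space forces a small angle: 2am sin η ≤ D ≤ amκ, and sin
  -- η ≥ 2η/π ≥ η/2.
  have hsmall : η ≤ κ := by
    have h1 : 2 * (a * m * Real.sin η) ≤ D := by
      refine le_of_sq_le_sq ?_ hD0
      calc (2 * (a * m * Real.sin η)) ^ 2 = 4 * (m * m) * (a ^ 2 * Real.sin η ^ 2) := by ring
        _ ≤ 4 * (ρ * ρ') * (a ^ 2 * Real.sin η ^ 2) := by gcongr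
        _ ≤ D ^ 2 := by nlinarith [sq_nonneg (ρ - ρ')]
    have h2 : a * m * (2 * Real.sin η) ≤ a * m * κ := by linarith
    have h3 : 2 * Real.sin η ≤ κ := le_of_mul_le_mul_left h2 (by positivity)
    have h4 := Real.mul_le_sin hη0 hη1
    have h5 : η / 2 ≤ 2 / Real.pi * η := by
      rw [div_mul_eq_mul_div, le_div_iff₀ hpi]
      nlinarith [Real.pi_le_four]
    linarith
  -- For small η the spatial chord and the developed arc differ by a factor 1 - O(η²); this is the
  -- only loss in the comparison.
  have hsinlow : (1 - κ ^ 2) * η ≤ Real.sin η := by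
    rcases hη0.eq_or_lt with h | h
    · rw [← h]; simp
    · have h1 := Real.sin_gt_sub_cube h
      have h2 : η ^ 2 ≤ κ ^ 2 := pow_le_pow_left₀ hη0 hsmall 2
      nlinarith [mul_le_mul_of_nonneg_left h2 hη0, mul_nonneg hη0 (sq_nonneg κ)]
  have hk : 0 ≤ 1 - κ ^ 2 := by nlinarith
  refine le_of_sq_le_sq ?_ hD0
  rw [mul_pow, dist_eq_norm, norm_sub_sq_polar]
  have h1 : Real.sin ((a * φ - a * φ') / 2) ^ 2 ≤ (a * η) ^ 2 := by
    rw [← hsq]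
    have h2 : |a * φ - a * φ'| / 2 = a * η := by
      rw [← mul_sub, abs_mul, abs_of_pos ha0, hη]; ring
    rw [h2]
    exact pow_le_pow_left₀ (Real.sin_nonneg_of_nonneg_of_le_pi (by positivity) (by nlinarith))
      (Real.sin_le (by positivity)) 2
  have h2 : (1 - κ ^ 2) ^ 2 ≤ 1 := pow_le_one₀ hk (by nlinarith)
  have h3 : (1 - κ ^ 2) ^ 2 * (a * η) ^ 2 ≤ a ^ 2 * Real.sin η ^ 2 := by
    have : ((1 - κ ^ 2) * η) ^ 2 ≤ Real.sin η ^ 2 := pow_le_pow_left₀ (by positivity) hsinlow 2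
    calc _ = a ^ 2 * ((1 - κ ^ 2) * η) ^ 2 := by ring
      _ ≤ _ := by gcongr
  calc (1 - κ ^ 2) ^ 2 * ((ρ - ρ') ^ 2 + 4 * (ρ * ρ') * Real.sin ((a * φ - a * φ') / 2) ^ 2)
      ≤ (1 - κ ^ 2) ^ 2 * ((ρ - ρ') ^ 2 + 4 * (ρ * ρ') * (a * η) ^ 2) := by gcongr
    _ = (1 - κ ^ 2) ^ 2 * (ρ - ρ') ^ 2 + 4 * (ρ * ρ') * ((1 - κ ^ 2) ^ 2 * (a * η) ^ 2) := by ring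
    _ ≤ 1 * (ρ - ρ') ^ 2 + 4 * (ρ * ρ') * (a ^ 2 * Real.sin η ^ 2) := by gcongr
    _ ≤ D ^ 2 := by rw [one_mul]; exact hlow

/-- A curve on the cone from one side of a large circle to the other is at least as long as the
chord of the developed sector. -/
theorem le_eVariationOn_cone (ha0 : 0 < a) (ha1 : a ≤ 1) (hab : a ^ 2 + b ^ 2 = 1) {R : ℝ}
    (hR : 0 ≤ R) {c : ℝ → EuclideanSpace ℝ (Fin 3)} (hc : ContinuousOn c (Icc 0 1))
    (hX : MapsTo c (Icc 0 1) (coneOfRevolution p a b)) (h0 : c 0 = conePoint p a b R 0)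
    (h1 : c 1 = conePoint p a b R Real.pi) :
    ENNReal.ofReal (2 * R * Real.sin (Real.pi * a / 2)) ≤ eVariationOn c (Icc 0 1) := by
  have hpi := Real.pi_pos
  have m0 : (0 : ℝ) ∈ Icc (0 : ℝ) 1 := left_mem_Icc.2 zero_le_one
  have m1 : (1 : ℝ) ∈ Icc (0 : ℝ) 1 := right_mem_Icc.2 zero_le_one
  obtain ⟨t₀, ht₀, hmin⟩ := isCompact_Icc.exists_isMinOn ⟨0, m0⟩
    (f := fun t => dist (c t) p) ((continuous_id.dist continuous_const).comp_continuousOn hc)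
  -- A curve through the apex consists of two pieces of length at least R each. Any other curve
  -- stays at a positive distance `m` from the apex, where folding is almost contracting on short
  -- steps.
  rcases (dist_nonneg (x := c t₀) (y := p)).eq_or_lt with hz | hpos
  · have hcp : c t₀ = p := dist_eq_zero.1 hz.symm
    have hadd := eVariationOn.Icc_add_Icc c (s := Icc 0 1) ht₀.1 ht₀.2 ht₀
    rw [inter_self] at hadd
    rw [← hadd]
    have e0 : edist (c 0) (c t₀) ≤ eVariationOn c (Icc 0 1 ∩ Icc 0 t₀) :=
      eVariationOn.edist_le c ⟨m0, left_mem_Icc.2 ht₀.1⟩ ⟨ht₀, right_mem_Icc.2 ht₀.1⟩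
    have e1 : edist (c 1) (c t₀) ≤ eVariationOn c (Icc 0 1 ∩ Icc t₀ 1) :=
      eVariationOn.edist_le c ⟨m1, right_mem_Icc.2 ht₀.2⟩ ⟨ht₀, left_mem_Icc.2 ht₀.2⟩
    rw [hcp, edist_dist, h0, dist_conePoint_apex hab hR] at e0
    rw [hcp, edist_dist, h1, dist_conePoint_apex hab hR] at e1
    refine le_trans ?_ (add_le_add e0 e1)
    rw [← ENNReal.ofReal_add hR hR]
    refine ENNReal.ofReal_le_ofReal ?_
    nlinarith [Real.sin_le_one (Real.pi * a / 2)]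
  · set m := dist (c t₀) p with hm
    have hcone : ∀ t : Icc (0 : ℝ) 1, ∃ ρθ : ℝ × ℝ, m ≤ ρθ.1 ∧ c t = conePoint p a b ρθ.1 ρθ.2 := by
      rintro ⟨t, ht⟩
      obtain ⟨ρ, θ, hρ, hct⟩ := mem_cone_iff.1 (hX ht)
      refine ⟨(ρ, θ), ?_, hct⟩
      have h2 : m ≤ dist (c t) p := hmin ht
      rwa [hct, dist_conePoint_apex hab hρ] at h2
    choose P hPm hP using hcone
    have hcomp : ∀ κ : ℝ, 0 < κ → κ ≤ 1 →
        ENNReal.ofReal ((1 - κ ^ 2) * (2 * R * Real.sin (Real.pi * a / 2)))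
          ≤ eVariationOn c (Icc 0 1) := by
      intro κ hκ0 hκ1
      have hk : 0 ≤ 1 - κ ^ 2 := by nlinarith
      obtain ⟨δ, hδ, hδc⟩ := Metric.uniformContinuousOn_iff.1
        (isCompact_Icc.uniformContinuousOn_of_continuous hc) (a * m * κ) (by positivity)
      obtain ⟨N, hN⟩ := exists_nat_one_div_lt hδ
      have hN0 : (0 : ℝ) < (N + 1 : ℕ) := by positivity
      -- Equidistant subdivision into N + 1 steps, capped at 1 so that it is a monotone sequence in
      -- [0, 1].
      let u : ℕ → ℝ := fun i => min ((i : ℝ) / (N + 1 : ℕ)) 1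
      have hu : ∀ i, u i ∈ Icc (0 : ℝ) 1 := fun i => ⟨le_min (by positivity) zero_le_one,
        min_le_right _ _⟩
      have humono : Monotone u := fun i j hij => by
        have : (i : ℝ) ≤ j := by exact_mod_cast hij
        exact min_le_min_right _ (by gcongr)
      have hustep : ∀ i, dist (u i) (u (i + 1)) < δ := fun i => by
        have e1 : u (i + 1) - u i ≤ 1 / (N + 1 : ℕ) := by
          have e2 : ((i + 1 : ℕ) : ℝ) / (N + 1 : ℕ) = (i : ℝ) / (N + 1 : ℕ) + 1 / (N + 1 : ℕ) := by
            push_cast; ring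
          simp only [u]
          rw [e2]
          have e3 : 0 < 1 / ((N + 1 : ℕ) : ℝ) := by positivity
          rcases min_cases ((i : ℝ) / (N + 1 : ℕ)) 1 with h | h
          · linarith [min_le_left ((i : ℝ) / (N + 1 : ℕ) + 1 / (N + 1 : ℕ)) 1]
          · linarith [min_le_right ((i : ℝ) / (N + 1 : ℕ) + 1 / (N + 1 : ℕ)) 1]
        rw [dist_comm, Real.dist_eq, abs_of_nonneg (sub_nonneg.2 (humono i.le_succ))]
        refine e1.trans_lt ?_
        push_cast
        exact hN
      let F : ℕ → ℂ := fun i => ((P ⟨u i, hu i⟩).1 : ℂ) *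
        Complex.exp ((a * Real.arccos (Real.cos (P ⟨u i, hu i⟩).2) : ℝ) * Complex.I)
      have hstep : ∀ i, (1 - κ ^ 2) * dist (F i) (F (i + 1)) ≤ dist (c (u i)) (c (u (i + 1))) := by
        intro i
        have e1 := hδc (u i) (hu i) (u (i + 1)) (hu (i + 1)) (hustep i)
        have e2 := hP ⟨u i, hu i⟩
        have e3 := hP ⟨u (i + 1), hu (i + 1)⟩
        simp only at e2 e3
        rw [e2, e3] at e1 ⊢
        exact fold_dist_le ha0 ha1 hab hpos (hPm _) (hPm _) _ _ hκ0 hκ1 e1.le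
      have hend : ∀ t (ht : t ∈ Icc (0 : ℝ) 1) (θ : ℝ), c t = conePoint p a b R θ →
          (P ⟨t, ht⟩).1 = R ∧ Real.cos (P ⟨t, ht⟩).2 = Real.cos θ := by
        intro t ht θ hct
        have e1 := hP ⟨t, ht⟩
        have e2 := hPm ⟨t, ht⟩
        simp only at e1
        rw [hct] at e1
        refine conePoint_eq ha0 hab hR (hpos.trans_le e2) e1
      have hu0 : u 0 = 0 := by simp [u]
      have huN : u (N + 1) = 1 := by simp only [u]; rw [div_self hN0.ne', min_self]
      have hF : 2 * R * Real.sin (Real.pi * a / 2) ≤ dist (F 0) (F (N + 1)) := by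
        obtain ⟨e1, e2⟩ := hend (u 0) (hu 0) 0 (by rw [hu0, h0])
        obtain ⟨e3, e4⟩ := hend (u (N + 1)) (hu (N + 1)) Real.pi (by rw [huN, h1])
        simp only [F]
        rw [e1, e2, e3, e4, Real.cos_zero, Real.arccos_one, Real.cos_pi, Real.arccos_neg_one]
        refine le_of_sq_le_sq ?_ dist_nonneg
        rw [dist_eq_norm, norm_sub_sq_polar]
        have e5 : (a * 0 - a * Real.pi) / 2 = -(Real.pi * a / 2) := by ring
        rw [e5, Real.sin_neg]
        apply le_of_eq
        ring
      refine le_trans ?_ (eVariationOn.sum_le (f := c) (n := N + 1) humono hu)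
      simp only [edist_dist]
      rw [← ENNReal.ofReal_sum_of_nonneg fun i _ => dist_nonneg]
      refine ENNReal.ofReal_le_ofReal ?_
      calc _ ≤ (1 - κ ^ 2) * dist (F 0) (F (N + 1)) := by gcongr
        _ ≤ (1 - κ ^ 2) * ∑ i ∈ Finset.range (N + 1), dist (F i) (F (i + 1)) := by
          gcongr; exact dist_le_range_sum_dist _ _
        _ = ∑ i ∈ Finset.range (N + 1), (1 - κ ^ 2) * dist (F i) (F (i + 1)) := Finset.mul_sum _ _ _
        _ ≤ _ := Finset.sum_le_sum fun i _ => by rw [dist_comm (c _)]; exact hstep i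
    -- Refining the subdivision lets κ tend to 0 and removes the factor 1 - κ².
    refine le_of_tendsto (x := 𝓝[>] (0 : ℝ)) ?_ (f := fun κ : ℝ => ENNReal.ofReal ((1 - κ ^ 2) *
      (2 * R * Real.sin (Real.pi * a / 2)))) ?_
    · have e1 : Tendsto (fun κ : ℝ => (1 - κ ^ 2) * (2 * R * Real.sin (Real.pi * a / 2))) (𝓝 0)
          (𝓝 ((1 - 0 ^ 2) * (2 * R * Real.sin (Real.pi * a / 2)))) :=
        Continuous.tendsto (by fun_prop) 0
      simp only [ne_eq, OfNat.ofNat_ne_zero, not_false_eq_true, zero_pow, sub_zero, one_mul] at e1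
      exact ENNReal.tendsto_ofReal (e1.mono_left nhdsWithin_le_nhds)
    · filter_upwards [Ioc_mem_nhdsGT (zero_lt_one' ℝ)] with κ hκ using hcomp κ hκ.1 hκ.2

/-- Two longitudes differ by at most π after reduction modulo 2π, so the development has angle at
most πa, with half-angle at most πa/2. Longitudes 0 and π on a circle attain this. -/
theorem hasOpening_cone (ha0 : 0 < a) (ha1 : a ≤ 1) (hab : a ^ 2 + b ^ 2 = 1) :
    HasOpening (fun x y : coneOfRevolution p a b => intrinsicEDist (coneOfRevolution p a b) x y)
      (Real.sin (Real.pi * a / 2)) := by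
  have hpi := Real.pi_pos
  have hrad : ∀ x : coneOfRevolution p a b, ∃ θ,
      (x : EuclideanSpace ℝ (Fin 3)) = conePoint p a b (dist (x : EuclideanSpace ℝ (Fin 3)) p) θ := by
    rintro ⟨x, hx⟩
    obtain ⟨ρ, θ, hρ, rfl⟩ := mem_cone_iff.1 hx
    exact ⟨θ, by rw [dist_conePoint_apex hab hρ]⟩
  have hpair : ∀ x y : coneOfRevolution p a b, ∃ δ, 0 ≤ δ ∧ δ ≤ Real.pi ∧
      intrinsicEDist (coneOfRevolution p a b) x y ≤ ENNReal.ofReal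
        ‖((dist (x : EuclideanSpace ℝ (Fin 3)) p : ℝ) : ℂ) * Complex.exp ((0 : ℝ) * Complex.I)
          - (dist (y : EuclideanSpace ℝ (Fin 3)) p : ℝ) *
            Complex.exp ((a * δ : ℝ) * Complex.I)‖ := by
    intro x y
    obtain ⟨θ, hx⟩ := hrad x
    obtain ⟨θ', hy⟩ := hrad y
    set η := (Complex.exp ((θ' - θ : ℝ) * Complex.I)).arg with hη
    have h1 : Complex.exp (η * Complex.I) = Complex.exp ((θ' - θ : ℝ) * Complex.I) := by
      have := norm_polar (Complex.exp ((θ' - θ : ℝ) * Complex.I))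
      rwa [Complex.norm_exp_ofReal_mul_I, Complex.ofReal_one, one_mul] at this
    have h2 : Complex.exp ((θ + η : ℝ) * Complex.I) = Complex.exp (θ' * Complex.I) := by
      rw [Complex.ofReal_add, add_mul, Complex.exp_add, h1, ← Complex.exp_add]
      congr 1
      push_cast
      ring
    have hcos : Real.cos (θ + η) = Real.cos θ' := by
      have := congrArg Complex.re h2
      rwa [Complex.exp_ofReal_mul_I_re, Complex.exp_ofReal_mul_I_re] at this
    have hsin : Real.sin (θ + η) = Real.sin θ' := by
      have := congrArg Complex.im h2
      rwa [Complex.exp_ofReal_mul_I_im, Complex.exp_ofReal_mul_I_im] at this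
    have hy' : (y : EuclideanSpace ℝ (Fin 3))
        = conePoint p a b (dist (y : EuclideanSpace ℝ (Fin 3)) p) (θ + η) := by
      rw [hy, dist_conePoint_apex hab dist_nonneg, conePoint, conePoint, hcos, hsin]
    refine ⟨|η|, abs_nonneg _, Complex.abs_arg_le_pi _, ?_⟩
    conv_lhs => rw [hx, hy']
    rcases abs_cases η with h | h
    · have := intrinsicEDist_conePoint_le (p := p) ha0 ha1 hab (dist_nonneg (x := x.1) (y := p))
        (dist_nonneg (x := y.1) (y := p)) θ (Or.inl rfl) (abs_nonneg η) (Complex.abs_arg_le_pi _)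
      rw [one_mul] at this
      rwa [h.1] at this ⊢
    · have := intrinsicEDist_conePoint_le (p := p) ha0 ha1 hab (dist_nonneg (x := x.1) (y := p))
        (dist_nonneg (x := y.1) (y := p)) θ (Or.inr rfl) (abs_nonneg η) (Complex.abs_arg_le_pi _)
      rw [h.1] at this ⊢
      rwa [neg_one_mul, neg_neg] at this
  refine ⟨fun x => dist (x : EuclideanSpace ℝ (Fin 3)) p, fun _ => dist_nonneg, ?_, ?_, ?_, ?_, ?_⟩
  · exact ⟨⟨p, mem_cone_iff.2 ⟨0, 0, le_rfl, by simp [conePoint]⟩⟩, dist_self p⟩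
  · intro x y
    refine le_trans ?_ (edist_le_intrinsicEDist _ _ _)
    rw [edist_dist]
    exact ENNReal.ofReal_le_ofReal (abs_dist_sub_le _ _ _)
  · intro x y
    obtain ⟨δ, -, -, h⟩ := hpair x y
    exact h.trans (ENNReal.ofReal_le_ofReal (norm_sub_polar_le_add dist_nonneg dist_nonneg _ _))
  · intro x y
    obtain ⟨δ, hδ0, hδ, h⟩ := hpair x y
    refine h.trans (ENNReal.ofReal_le_ofReal (norm_sub_polar_le dist_nonneg ?_))
    have e1 : (0 - a * δ) / 2 = -(a * δ / 2) := by ring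
    have e2 : a * δ ≤ Real.pi * a := by nlinarith
    have e3 : Real.pi * a ≤ Real.pi := by nlinarith
    have e4 : 0 ≤ a * δ := by positivity
    rw [e1, Real.sin_neg, abs_neg, abs_of_nonneg
      (Real.sin_nonneg_of_nonneg_of_le_pi (by linarith) (by linarith))]
    exact Real.sin_le_sin_of_le_of_le_pi_div_two (by linarith) (by linarith) (by linarith)
  · intro R hR
    refine ⟨⟨conePoint p a b R 0, mem_cone_iff.2 ⟨_, _, hR, rfl⟩⟩,
      ⟨conePoint p a b R Real.pi, mem_cone_iff.2 ⟨_, _, hR, rfl⟩⟩,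
      dist_conePoint_apex hab hR _, dist_conePoint_apex hab hR _, ?_⟩
    simp only [intrinsicEDist, le_iInf_iff]
    intro c hc hX h0 h1
    exact le_eVariationOn_cone ha0 ha1 hab hR hc hX h0 h1

/-- An isometry and its inverse give equal openings, and the sine is injective on the angles πa/2
and π/(2n), which lie in [0, π/2]. -/
theorem cone_slope_eq_of_isometric (ha0 : 0 < a) (ha1 : a ≤ 1) (hab : a ^ 2 + b ^ 2 = 1) {n : ℕ}
    (hn : 0 < n) (h : IsIsometricToPlaneQuotient (coneOfRevolution p a b) n) : a = 1 / n := by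
  obtain ⟨e, he⟩ := h
  have hpi := Real.pi_pos
  have hn1 : (1 : ℝ) ≤ n := by exact_mod_cast hn
  have hC := hasOpening_cone (p := p) ha0 ha1 hab
  have hQ := hasOpening_quotientEDist hn
  have e2 : Real.pi * a ≤ Real.pi := by nlinarith
  have e3 : Real.pi / (2 * n) ≤ Real.pi / 2 := by
    apply div_le_div_of_nonneg_left hpi.le two_pos; linarith
  have e4 : 0 < Real.pi * a := by positivity
  have e5 : 0 < Real.pi / (2 * n) := by positivity
  have h1 := hC.le_of_isometry hQ
    (Real.sin_nonneg_of_nonneg_of_le_pi e5.le (by linarith)) e he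
  have h2 := hQ.le_of_isometry hC
    (Real.sin_nonneg_of_nonneg_of_le_pi (by linarith) (by linarith)) e.symm
    fun p q => by simp [← he]
  have h3 := Real.injOn_sin ⟨by linarith, by linarith⟩ ⟨by linarith, by linarith⟩ (h1.antisymm h2)
  have h4 : a * n = 1 := by
    field_simp at h3
    linarith
  rw [eq_div_iff (by linarith)]
  linarith

end Cone

/-! ### The profile of a surface of constant positive curvature. -/

namespace SphericalSurface

variable {S : SphericalSurface}

/-- The profile of a surface of constant curvature `κ²` with slope `β` at the north pole. -/
structure IsRound (S : SphericalSurface) (κ β : ℝ) : Prop where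
  kappa_pos : 0 < κ
  beta_pos : 0 < β
  f_eq : ∀ r ∈ Icc S.rN S.rS, S.f r = β / κ * Real.sin (κ * (r - S.rN))
  f'_eq : ∀ r ∈ Icc S.rN S.rS, S.f' r = β * Real.cos (κ * (r - S.rN))
  rS_eq : S.rS = S.rN + Real.pi / κ

theorem contDiffOn_f' (S : SphericalSurface) : ContDiffOn ℝ ∞ S.f' (Icc S.rN S.rS) :=
  S.smooth_f.derivWithin (uniqueDiffOn_Icc S.rN_lt_rS) (by simp)

theorem hasDerivAt_f {r : ℝ} (hr : r ∈ Ioo S.rN S.rS) : HasDerivAt S.f (S.f' r) r :=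
  ((S.smooth_f.differentiableOn (by simp)) r (Ioo_subset_Icc_self hr)).hasDerivWithinAt.hasDerivAt
    (Icc_mem_nhds hr.1 hr.2)

theorem hasDerivAt_f' {r : ℝ} (hr : r ∈ Ioo S.rN S.rS) : HasDerivAt S.f' (S.f'' r) r :=
  ((S.contDiffOn_f'.differentiableOn (by simp)) r
    (Ioo_subset_Icc_self hr)).hasDerivWithinAt.hasDerivAt (Icc_mem_nhds hr.1 hr.2)

theorem eq_of_hasDerivAt_zero {a b : ℝ} {E : ℝ → ℝ} (hc : ContinuousOn E (Icc a b))
    (hd : ∀ r ∈ Ioo a b, HasDerivAt E 0 r) : ∀ r ∈ Icc a b, E r = E a := by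
  intro r hr
  rcases hr.1.eq_or_lt with h | h
  · rw [h]
  · obtain ⟨c, -, hc'⟩ := exists_hasDerivAt_eq_slope E (fun _ => 0) h
      (hc.mono (Icc_subset_Icc_right hr.2)) fun x hx => hd x ⟨hx.1, hx.2.trans_le hr.2⟩
    have : 0 < r - a := sub_pos.2 h
    field_simp at hc'
    linarith

theorem f_pos {r : ℝ} (hr : r ∈ Ioo S.rN S.rS) : 0 < S.f r := by
  have h := Ioo_subset_Icc_self hr
  refine lt_of_le_of_ne (S.f_nonneg r h) fun h0 => ?_
  rcases (S.f_eq_zero_iff r h).1 h0.symm with h1 | h1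
  · exact hr.1.ne' h1
  · exact hr.2.ne h1

/-- The vector (κf, f') rotates at constant angular speed, so rotating it back gives two first
integrals, whose values are read off at the north pole. Positivity of f inside and its vanishing at
the south pole then fix the sign of β and the length of the interval. -/
theorem isRound_of_hasConstantCurvature {K : ℝ} (hK : 0 < K) (h : S.HasConstantCurvature K) :
    S.IsRound √K (S.f' S.rN) := by
  set κ := √K with hκ
  have hκ0 : 0 < κ := Real.sqrt_pos.2 hK
  have hκK : κ ^ 2 = K := Real.sq_sqrt hK.le
  have hlt := S.rN_lt_rS
  have hN : S.rN ∈ Icc S.rN S.rS := left_mem_Icc.2 hlt.le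
  have hSm : S.rS ∈ Icc S.rN S.rS := right_mem_Icc.2 hlt.le
  have hfN : S.f S.rN = 0 := (S.f_eq_zero_iff _ hN).2 (Or.inl rfl)
  have hfS : S.f S.rS = 0 := (S.f_eq_zero_iff _ hSm).2 (Or.inr rfl)
  have hcf : ContinuousOn S.f (Icc S.rN S.rS) := S.smooth_f.continuousOn
  have hcf' : ContinuousOn S.f' (Icc S.rN S.rS) := S.contDiffOn_f'.continuousOn
  have hf'' : ∀ r ∈ Ioo S.rN S.rS, S.f'' r = -(κ ^ 2 * S.f r) := by
    intro r hr
    have h1 := h r hr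
    rw [gaussianCurvature, div_eq_iff (f_pos hr).ne'] at h1
    rw [hκK]; linarith
  have hds : ∀ r, HasDerivAt (fun r => Real.sin (κ * (r - S.rN)))
      (Real.cos (κ * (r - S.rN)) * κ) r := fun r => by
    have := (((hasDerivAt_id r).sub_const S.rN).const_mul κ).sin
    simpa using this
  have hdc : ∀ r, HasDerivAt (fun r => Real.cos (κ * (r - S.rN)))
      (-Real.sin (κ * (r - S.rN)) * κ) r := fun r => by
    have := (((hasDerivAt_id r).sub_const S.rN).const_mul κ).cos
    simpa using this
  have hsc : Continuous fun r => Real.sin (κ * (r - S.rN)) := by fun_prop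
  have hcc : Continuous fun r => Real.cos (κ * (r - S.rN)) := by fun_prop
  -- The curvature equation is known only in the open interval; continuity carries the first
  -- integrals to the poles.
  have hE1 := eq_of_hasDerivAt_zero
    (E := fun r => κ * S.f r * Real.cos (κ * (r - S.rN)) - S.f' r * Real.sin (κ * (r - S.rN)))
    (((continuousOn_const.mul hcf).mul hcc.continuousOn).sub (hcf'.mul hsc.continuousOn))
    (fun r hr => by
      have h1 := (((hasDerivAt_f hr).const_mul κ).mul (hdc r)).sub ((hasDerivAt_f' hr).mul (hds r))
      refine h1.congr_deriv ?_
      rw [hf'' r hr]; ring)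
  have hE2 := eq_of_hasDerivAt_zero
    (E := fun r => κ * S.f r * Real.sin (κ * (r - S.rN)) + S.f' r * Real.cos (κ * (r - S.rN)))
    (((continuousOn_const.mul hcf).mul hsc.continuousOn).add (hcf'.mul hcc.continuousOn))
    (fun r hr => by
      have h1 := (((hasDerivAt_f hr).const_mul κ).mul (hds r)).add ((hasDerivAt_f' hr).mul (hdc r))
      refine h1.congr_deriv ?_
      rw [hf'' r hr]; ring)
  simp only [hfN, sub_self, mul_zero, Real.sin_zero, Real.cos_zero, mul_one,
    zero_add] at hE1 hE2
  set β := S.f' S.rN with hβ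
  have hf : ∀ r ∈ Icc S.rN S.rS, S.f r = β / κ * Real.sin (κ * (r - S.rN)) := by
    intro r hr
    have h1 := hE1 r hr
    have h2 := hE2 r hr
    have h3 := Real.sin_sq_add_cos_sq (κ * (r - S.rN))
    field_simp
    linear_combination Real.sin (κ * (r - S.rN)) * h2 + Real.cos (κ * (r - S.rN)) * h1
      - κ * S.f r * h3
  have hf' : ∀ r ∈ Icc S.rN S.rS, S.f' r = β * Real.cos (κ * (r - S.rN)) := by
    intro r hr
    have h1 := hE1 r hr
    have h2 := hE2 r hr
    have h3 := Real.sin_sq_add_cos_sq (κ * (r - S.rN))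
    linear_combination Real.cos (κ * (r - S.rN)) * h2 - Real.sin (κ * (r - S.rN)) * h1
      - S.f' r * h3
  set L := S.rS - S.rN with hL
  have hL0 : 0 < L := sub_pos.2 hlt
  have hpi := Real.pi_pos
  have hβ0 : 0 < β := by
    -- A point inside the interval and within a quarter period of the pole, so that the sine there
    -- is nonnegative and positivity of f forces β > 0.
    let s := min (L / 2) (Real.pi / (2 * κ))
    have hs0 : 0 < s := lt_min (by linarith) (by positivity)
    have hs1 : S.rN + s ∈ Ioo S.rN S.rS := ⟨by linarith, by
      linarith [min_le_left (L / 2) (Real.pi / (2 * κ))]⟩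
    have h1 := f_pos hs1
    rw [hf _ (Ioo_subset_Icc_self hs1), add_sub_cancel_left] at h1
    have h2 : κ * s ≤ Real.pi / 2 := by
      have := mul_le_mul_of_nonneg_left (min_le_right (L / 2) (Real.pi / (2 * κ))) hκ0.le
      calc κ * s ≤ _ := this
        _ = _ := by field_simp
    have h3 : 0 ≤ Real.sin (κ * s) :=
      Real.sin_nonneg_of_nonneg_of_le_pi (by positivity) (by linarith)
    have h4 : 0 < β / κ := by
      by_contra! hle
      nlinarith
    exact (div_pos_iff_of_pos_right hκ0).1 h4
  -- A longer interval would contain an interior zero of f; a shorter one would leave f positive at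
  -- the south pole.
  have hle : κ * L ≤ Real.pi := by
    by_contra! hgt
    have h1 : S.rN + Real.pi / κ ∈ Ioo S.rN S.rS := ⟨by linarith [div_pos hpi hκ0], by
      have : Real.pi / κ < L := by rw [div_lt_iff₀ hκ0]; linarith
      linarith⟩
    have h2 := f_pos h1
    rw [hf _ (Ioo_subset_Icc_self h1), add_sub_cancel_left, mul_div_cancel₀ _ hκ0.ne',
      Real.sin_pi, mul_zero] at h2
    exact lt_irrefl _ h2
  have hge : κ * L = Real.pi := by
    by_contra hne
    have h1 := Real.sin_pos_of_pos_of_lt_pi (mul_pos hκ0 hL0) (lt_of_le_of_ne hle hne)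
    have h2 := hf _ hSm
    rw [hfS] at h2
    have h3 : 0 < β / κ := div_pos hβ0 hκ0
    nlinarith
  refine ⟨hκ0, hβ0, hf, hf', ?_⟩
  rw [← hge, mul_div_cancel_left₀ _ hκ0.ne']
  simp [hL]

/-- At the poles f'' is multiplied by f = 0, so its value there does not matter; inside, the
relation is cos² + sin² = 1. -/
theorem IsRound.isBeta_iff {κ β : ℝ} (h : S.IsRound κ β) {b : ℝ} : S.IsBeta b ↔ b ^ 2 = β ^ 2 := by
  have hlt := S.rN_lt_rS
  have hN : S.rN ∈ Icc S.rN S.rS := left_mem_Icc.2 hlt.le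
  have hκ := h.kappa_pos
  have hend : ∀ r ∈ Icc S.rN S.rS, S.f r = 0 →
      -(S.f r) * S.f'' r + S.f' r ^ 2 = β ^ 2 := by
    intro r hr hz
    have h1 := h.f_eq r hr
    have h2 : Real.sin (κ * (r - S.rN)) = 0 := by
      rw [hz] at h1
      have : β / κ ≠ 0 := (div_pos h.beta_pos hκ).ne'
      simpa [this] using h1.symm
    rw [hz, h.f'_eq r hr]
    have h3 := Real.sin_sq_add_cos_sq (κ * (r - S.rN))
    rw [h2] at h3
    linear_combination β ^ 2 * h3
  constructor
  · intro hb
    rw [← hb S.rN hN]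
    exact hend _ hN ((S.f_eq_zero_iff _ hN).2 (Or.inl rfl))
  · intro hb r hr
    rw [hb]
    by_cases hz : S.f r = 0
    · exact hend r hr hz
    have hr' : r ∈ Ioo S.rN S.rS := by
      refine ⟨lt_of_le_of_ne hr.1 fun e => hz ?_, lt_of_le_of_ne hr.2 fun e => hz ?_⟩
      · exact (S.f_eq_zero_iff _ hr).2 (Or.inl e.symm)
      · exact (S.f_eq_zero_iff _ hr).2 (Or.inr e)
    have hd : HasDerivAt S.f' (β * (-Real.sin (κ * (r - S.rN)) * κ)) r := by
      have h1 : HasDerivAt (fun r => β * Real.cos (κ * (r - S.rN)))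
          (β * (-Real.sin (κ * (r - S.rN)) * κ)) r := by
        have := ((((hasDerivAt_id r).sub_const S.rN).const_mul κ).cos).const_mul β
        simpa using this
      refine h1.congr_of_eventuallyEq ?_
      filter_upwards [Icc_mem_nhds hr'.1 hr'.2] with x hx using h.f'_eq x hx
    rw [(hasDerivAt_f' hr').unique hd, h.f'_eq r hr, h.f_eq r hr]
    have h3 := Real.sin_sq_add_cos_sq (κ * (r - S.rN))
    field_simp
    linear_combination β ^ 2 * h3

theorem f'_le_one {r : ℝ} (hr : r ∈ Icc S.rN S.rS) : S.f' r ≤ 1 := by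
  have h : S.f' r ^ 2 + S.g' r ^ 2 = 1 := S.unit_speed r hr
  nlinarith [sq_nonneg (S.g' r), sq_nonneg (S.f' r - 1)]

theorem IsRound.beta_eq {κ β : ℝ} (h : S.IsRound κ β) : S.f' S.rN = β := by
  rw [h.f'_eq _ (left_mem_Icc.2 S.rN_lt_rS.le)]; simp

theorem IsRound.beta_eq_one_div {κ β : ℝ} (h : S.IsRound κ β) {n : ℕ} (hn : 0 < n)
    (hc : IsIsometricToPlaneQuotient S.tangentConeNorth n) : β = 1 / n := by
  have hN : S.rN ∈ Icc S.rN S.rS := left_mem_Icc.2 S.rN_lt_rS.le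
  rw [← h.beta_eq]
  exact cone_slope_eq_of_isometric (h.beta_eq ▸ h.beta_pos) (f'_le_one hN) (S.unit_speed _ hN) hn hc

end SphericalSurface

/-! ### The shape function as radial coordinate. -/

/-- Parameters of the Kepler problem on a round surface: the profile is
`f = (β / κ) sin (κ (r - a))`, the potential is `γ (C - (κ / β²) cot (κ (r - a)))` and `h` is the
energy. -/
structure KeplerData where
  a : ℝ
  κ : ℝ
  β : ℝ
  C : ℝ
  γ : ℝ
  h : ℝ
  κ_pos : 0 < κ
  β_pos : 0 < β
  γ_pos : 0 < γ

namespace KeplerData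

variable (P : KeplerData)

/-- The radius at which the shape function of the potential has the value `q`. -/
def R (q : ℝ) : ℝ := P.a + (Real.pi / 2 + Real.arctan (P.β ^ 2 * (q - P.C) / P.κ)) / P.κ

/-- The distance from the axis as a function of the value `q` of the shape function. -/
def F (q : ℝ) : ℝ := P.β / P.κ * Real.cos (Real.arctan (P.β ^ 2 * (q - P.C) / P.κ))

/-- The state with shape function `q`, radial momentum `p`, angular momentum `l` and longitude
`ζ`. -/
def state (q p l : ℝ) (ζ : ℂ) : KeplerState := (P.R q, ζ, l / (P.F q * √(-q)), p / √(-q))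

/-- Twice the energy. -/
def energy (q p l : ℝ) : ℝ :=
  p ^ 2 + l ^ 2 * (P.κ ^ 2 + P.β ^ 4 * (q - P.C) ^ 2) / P.β ^ 2 + 2 * P.γ * q

theorem F_pos (q : ℝ) : 0 < P.F q :=
  mul_pos (div_pos P.β_pos P.κ_pos) (Real.cos_arctan_pos _)

/-- With q as coordinate 1/f² is a quadratic polynomial, so the centrifugal term l²/f² of the energy
is polynomial in q. This is what makes the reduced motion linear. -/
theorem F_sq_mul (q : ℝ) : P.F q ^ 2 * (P.κ ^ 2 + P.β ^ 4 * (q - P.C) ^ 2) = P.β ^ 2 := by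
  have hκ := P.κ_pos.ne'
  have h : 0 < P.κ ^ 2 + P.β ^ 4 * (q - P.C) ^ 2 := by
    have := P.κ_pos
    positivity
  rw [F, mul_pow, Real.cos_sq_arctan]
  have h2 : 0 < 1 + (P.β ^ 2 * (q - P.C) / P.κ) ^ 2 := by positivity
  field_simp

theorem F_mul_tan (q : ℝ) : P.F q * (P.β ^ 2 * (q - P.C) / P.κ)
    = P.β / P.κ * Real.sin (Real.arctan (P.β ^ 2 * (q - P.C) / P.κ)) := by
  have h := Real.tan_mul_cos (Real.cos_arctan_pos (P.β ^ 2 * (q - P.C) / P.κ)).ne'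
  rw [Real.tan_arctan] at h
  rw [F]
  linear_combination (P.β / P.κ) * h

theorem hasDerivAt_arg (q : ℝ) : HasDerivAt (fun q => Real.arctan (P.β ^ 2 * (q - P.C) / P.κ))
    (P.κ * P.F q ^ 2) q := by
  have h1 : HasDerivAt (fun q => P.β ^ 2 * (q - P.C) / P.κ) (P.β ^ 2 / P.κ) q := by
    have := (((hasDerivAt_id q).sub_const P.C).const_mul (P.β ^ 2)).div_const P.κ
    simpa using this
  refine h1.arctan.congr_deriv ?_
  have hκ := P.κ_pos.ne'
  rw [F, mul_pow, Real.cos_sq_arctan]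
  field_simp

theorem hasDerivAt_R (q : ℝ) : HasDerivAt P.R (P.F q ^ 2) q := by
  have h := (((P.hasDerivAt_arg q).const_add (Real.pi / 2)).div_const P.κ).const_add P.a
  refine h.congr_deriv ?_
  have hκ := P.κ_pos.ne'
  field_simp

theorem hasDerivAt_F (q : ℝ) : HasDerivAt P.F (-(P.β ^ 2 * (q - P.C)) * P.F q ^ 3) q := by
  have h := ((P.hasDerivAt_arg q).cos).const_mul (P.β / P.κ)
  refine h.congr_deriv ?_
  have hκ := P.κ_pos.ne'
  have h1 := P.F_mul_tan q
  have h2 : P.β / P.κ * (-Real.sin (Real.arctan (P.β ^ 2 * (q - P.C) / P.κ)) * (P.κ * P.F q ^ 2))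
      = -(P.β / P.κ * Real.sin (Real.arctan (P.β ^ 2 * (q - P.C) / P.κ))) * (P.κ * P.F q ^ 2) := by
    ring
  rw [h2, ← h1]
  field_simp

theorem strictMono_R : StrictMono P.R := strictMono_of_deriv_pos fun q => by
  rw [(P.hasDerivAt_R q).deriv]; exact pow_pos (P.F_pos q) 2

theorem continuous_R : Continuous P.R :=
  continuous_iff_continuousAt.2 fun q => (P.hasDerivAt_R q).continuousAt

theorem continuous_F : Continuous P.F :=
  continuous_iff_continuousAt.2 fun q => (P.hasDerivAt_F q).continuousAt

theorem R_mem (q : ℝ) : P.R q ∈ Ioo P.a (P.a + Real.pi / P.κ) := by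
  have h1 := Real.neg_pi_div_two_lt_arctan (P.β ^ 2 * (q - P.C) / P.κ)
  have h2 := Real.arctan_lt_pi_div_two (P.β ^ 2 * (q - P.C) / P.κ)
  constructor
  · have : 0 < (Real.pi / 2 + Real.arctan (P.β ^ 2 * (q - P.C) / P.κ)) / P.κ :=
      div_pos (by linarith) P.κ_pos
    rw [R]; linarith
  · have : (Real.pi / 2 + Real.arctan (P.β ^ 2 * (q - P.C) / P.κ)) / P.κ < Real.pi / P.κ :=
      div_lt_div_of_pos_right (by linarith) P.κ_pos
    rw [R]; linarith

theorem tendsto_R_atBot : Tendsto P.R atBot (𝓝 P.a) := by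
  have h1 : Tendsto (fun q => P.β ^ 2 * (q - P.C) / P.κ) atBot atBot := by
    refine Tendsto.atBot_div_const P.κ_pos (Tendsto.const_mul_atBot (pow_pos P.β_pos 2) ?_)
    exact tendsto_atBot_add_const_right _ (-P.C) tendsto_id
  have h2 := ((Real.tendsto_arctan_atBot.mono_right nhdsWithin_le_nhds).comp h1)
  have h3 := ((h2.const_add (Real.pi / 2)).div_const P.κ).const_add P.a
  rw [add_neg_cancel, zero_div, add_zero] at h3
  exact h3

/-- The data `P` describe the Kepler problem on the surface `S` with shape function `Θ`. -/
structure Models (S : SphericalSurface) (Θ : ℝ → ℝ) : Prop where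
  isRound : S.IsRound P.κ P.β
  a_eq : P.a = S.rN
  shape_eq : ∀ r ∈ Ioo S.rN S.rS, Θ r
    = P.C - P.κ / P.β ^ 2 * (Real.cos (P.κ * (r - S.rN)) / Real.sin (P.κ * (r - S.rN)))

variable {P} {S : SphericalSurface} {Θ : ℝ → ℝ}

theorem Models.R_mem (H : P.Models S Θ) (q : ℝ) : P.R q ∈ Ioo S.rN S.rS := by
  have := P.R_mem q
  rwa [H.a_eq, ← H.isRound.rS_eq] at this

theorem Models.angle (H : P.Models S Θ) (q : ℝ) : P.κ * (P.R q - S.rN)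
    = Real.arctan (P.β ^ 2 * (q - P.C) / P.κ) + Real.pi / 2 := by
  have hκ := P.κ_pos.ne'
  rw [R, H.a_eq]
  field_simp
  ring

theorem Models.f_R (H : P.Models S Θ) (q : ℝ) : S.f (P.R q) = P.F q := by
  rw [H.isRound.f_eq _ (Ioo_subset_Icc_self (H.R_mem q)), H.angle, Real.sin_add_pi_div_two, F]

theorem Models.f'_R (H : P.Models S Θ) (q : ℝ) :
    S.f' (P.R q) = -(P.β ^ 2 * (q - P.C)) * P.F q := by
  rw [H.isRound.f'_eq _ (Ioo_subset_Icc_self (H.R_mem q)), H.angle, Real.cos_add_pi_div_two]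
  have h := P.F_mul_tan q
  have hκ := P.κ_pos.ne'
  field_simp at h
  linarith

theorem Models.shape_R (H : P.Models S Θ) (q : ℝ) : Θ (P.R q) = q := by
  rw [H.shape_eq _ (H.R_mem q), H.angle, Real.cos_add_pi_div_two, Real.sin_add_pi_div_two, neg_div,
    ← Real.tan_eq_sin_div_cos, Real.tan_arctan]
  have hκ := P.κ_pos.ne'
  have hβ := P.β_pos.ne'
  field_simp
  ring

theorem Models.R_shape (H : P.Models S Θ) {r : ℝ} (hr : r ∈ Ioo S.rN S.rS) : P.R (Θ r) = r := by
  have hκ := P.κ_pos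
  have hβ := P.β_pos
  have hS := H.isRound.rS_eq
  have h0 : 0 < P.κ * (r - S.rN) := mul_pos hκ (sub_pos.2 hr.1)
  have h1 : P.κ * (r - S.rN) < Real.pi := by
    have : r - S.rN < Real.pi / P.κ := by linarith [hr.2]
    rw [lt_div_iff₀ hκ] at this
    linarith
  have h2 : P.β ^ 2 * (Θ r - P.C) / P.κ = Real.tan (P.κ * (r - S.rN) - Real.pi / 2) := by
    rw [H.shape_eq r hr, Real.tan_eq_sin_div_cos, Real.sin_sub_pi_div_two, Real.cos_sub_pi_div_two]
    field_simp
    ring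
  rw [R, h2, Real.arctan_tan (by linarith) (by linarith), H.a_eq]
  field_simp
  ring

/-- Since f = (β/κ) sin, an antiderivative of 1/f² is -(κ/β²) cot up to a constant, which is the
parameter `C`. -/
theorem exists_models {κ β γ h : ℝ} (hround : S.IsRound κ β) (hΘ : S.IsPotentialShape Θ)
    (hγ : 0 < γ) : ∃ P : KeplerData, P.Models S Θ ∧ P.κ = κ ∧ P.β = β ∧ P.γ = γ ∧ P.h = h := by
  have hκ := hround.kappa_pos
  have hβ := hround.beta_pos
  have hsin : ∀ r ∈ Ioo S.rN S.rS, Real.sin (κ * (r - S.rN)) ≠ 0 := by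
    intro r hr h0
    have h1 := SphericalSurface.f_pos hr
    rw [hround.f_eq r (Ioo_subset_Icc_self hr), h0, mul_zero] at h1
    exact lt_irrefl _ h1
  let E : ℝ → ℝ := fun r => Θ r +
    κ / β ^ 2 * (Real.cos (κ * (r - S.rN)) / Real.sin (κ * (r - S.rN)))
  have hE : ∀ r ∈ Ioo S.rN S.rS, HasDerivAt E 0 r := by
    intro r hr
    have hl : HasDerivAt (fun r => κ * (r - S.rN)) κ r := by
      simpa using ((hasDerivAt_id r).sub_const S.rN).const_mul κ
    have h1 := (hΘ r hr).add ((hl.cos.div hl.sin (hsin r hr)).const_mul (κ / β ^ 2))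
    refine h1.congr_deriv ?_
    have h2 := hsin r hr
    rw [hround.f_eq r (Ioo_subset_Icc_self hr)]
    have h3 := Real.sin_sq_add_cos_sq (κ * (r - S.rN))
    field_simp
    linear_combination -κ ^ 2 * h3
  obtain ⟨C, hC⟩ := isOpen_Ioo.exists_is_const_of_deriv_eq_zero isPreconnected_Ioo
    (fun r hr => (hE r hr).differentiableAt.differentiableWithinAt) (fun r hr => (hE r hr).deriv)
  refine ⟨⟨S.rN, κ, β, C, γ, h, hκ, hβ, hγ⟩, ⟨hround, rfl, fun r hr => ?_⟩, rfl, rfl, rfl, rfl⟩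
  have := hC r hr
  simp only [E] at this
  simp only
  linarith

/-- Away from the singularity the field is smooth. -/
theorem Models.contDiffAt_field (H : P.Models S Θ) (γ : ℝ) {x : KeplerState}
    (hx : x.1 ∈ Ioo S.rN S.rS) (hx0 : Θ x.1 ≠ 0) : ContDiffAt ℝ 1 (S.keplerField Θ γ) x := by
  have hfst : ContDiffAt ℝ 1 (fun x : KeplerState => x.1) x := contDiffAt_fst
  have hΘ : ContDiffAt ℝ 1 Θ x.1 := by
    have h1 : ContDiffAt ℝ 1 (fun r => P.C - P.κ / P.β ^ 2 *
        (Real.cos (P.κ * (r - S.rN)) / Real.sin (P.κ * (r - S.rN)))) x.1 := by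
      have hs : Real.sin (P.κ * (x.1 - S.rN)) ≠ 0 := by
        intro h0
        have h1 := SphericalSurface.f_pos hx
        rw [H.isRound.f_eq _ (Ioo_subset_Icc_self hx), h0, mul_zero] at h1
        exact lt_irrefl _ h1
      have hc : ContDiff ℝ 1 fun r => Real.cos (P.κ * (r - S.rN)) := by fun_prop
      have hs' : ContDiff ℝ 1 fun r => Real.sin (P.κ * (r - S.rN)) := by fun_prop
      exact contDiffAt_const.sub (contDiffAt_const.mul (hc.contDiffAt.div hs'.contDiffAt hs))
    refine h1.congr_of_eventuallyEq ?_
    filter_upwards [Ioo_mem_nhds hx.1 hx.2] with r hr using H.shape_eq r hr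
  have hmem := Icc_mem_nhds hx.1 hx.2
  have hf : ContDiffAt ℝ 1 (fun x : KeplerState => S.f x.1) x :=
    ((S.smooth_f.contDiffAt hmem).of_le (by simp)).comp x hfst
  have hf' : ContDiffAt ℝ 1 (fun x : KeplerState => S.f' x.1) x :=
    ((S.contDiffOn_f'.contDiffAt hmem).of_le (by simp)).comp x hfst
  have hT : ContDiffAt ℝ 1 (fun x : KeplerState => Θ x.1) x := hΘ.comp x hfst
  have hA : ContDiffAt ℝ 1 (fun x : KeplerState => |Θ x.1|) x := hT.abs hx0
  have hQ : ContDiffAt ℝ 1 (fun x : KeplerState => √|Θ x.1|) x := hA.sqrt (abs_ne_zero.2 hx0)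
  have hf0 : S.f x.1 ≠ 0 := (SphericalSurface.f_pos hx).ne'
  have hζ : ContDiffAt ℝ 1 (fun x : KeplerState => x.2.1) x := by fun_prop
  have hu : ContDiffAt ℝ 1 (fun x : KeplerState => x.2.2.1) x := by fun_prop
  have hv : ContDiffAt ℝ 1 (fun x : KeplerState => x.2.2.2) x := by fun_prop
  have hw := hQ.div hf hf0
  have h2 := (contDiffAt_const (c := (2 : ℝ))).mul hf |>.mul hT
  have h2' : 2 * S.f x.1 * Θ x.1 ≠ 0 := by simp [hf0, hx0]
  have e1 := hv.mul hQ
  have e2 := ((Complex.ofRealCLM.contDiff.contDiffAt.comp x (hu.mul hw)).mul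
    (contDiffAt_const (c := Complex.I))).mul hζ
  have e3 := ((hu.neg.mul hv).mul (hf'.add (contDiffAt_const (c := (1 : ℝ)) |>.div h2 h2'))).mul hw
  have e4 := (((hu.pow 2).mul hf').sub ((hv.pow 2).div h2 h2')).sub
    ((contDiffAt_const (c := γ)).div (hf.mul hA) (mul_ne_zero hf0 (abs_ne_zero.2 hx0))) |>.mul hw
  exact e1.prodMk (e2.prodMk (e3.prodMk e4))

end KeplerData

/-! ### Energy relation and equations of motion in the new coordinates. -/

namespace KeplerData

variable {P : KeplerData} {S : SphericalSurface} {Θ : ℝ → ℝ}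

theorem mk_mem_energyManifold {γ h r u v : ℝ} {ζ : ℂ} :
    ((r, ζ, u, v) : KeplerState) ∈ S.energyManifold Θ γ h ↔ ‖ζ‖ = 1 ∧
      ((r = S.rN ∧ u ^ 2 + v ^ 2 = 2 * γ) ∨ (r ∈ Ioo S.rN S.rS ∧ Θ r ≠ 0 ∧
        (SignType.sign (Θ r) : ℝ) * ((u ^ 2 + v ^ 2) / 2) + γ = h / Θ r)) := by
  constructor
  · rintro ⟨r', ζ', u', v', he, h1⟩
    simp only [Prod.mk.injEq] at he
    obtain ⟨rfl, rfl, rfl, rfl⟩ := he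
    exact h1
  · intro h1
    exact ⟨r, ζ, u, v, rfl, h1⟩

theorem mk_mem_diff {γ h r u v : ℝ} {ζ : ℂ} :
    ((r, ζ, u, v) : KeplerState) ∈ S.energyManifold Θ γ h \ S.northSingularity Θ γ h ↔
      ‖ζ‖ = 1 ∧ r ∈ Ioo S.rN S.rS ∧ Θ r ≠ 0 ∧
        (SignType.sign (Θ r) : ℝ) * ((u ^ 2 + v ^ 2) / 2) + γ = h / Θ r := by
  constructor
  · rintro ⟨h1, h2⟩
    have h3 := mk_mem_energyManifold.1 h1
    refine ⟨h3.1, h3.2.resolve_left fun h4 => h2 ⟨h1, h4.1⟩⟩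
  · rintro ⟨h1, h2⟩
    exact ⟨mk_mem_energyManifold.2 ⟨h1, Or.inr h2⟩, fun h3 => h2.1.1.ne' h3.2⟩

/-- Multiply the energy relation for Θ = q < 0 by 2q = -2s². The letters s and f stand for √(-q) and
the radius, so that only rational expressions occur. -/
theorem energy_of_F {q s p l f : ℝ} (hs : s ≠ 0) (hq : q = -s ^ 2) (hf : f ≠ 0)
    (hF : f ^ 2 * (P.κ ^ 2 + P.β ^ 4 * (q - P.C) ^ 2) = P.β ^ 2) :
    (-1 * (((l / (f * s)) ^ 2 + (p / s) ^ 2) / 2) + P.γ = P.h / q) ↔ P.energy q p l = 2 * P.h := by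
  have hβ := P.β_pos.ne'
  have hk : P.κ ^ 2 + P.β ^ 4 * (q - P.C) ^ 2 = P.β ^ 2 / f ^ 2 := by
    field_simp
    linarith
  rw [energy, hk, hq]
  field_simp
  constructor <;> intro h <;> linarith

theorem Models.state_mem_diff (H : P.Models S Θ) {q p l : ℝ} {ζ : ℂ} (hq : q < 0) :
    P.state q p l ζ ∈ S.energyManifold Θ P.γ P.h \ S.northSingularity Θ P.γ P.h ↔
      ‖ζ‖ = 1 ∧ P.energy q p l = 2 * P.h := by
  have hs : 0 < √(-q) := Real.sqrt_pos.2 (by linarith)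
  have hs2 : q = -√(-q) ^ 2 := by rw [Real.sq_sqrt (by linarith)]; ring
  rw [state, mk_mem_diff, H.shape_R, sign_neg hq]
  simp only [H.R_mem q, hq.ne, ne_eq, not_false_eq_true, true_and, SignType.coe_neg_one]
  rw [energy_of_F hs.ne' hs2 (P.F_pos q).ne' (P.F_sq_mul q)]

theorem Models.exists_state (H : P.Models S Θ) {r u v : ℝ} {ζ : ℂ} (hr : r ∈ Ioo S.rN S.rS)
    (hq : Θ r < 0) : ((r, ζ, u, v) : KeplerState)
      = P.state (Θ r) (v * √(-Θ r)) (u * (P.F (Θ r) * √(-Θ r))) ζ := by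
  have hs : 0 < √(-Θ r) := Real.sqrt_pos.2 (by linarith)
  rw [state, H.R_shape hr, mul_div_cancel_right₀ _ hs.ne',
    mul_div_cancel_right₀ _ (mul_pos (P.F_pos _) hs).ne']

/-- The factor f² is the time change dt = f² dσ. It cancels dq/dr = 1/f², and turns the radial force
l²f'/f³ - γ/f² into l²f'/f - γ, which is affine in q because f'/f = -β²(q - C). -/
theorem Models.hasDerivAt_state (H : P.Models S Θ) {q p : ℝ → ℝ} {l σ : ℝ} {ζ : ℂ}
    (hq : HasDerivAt q (p σ) σ)
    (hp : HasDerivAt p (-((P.β * l) ^ 2 * (q σ - P.C)) - P.γ) σ) (hneg : q σ < 0) :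
    HasDerivAt (fun σ : ℝ => P.state (q σ) (p σ) l (ζ * Complex.exp ((l * σ : ℝ) * Complex.I)))
      (P.F (q σ) ^ 2 • S.keplerField Θ P.γ
        (P.state (q σ) (p σ) l (ζ * Complex.exp ((l * σ : ℝ) * Complex.I)))) σ := by
  have hs : 0 < √(-q σ) := Real.sqrt_pos.2 (by linarith)
  have hs2 : q σ = -√(-q σ) ^ 2 := by rw [Real.sq_sqrt (by linarith)]; ring
  have hF := P.F_pos (q σ)
  have hdR := (P.hasDerivAt_R (q σ)).comp σ hq
  have hdF := (P.hasDerivAt_F (q σ)).comp σ hq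
  have hds : HasDerivAt (fun σ => √(-q σ)) (-(p σ) / (2 * √(-q σ))) σ :=
    hq.neg.sqrt (by simpa using hneg.ne)
  have hdu := (hasDerivAt_const σ l).div (hdF.mul hds) (mul_pos hF hs).ne'
  have hdv := hp.div hds hs.ne'
  have hdζ : HasDerivAt (fun σ : ℝ => ζ * Complex.exp ((l * σ : ℝ) * Complex.I))
      (ζ * (Complex.exp ((l * σ : ℝ) * Complex.I) * (l * Complex.I))) σ := by
    have h1 : HasDerivAt (fun σ : ℝ => ((l * σ : ℝ) : ℂ) * Complex.I) (l * Complex.I) σ := by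
      have h2 : HasDerivAt (fun σ : ℝ => l * σ) l σ := by
        simpa using (hasDerivAt_id σ).const_mul l
      exact h2.ofReal_comp.mul_const Complex.I
    exact h1.cexp.const_mul ζ
  refine (hdR.prodMk (hdζ.prodMk (hdu.prodMk hdv))).congr_deriv ?_
  simp only [SphericalSurface.keplerField, state, H.shape_R, H.f_R, H.f'_R, abs_of_neg hneg,
    Prod.smul_mk, Prod.mk.injEq, Function.comp_apply, smul_eq_mul, Pi.mul_apply]
  refine ⟨?_, ?_, ?_, ?_⟩
  · field_simp
  · rw [Complex.real_smul]
    have hF' : (P.F (q σ) : ℂ) ≠ 0 := by exact_mod_cast hF.ne'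
    have hs' : (√(-q σ) : ℂ) ≠ 0 := by exact_mod_cast hs.ne'
    push_cast
    field_simp
  · generalize √(-q σ) = s at *
    generalize P.F (q σ) = f at *
    rw [hs2]
    field_simp
    ring
  · generalize √(-q σ) = s at *
    have h3 := P.β_pos
    generalize P.F (q σ) = f at *
    rw [hs2]
    field_simp
    ring

end KeplerData

/-! ### The explicit oscillator orbits. -/

section ReducedOrbit

theorem isOpen_ordConnectedComponent {s : Set ℝ} (hs : IsOpen s) (x : ℝ) :
    IsOpen (ordConnectedComponent s x) := by
  rw [isOpen_iff_mem_nhds]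
  intro y hy
  rw [ordConnectedComponent_eq (mem_ordConnectedComponent.1 hy), ordConnectedComponent_mem_nhds]
  exact hs.mem_nhds (ordConnectedComponent_subset hy)

/-- The solution `q` of `q'' = -Ω² (q - C) - γ` with initial values `q₀`, `p₀`. -/
def orbitQ (C γ Ω q₀ p₀ σ : ℝ) : ℝ :=
  if Ω = 0 then q₀ + p₀ * σ - γ * σ ^ 2 / 2
  else (C - γ / Ω ^ 2) + (q₀ - (C - γ / Ω ^ 2)) * Real.cos (Ω * σ) + p₀ / Ω * Real.sin (Ω * σ)

/-- The derivative of `orbitQ`. -/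
def orbitP (C γ Ω q₀ p₀ σ : ℝ) : ℝ :=
  if Ω = 0 then p₀ - γ * σ
  else -((q₀ - (C - γ / Ω ^ 2)) * Ω * Real.sin (Ω * σ)) + p₀ * Real.cos (Ω * σ)

variable {C γ Ω q₀ p₀ : ℝ}

@[simp] theorem orbitQ_zero : orbitQ C γ Ω q₀ p₀ 0 = q₀ := by
  unfold orbitQ; split_ifs <;> simp

@[simp] theorem orbitP_zero : orbitP C γ Ω q₀ p₀ 0 = p₀ := by
  unfold orbitP; split_ifs <;> simp

theorem hasDerivAt_orbitQ (σ : ℝ) :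
    HasDerivAt (orbitQ C γ Ω q₀ p₀) (orbitP C γ Ω q₀ p₀ σ) σ := by
  by_cases hΩ : Ω = 0
  · have h : orbitQ C γ Ω q₀ p₀ = fun σ => q₀ + p₀ * σ - γ * σ ^ 2 / 2 := by
      funext σ; simp [orbitQ, hΩ]
    rw [h, orbitP, if_pos hΩ]
    have h1 := (((hasDerivAt_id σ).const_mul p₀).const_add q₀).sub
      ((((hasDerivAt_id σ).pow 2).const_mul γ).div_const 2)
    refine h1.congr_deriv ?_
    simp
    ring
  · have h : orbitQ C γ Ω q₀ p₀ = fun σ => (C - γ / Ω ^ 2) +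
        (q₀ - (C - γ / Ω ^ 2)) * Real.cos (Ω * σ) + p₀ / Ω * Real.sin (Ω * σ) := by
      funext σ; simp [orbitQ, hΩ]
    rw [h, orbitP, if_neg hΩ]
    have hl : HasDerivAt (fun σ => Ω * σ) Ω σ := by simpa using (hasDerivAt_id σ).const_mul Ω
    have h1 := ((hl.cos.const_mul (q₀ - (C - γ / Ω ^ 2))).const_add (C - γ / Ω ^ 2)).add
      (hl.sin.const_mul (p₀ / Ω))
    refine h1.congr_deriv ?_
    field_simp

theorem hasDerivAt_orbitP (σ : ℝ) : HasDerivAt (orbitP C γ Ω q₀ p₀)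
    (-(Ω ^ 2 * (orbitQ C γ Ω q₀ p₀ σ - C)) - γ) σ := by
  by_cases hΩ : Ω = 0
  · have h : orbitP C γ Ω q₀ p₀ = fun σ => p₀ - γ * σ := by
      funext σ; simp [orbitP, hΩ]
    rw [h]
    have h1 := ((hasDerivAt_id σ).const_mul γ).const_sub p₀
    refine h1.congr_deriv ?_
    simp [hΩ]
  · have h : orbitP C γ Ω q₀ p₀ = fun σ =>
        -((q₀ - (C - γ / Ω ^ 2)) * Ω * Real.sin (Ω * σ)) + p₀ * Real.cos (Ω * σ) := by
      funext σ; simp [orbitP, hΩ]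
    rw [h, orbitQ, if_neg hΩ]
    have hl : HasDerivAt (fun σ => Ω * σ) Ω σ := by simpa using (hasDerivAt_id σ).const_mul Ω
    have h1 := (hl.sin.const_mul ((q₀ - (C - γ / Ω ^ 2)) * Ω)).neg.add (hl.cos.const_mul p₀)
    refine h1.congr_deriv ?_
    field_simp
    ring

theorem orbitQ_neg_omega : orbitQ C γ (-Ω) q₀ p₀ = orbitQ C γ Ω q₀ p₀ := by
  funext σ
  simp only [orbitQ, neg_eq_zero, neg_mul, Real.cos_neg, Real.sin_neg, neg_sq, div_neg, mul_neg,
    neg_neg]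

theorem orbitP_neg_omega : orbitP C γ (-Ω) q₀ p₀ = orbitP C γ Ω q₀ p₀ := by
  funext σ
  simp only [orbitP, neg_eq_zero, neg_mul, Real.cos_neg, Real.sin_neg, neg_sq, mul_neg, neg_neg]

/-- Phase-amplitude form of the orbit. -/
theorem orbit_phase (hΩ : 0 < Ω) {w : ℂ} (hre : w.re = q₀ - (C - γ / Ω ^ 2))
    (him : w.im = -(p₀ / Ω)) (σ : ℝ) :
    orbitQ C γ Ω q₀ p₀ σ = (C - γ / Ω ^ 2) + ‖w‖ * Real.cos (Ω * σ + w.arg) ∧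
      orbitP C γ Ω q₀ p₀ σ = -(Ω * (‖w‖ * Real.sin (Ω * σ + w.arg))) := by
  have e1 := Complex.norm_mul_cos_arg w
  have e2 := Complex.norm_mul_sin_arg w
  rw [hre] at e1
  rw [him] at e2
  have hp : p₀ = -Ω * (‖w‖ * Real.sin w.arg) := by rw [e2]; field_simp
  constructor
  · rw [orbitQ, if_neg hΩ.ne', Real.cos_add, ← e1, show p₀ / Ω = -(‖w‖ * Real.sin w.arg) by linarith]
    ring
  · rw [orbitP, if_neg hΩ.ne', Real.sin_add, ← e1]
    linear_combination Real.cos (Ω * σ) * hp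

/-- Every orbit has a point of maximal `q`. -/
theorem exists_orbit_max (hγ : 0 < γ) : ∃ σ, orbitP C γ Ω q₀ p₀ σ = 0 ∧
    -(Ω ^ 2 * (orbitQ C γ Ω q₀ p₀ σ - C)) - γ ≤ 0 := by
  by_cases hΩ : Ω = 0
  · refine ⟨p₀ / γ, ?_, ?_⟩
    · rw [orbitP, if_pos hΩ]; field_simp; ring
    · rw [hΩ]; nlinarith
  wlog hpos : 0 < Ω generalizing Ω
  · have := this (Ω := -Ω) (neg_ne_zero.2 hΩ) (neg_pos.2 (lt_of_le_of_ne (not_lt.1 hpos) hΩ))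
    rwa [orbitQ_neg_omega, orbitP_neg_omega, neg_sq] at this
  let w : ℂ := ⟨q₀ - (C - γ / Ω ^ 2), -(p₀ / Ω)⟩
  obtain ⟨h1, h2⟩ := orbit_phase (γ := γ) (C := C) (w := w) hpos rfl rfl (-w.arg / Ω)
  -- At this time the phase is 0, so the cosine is maximal.
  have e : Ω * (-w.arg / Ω) + w.arg = 0 := by field_simp; ring
  rw [e] at h1 h2
  refine ⟨-w.arg / Ω, by rw [h2]; simp, ?_⟩
  rw [h1, Real.cos_zero]
  have : Ω ^ 2 * (C - γ / Ω ^ 2 + ‖w‖ * 1 - C) = -γ + Ω ^ 2 * ‖w‖ := by field_simp; ring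
  rw [this]
  have : 0 ≤ Ω ^ 2 * ‖w‖ := by positivity
  linarith

/-- An orbit which does not move outwards at first comes back to its initial height with opposite
momentum. -/
theorem exists_orbit_return (hΩ : Ω ≠ 0) (hp : p₀ ≤ 0)
    (hp0 : p₀ = 0 → Ω ^ 2 * (q₀ - C) + γ < 0) :
    ∃ T, 0 ≤ T ∧ (∀ σ ∈ Icc 0 T, orbitQ C γ Ω q₀ p₀ σ ≤ q₀) ∧ orbitQ C γ Ω q₀ p₀ T = q₀ ∧
      orbitP C γ Ω q₀ p₀ T = -p₀ ∧ (∃ ε > 0, ∀ σ ∈ Ioo T (T + ε), q₀ < orbitQ C γ Ω q₀ p₀ σ) ∧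
      Complex.exp ((Ω * T : ℝ) * Complex.I)
        = (starRingEnd ℂ) ((Ω ^ 2 * (q₀ - C) + γ : ℝ) - (p₀ * Ω : ℝ) * Complex.I) /
          ((Ω ^ 2 * (q₀ - C) + γ : ℝ) - (p₀ * Ω : ℝ) * Complex.I) := by
  wlog hpos : 0 < Ω generalizing Ω
  · obtain ⟨T, h1, h2, h3, h4, h5, h6⟩ := this (Ω := -Ω) (neg_ne_zero.2 hΩ)
      (fun h => by rw [neg_sq]; exact hp0 h) (neg_pos.2 (lt_of_le_of_ne (not_lt.1 hpos) hΩ))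
    -- The orbit depends on Ω² only; changing the sign of Ω inverts the exponential and conjugates
    -- the complex number on the right.
    rw [orbitQ_neg_omega] at h2 h3 h5
    rw [orbitP_neg_omega] at h4
    refine ⟨T, h1, h2, h3, h4, h5, ?_⟩
    have e : ((Ω * T : ℝ) : ℂ) * Complex.I = -(((-Ω * T : ℝ) : ℂ) * Complex.I) := by
      push_cast; ring
    rw [e, Complex.exp_neg, h6, inv_div, neg_sq]
    simp only [map_sub, map_mul, Complex.conj_ofReal, Complex.conj_I]
    push_cast
    ring
  have hpi := Real.pi_pos
  set w : ℂ := ⟨q₀ - (C - γ / Ω ^ 2), -(p₀ / Ω)⟩ with hw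
  have hph := orbit_phase (γ := γ) (C := C) (q₀ := q₀) (p₀ := p₀) (w := w) hpos rfl rfl
  set ψ := w.arg with hψ
  have him : 0 ≤ w.im := by
    have : p₀ / Ω ≤ 0 := div_nonpos_of_nonpos_of_nonneg hp hpos.le
    simp only [hw]; linarith
  -- A vanishing phase would mean starting at rest at the top of the oscillation, or at its
  -- equilibrium; `hp0` excludes both.
  have hψ0 : 0 < ψ := by
    refine lt_of_le_of_ne (Complex.arg_nonneg_iff.2 him) fun h => ?_
    obtain ⟨h1, h2⟩ := Complex.arg_eq_zero_iff.1 h.symm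
    simp only [hw, neg_eq_zero, div_eq_zero_iff, hΩ, or_false] at h1 h2
    have h3 := hp0 h2
    have h4 : Ω ^ 2 * (q₀ - (C - γ / Ω ^ 2)) = Ω ^ 2 * (q₀ - C) + γ := by field_simp; ring
    have h5 := mul_nonneg (sq_nonneg Ω) h1
    linarith
  have hψ1 : ψ ≤ Real.pi := Complex.arg_le_pi w
  have hw0 : w ≠ 0 := by
    rintro h
    rw [hψ, h, Complex.arg_zero] at hψ0
    exact lt_irrefl _ hψ0
  have hnw : 0 < ‖w‖ := norm_pos_iff.2 hw0
  have hq0 : q₀ = (C - γ / Ω ^ 2) + ‖w‖ * Real.cos ψ := by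
    rw [Complex.norm_mul_cos_arg w]; simp [hw]
  have hp0' : p₀ = -(Ω * (‖w‖ * Real.sin ψ)) := by
    rw [Complex.norm_mul_sin_arg w]; simp only [hw]; field_simp
  -- The phase runs from ψ to 2π - ψ, where the cosine is the same and the sine opposite. If ψ = π,
  -- the start at rest at the bottom, then T = 0.
  set T := (2 * Real.pi - 2 * ψ) / Ω with hT
  have hΩT : Ω * T = 2 * Real.pi - 2 * ψ := by rw [hT]; field_simp
  have hT0 : 0 ≤ T := div_nonneg (by linarith) hpos.le
  have hcos : ∀ x, Real.cos x = Real.cos (2 * Real.pi - x) := fun x => (Real.cos_two_pi_sub x).symm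
  refine ⟨T, hT0, ?_, ?_, ?_, ⟨ψ / Ω, div_pos hψ0 hpos, ?_⟩, ?_⟩
  · intro σ hσ
    rw [(hph σ).1]
    conv_rhs => rw [hq0]
    have h1 : 0 ≤ Ω * σ := mul_nonneg hpos.le hσ.1
    have h2 : Ω * σ ≤ 2 * Real.pi - 2 * ψ := by rw [← hΩT]; exact mul_le_mul_of_nonneg_left hσ.2 hpos.le
    have h3 : Real.cos (Ω * σ + ψ) ≤ Real.cos ψ := by
      rcases le_total (Ω * σ + ψ) Real.pi with h | h
      · exact Real.cos_le_cos_of_nonneg_of_le_pi hψ0.le h (by linarith)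
      · rw [hcos (Ω * σ + ψ)]
        exact Real.cos_le_cos_of_nonneg_of_le_pi hψ0.le (by linarith) (by linarith)
    gcongr
  · rw [(hph T).1, hΩT, show 2 * Real.pi - 2 * ψ + ψ = 2 * Real.pi - ψ by ring, ← hcos, ← hq0]
  · rw [(hph T).2, hΩT, show 2 * Real.pi - 2 * ψ + ψ = 2 * Real.pi - ψ by ring,
      Real.sin_two_pi_sub, hp0']
    ring
  · intro σ hσ
    rw [(hph σ).1]
    conv_lhs => rw [hq0]
    have h1 : 2 * Real.pi - 2 * ψ < Ω * σ := by rw [← hΩT]; exact mul_lt_mul_of_pos_left hσ.1 hpos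
    have h2 : Ω * σ < 2 * Real.pi - ψ := by
      have := mul_lt_mul_of_pos_left hσ.2 hpos
      rw [mul_add, hΩT, mul_div_cancel₀ _ hpos.ne'] at this
      linarith
    have h3 : Real.cos ψ < Real.cos (Ω * σ + ψ) := by
      rw [hcos (Ω * σ + ψ)]
      exact Real.cos_lt_cos_of_nonneg_of_le_pi (by linarith) hψ1 (by linarith)
    gcongr
  · have hZ : ((Ω ^ 2 * (q₀ - C) + γ : ℝ) : ℂ) - (p₀ * Ω : ℝ) * Complex.I
        = ((Ω ^ 2 : ℝ) : ℂ) * w := by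
      apply Complex.ext
      · rw [Complex.re_ofReal_mul, Complex.sub_re, Complex.ofReal_re, Complex.mul_I_re,
          Complex.ofReal_im]
        simp only [hw]
        field_simp
        ring
      · rw [Complex.im_ofReal_mul, Complex.sub_im, Complex.ofReal_im, Complex.mul_I_im,
          Complex.ofReal_re]
        simp only [hw]
        field_simp
        ring
    have hwp : (‖w‖ : ℂ) * Complex.exp (ψ * Complex.I) = w := norm_polar w
    have hΩ2 : ((Ω ^ 2 : ℝ) : ℂ) ≠ 0 := by exact_mod_cast (pow_pos hpos 2).ne'
    have hn : (‖w‖ : ℂ) ≠ 0 := by exact_mod_cast hnw.ne'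
    rw [hZ, map_mul, Complex.conj_ofReal, mul_div_mul_left _ _ hΩ2, ← hwp, map_mul,
      Complex.conj_ofReal, mul_div_mul_left _ _ hn, ← Complex.exp_conj, ← Complex.exp_sub, hΩT,
      Complex.exp_eq_exp_iff_exists_int]
    refine ⟨1, ?_⟩
    simp only [map_mul, Complex.conj_ofReal, Complex.conj_I]
    push_cast
    ring

/-- A function with positive initial velocity, or with zero velocity and positive acceleration,
increases at first. -/
theorem exists_forall_lt_of_initially_increasing {q p : ℝ → ℝ} {c : ℝ}
    (hq : ∀ σ, HasDerivAt q (p σ) σ) (hp : HasDerivAt p c 0) (h : 0 < p 0 ∨ (p 0 = 0 ∧ 0 < c)) :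
    ∃ ε > 0, ∀ σ ∈ Ioo 0 ε, q 0 < q σ := by
  have hev : ∀ᶠ σ in 𝓝[>] (0 : ℝ), 0 < p σ := by
    rcases h with h | ⟨h, hc⟩
    · exact (hp.continuousAt.eventually (lt_mem_nhds h)).filter_mono nhdsWithin_le_nhds
    · have h1 := eventually_nhdsWithin_sign_eq_of_deriv_pos (f := p) (x₀ := 0)
        (by rw [hp.deriv]; exact hc) h
      filter_upwards [h1.filter_mono nhdsWithin_le_nhds, self_mem_nhdsWithin] with σ h2 h3
      rw [sub_zero, sign_pos (show (0 : ℝ) < σ from h3)] at h2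
      exact sign_eq_one_iff.1 h2
  obtain ⟨ε, hε, hsub⟩ := mem_nhdsGT_iff_exists_Ioo_subset.1 hev
  refine ⟨ε, hε, fun σ hσ => ?_⟩
  have hmono : StrictMonoOn q (Icc 0 σ) := by
    refine strictMonoOn_of_deriv_pos (convex_Icc _ _)
      (fun x _ => (hq x).continuousAt.continuousWithinAt) fun x hx => ?_
    rw [interior_Icc] at hx
    rw [(hq x).deriv]
    exact hsub ⟨hx.1, hx.2.trans hσ.2⟩
  exact hmono (left_mem_Icc.2 hσ.1.le) (right_mem_Icc.2 hσ.1.le) hσ.1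

end ReducedOrbit

/-! ### Orbits on the energy manifold and the choice of the height of the block. -/

namespace KeplerData

variable {P : KeplerData} {S : SphericalSurface} {Θ : ℝ → ℝ}

/-- Position on the orbit of `state q p l ζ` at the regularized time `σ`. -/
def orbit (P : KeplerData) (q p l : ℝ) (ζ : ℂ) (σ : ℝ) : KeplerState :=
  P.state (orbitQ P.C P.γ (P.β * l) q p σ) (orbitP P.C P.γ (P.β * l) q p σ) l
    (ζ * Complex.exp ((l * σ : ℝ) * Complex.I))

@[simp] theorem orbit_zero (q p l : ℝ) (ζ : ℂ) : P.orbit q p l ζ 0 = P.state q p l ζ := by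
  simp [orbit]

theorem energy_orbit (q p l σ : ℝ) :
    P.energy (orbitQ P.C P.γ (P.β * l) q p σ) (orbitP P.C P.γ (P.β * l) q p σ) l
      = P.energy q p l := by
  have hβ := P.β_pos.ne'
  have hd : ∀ σ, HasDerivAt (fun σ => P.energy (orbitQ P.C P.γ (P.β * l) q p σ)
      (orbitP P.C P.γ (P.β * l) q p σ) l) 0 σ := by
    intro σ
    have hq := hasDerivAt_orbitQ (C := P.C) (γ := P.γ) (Ω := P.β * l) (q₀ := q) (p₀ := p) σ
    have hp := hasDerivAt_orbitP (C := P.C) (γ := P.γ) (Ω := P.β * l) (q₀ := q) (p₀ := p) σ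
    have h1 := ((hp.pow 2).add ((((((hq.sub_const P.C).pow 2).const_mul (P.β ^ 4)).const_add
      (P.κ ^ 2)).const_mul (l ^ 2)).div_const (P.β ^ 2))).add (hq.const_mul (2 * P.γ))
    refine h1.congr_deriv ?_
    field_simp
    ring
  have := is_const_of_deriv_eq_zero (fun σ => (hd σ).differentiableAt) (fun σ => (hd σ).deriv) σ 0
  simpa using this

/-- The oscillator orbit is defined for all σ, but it describes the Kepler flow only while q stays
negative, since u and v degenerate at Θ = 0. One time change τ, built from the global function q,
serves the whole orbit. -/
theorem Models.exists_flowsTo_orbit (H : P.Models S Θ) {q p l : ℝ} {ζ : ℂ}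
    (hq : q < 0) (hζ : ‖ζ‖ = 1) (hE : P.energy q p l = 2 * P.h) :
    ∃ τ : ℝ → ℝ, StrictMono τ ∧ Continuous τ ∧ τ 0 = 0 ∧
      ∀ σ, (∀ s ∈ uIcc 0 σ, orbitQ P.C P.γ (P.β * l) q p s < 0) →
        FlowsTo (S.keplerField Θ P.γ)
          (S.energyManifold Θ P.γ P.h \ S.northSingularity Θ P.γ P.h)
          (P.state q p l ζ) (τ σ) (P.orbit q p l ζ σ) := by
  set Q := orbitQ P.C P.γ (P.β * l) q p with hQ
  have hQc : Continuous Q := continuous_iff_continuousAt.2 fun σ =>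
    (hasDerivAt_orbitQ σ).continuousAt
  obtain ⟨τ, h1, h2, h3, h4⟩ := exists_flowsTo_of_reparametrization
    (F := S.keplerField Θ P.γ) (D := S.energyManifold Θ P.γ P.h \ S.northSingularity Θ P.γ P.h)
    (l := fun σ => P.F (Q σ) ^ 2) ((P.continuous_F.comp hQc).pow 2)
    (fun σ => pow_pos (P.F_pos _) 2)
  refine ⟨τ, h1, h2, h3, fun σ hσ => ?_⟩
  have hopen : IsOpen {s | Q s < 0} := isOpen_lt hQc continuous_const
  have h0 : (0 : ℝ) ∈ {s | Q s < 0} := by simpa [hQ] using hq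
  have := h4 (P.orbit q p l ζ) (ordConnectedComponent {s | Q s < 0} 0)
    (isOpen_ordConnectedComponent hopen 0) inferInstance
    (self_mem_ordConnectedComponent.2 h0) (fun s hs => ?_) σ
    (mem_ordConnectedComponent.2 hσ)
  · rwa [orbit_zero] at this
  · have hs0 : s ∈ {s | Q s < 0} := ordConnectedComponent_subset hs
    refine ⟨(H.state_mem_diff hs0).2 ⟨?_, ?_⟩, H.hasDerivAt_state (hasDerivAt_orbitQ s)
      (hasDerivAt_orbitP s) hs0⟩
    · rw [norm_mul, hζ, Complex.norm_exp_ofReal_mul_I, one_mul]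
    · rw [energy_orbit, hE]

theorem Models.flow_unique (H : P.Models S Θ) {x y y' : KeplerState} {t : ℝ}
    (h : FlowsTo (S.keplerField Θ P.γ)
      (S.energyManifold Θ P.γ P.h \ S.northSingularity Θ P.γ P.h) x t y)
    (h' : FlowsTo (S.keplerField Θ P.γ)
      (S.energyManifold Θ P.γ P.h \ S.northSingularity Θ P.γ P.h) x t y') : y = y' := by
  refine h.unique ?_ h'
  rintro ⟨r, ζ, u, v⟩ hx
  obtain ⟨-, h1, h2, -⟩ := mk_mem_diff.1 hx
  exact H.contDiffAt_field P.γ h1 h2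

/-- Deep in the well of the potential every critical point of `q` along an orbit is a minimum. -/
theorem exists_threshold (P : KeplerData) : ∃ q₀ < 0, ∀ q ≤ q₀, 0 < P.h - P.γ * q ∧
    ∀ l, P.energy q 0 l = 2 * P.h → 0 < -((P.β * l) ^ 2 * (q - P.C)) - P.γ := by
  have hκ := P.κ_pos
  have hβ := P.β_pos
  have hγ := P.γ_pos
  -- With y = C - q and p = 0, the energy equation reduces the claim to γ(κ² + β⁴y²) < yβ⁴(2γy + 2(h
  -- - γC)), true for large y. `Y` makes y ≥ 1 and γy + 2(h - γC) ≥ γ(1 + κ²/β⁴), which is enough.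
  let Y := 1 + P.κ ^ 2 / P.β ^ 4 + 2 * |P.h - P.γ * P.C| / P.γ
  have hY : 0 < Y := by positivity
  have hY1 : 1 ≤ Y := by
    have : 0 ≤ P.κ ^ 2 / P.β ^ 4 + 2 * |P.h - P.γ * P.C| / P.γ := by positivity
    simp only [Y]; linarith
  have hh : 0 ≤ |P.h| / P.γ := by positivity
  refine ⟨-(|P.C| + Y + |P.h| / P.γ), by linarith [abs_nonneg P.C], fun q hq => ⟨?_, fun l hl => ?_⟩⟩
  · have h1 : q < -(|P.h| / P.γ) := by linarith [abs_nonneg P.C]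
    have h2 : P.γ * q < P.γ * -(|P.h| / P.γ) := mul_lt_mul_of_pos_left h1 hγ
    rw [mul_neg, mul_div_cancel₀ _ hγ.ne'] at h2
    linarith [neg_abs_le P.h]
  · set y := P.C - q with hy
    have hyY : Y ≤ y := by linarith [neg_abs_le P.C]
    have hy0 : 0 < y := hY.trans_le hyY
    have hq' : q = P.C - y := by linarith
    rw [energy, hq'] at hl
    have hk : 0 < P.κ ^ 2 + P.β ^ 4 * y ^ 2 := by positivity
    have h1 : (P.β * l) ^ 2 * (P.κ ^ 2 + P.β ^ 4 * y ^ 2)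
        = P.β ^ 4 * (2 * P.h - 2 * P.γ * (P.C - y)) := by
      field_simp at hl
      linear_combination P.β ^ 2 * hl
    have h2 : P.γ * (1 + P.κ ^ 2 / P.β ^ 4) ≤ P.γ * y + 2 * (P.h - P.γ * P.C) := by
      have h3 : P.γ * Y ≤ P.γ * y := mul_le_mul_of_nonneg_left hyY hγ.le
      have h4 : P.γ * Y = P.γ * (1 + P.κ ^ 2 / P.β ^ 4) + 2 * |P.h - P.γ * P.C| := by
        simp only [Y]; field_simp
      linarith [neg_abs_le (P.h - P.γ * P.C)]
    have h5 : P.γ * (P.β ^ 4 + P.κ ^ 2) ≤ P.β ^ 4 * (P.γ * y + 2 * (P.h - P.γ * P.C)) := by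
      have := mul_le_mul_of_nonneg_left h2 (pow_pos hβ 4).le
      field_simp at this ⊢
      linarith
    have h6 : P.γ * (P.κ ^ 2 + P.β ^ 4 * y ^ 2) < (P.β * l) ^ 2 * y * (P.κ ^ 2 + P.β ^ 4 * y ^ 2) := by
      have h7 : (P.β * l) ^ 2 * y * (P.κ ^ 2 + P.β ^ 4 * y ^ 2)
          = P.γ * P.β ^ 4 * y ^ 2 + y * (P.β ^ 4 * (P.γ * y + 2 * (P.h - P.γ * P.C))) := by
        linear_combination y * h1
      rw [h7]
      have h8 : 0 < P.γ * P.β ^ 4 := by positivity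
      have h9 : 0 < P.γ * (P.β ^ 4 + P.κ ^ 2) := by positivity
      nlinarith [mul_le_mul_of_nonneg_left h5 hy0.le]
    have h10 : P.γ < (P.β * l) ^ 2 * y := lt_of_mul_lt_mul_right h6 hk.le
    have h11 : -((P.β * l) ^ 2 * (q - P.C)) = (P.β * l) ^ 2 * y := by rw [hq']; ring
    rw [h11]
    linarith

end KeplerData

/-! ### The block: compactness, interior, boundary torus and tangency circles. -/

namespace KeplerData

variable {P : KeplerData} {S : SphericalSurface} {Θ : ℝ → ℝ} {q₀ : ℝ}

/-- The energy manifold. -/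
abbrev manifold (P : KeplerData) (S : SphericalSurface) (Θ : ℝ → ℝ) : Set KeplerState :=
  S.energyManifold Θ P.γ P.h

/-- The collision states. -/
abbrev collisions (P : KeplerData) (S : SphericalSurface) (Θ : ℝ → ℝ) : Set KeplerState :=
  S.northSingularity Θ P.γ P.h

/-- The states of a neighbourhood of the north pole. -/
def block (P : KeplerData) (S : SphericalSurface) (Θ : ℝ → ℝ) (q₀ : ℝ) : Set KeplerState :=
  {x ∈ P.manifold S Θ | x.1 ≤ P.R q₀}

/-- `q₀` is so negative that below it orbits have no maxima of `q`. -/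
structure IsThreshold (P : KeplerData) (q₀ : ℝ) : Prop where
  neg : q₀ < 0
  kinetic_pos : ∀ q ≤ q₀, 0 < P.h - P.γ * q
  accel_pos : ∀ q ≤ q₀, ∀ l, P.energy q 0 l = 2 * P.h → 0 < -((P.β * l) ^ 2 * (q - P.C)) - P.γ

theorem exists_isThreshold (P : KeplerData) : ∃ q₀, P.IsThreshold q₀ := by
  obtain ⟨q₀, h0, h⟩ := P.exists_threshold
  exact ⟨q₀, h0, fun q hq => (h q hq).1, fun q hq => (h q hq).2⟩

theorem Models.mk_mem_manifold (H : P.Models S Θ) {q u v : ℝ} {ζ : ℂ} (hq : q < 0) :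
    ((P.R q, ζ, u, v) : KeplerState) ∈ P.manifold S Θ ↔
      ‖ζ‖ = 1 ∧ u ^ 2 + v ^ 2 = 2 * P.γ - 2 * P.h / q := by
  have h1 : P.R q ≠ S.rN := (H.R_mem q).1.ne'
  rw [mk_mem_energyManifold, H.shape_R, sign_neg hq]
  simp only [H.R_mem q, h1, hq.ne, ne_eq, not_false_eq_true, true_and, false_and, false_or,
    SignType.coe_neg_one]
  refine and_congr_right fun _ => ?_
  have : 2 * P.h / q = 2 * (P.h / q) := by ring
  rw [this]
  constructor <;> intro h <;> linarith

theorem Models.shape_le (H : P.Models S Θ) {r : ℝ} (hr : r ∈ Ioo S.rN S.rS) (hle : r ≤ P.R q₀) :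
    Θ r ≤ q₀ := by
  rw [← P.strictMono_R.le_iff_le, H.R_shape hr]
  exact hle

theorem IsThreshold.radius_pos (hT : P.IsThreshold q₀) : 0 < 2 * P.γ - 2 * P.h / q₀ := by
  have h1 := hT.kinetic_pos q₀ le_rfl
  have h0 := hT.neg
  have h2 : 2 * P.γ - 2 * P.h / q₀ = 2 * (P.h - P.γ * q₀) / (-q₀) := by
    rw [div_neg, eq_neg_iff_add_eq_zero]
    have := h0.ne
    field_simp
    ring
  rw [h2]
  exact div_pos (by linarith) (by linarith)

/-- The square of the velocity as a function of the radius. -/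
def speedSq (P : KeplerData) (r : ℝ) : ℝ :=
  2 * P.γ - 2 * P.h * Real.sin (P.κ * (r - P.a)) /
    (P.C * Real.sin (P.κ * (r - P.a)) - P.κ / P.β ^ 2 * Real.cos (P.κ * (r - P.a)))

/-- Multiplying Θ by the sine removes its pole, so that 2γ - 2h/Θ extends continuously to the north
pole. -/
theorem Models.denominator_ne (H : P.Models S Θ) {r : ℝ} (hr : r ∈ Ioo S.rN S.rS) :
    Real.sin (P.κ * (r - P.a)) ≠ 0 ∧
      P.C * Real.sin (P.κ * (r - P.a)) - P.κ / P.β ^ 2 * Real.cos (P.κ * (r - P.a))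
        = Θ r * Real.sin (P.κ * (r - P.a)) := by
  have hs : Real.sin (P.κ * (r - P.a)) ≠ 0 := by
    intro h0
    have h1 := SphericalSurface.f_pos hr
    rw [H.isRound.f_eq _ (Ioo_subset_Icc_self hr), ← H.a_eq, h0, mul_zero] at h1
    exact lt_irrefl _ h1
  refine ⟨hs, ?_⟩
  rw [H.shape_eq r hr, ← H.a_eq]
  field_simp

/-- The collision clause and the regular clause of the energy manifold merge into one equation with
a right-hand side continuous up to the pole, as compactness requires. -/
theorem Models.block_eq (H : P.Models S Θ) (hT : P.IsThreshold q₀) : P.block S Θ q₀ =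
    {x : KeplerState | x.1 ∈ Icc P.a (P.R q₀) ∧ ‖x.2.1‖ = 1 ∧
      x.2.2.1 ^ 2 + x.2.2.2 ^ 2 = P.speedSq x.1} := by
  have h0 := hT.neg
  ext ⟨r, ζ, u, v⟩
  simp only [block, mem_ofPred_eq]
  have hN : P.speedSq P.a = 2 * P.γ := by simp [speedSq]
  by_cases hr : r = P.a
  · subst hr
    rw [mk_mem_energyManifold, hN]
    have h1 : ¬ P.a ∈ Ioo S.rN S.rS := by rw [H.a_eq]; exact fun h => lt_irrefl _ h.1
    have h2 := (P.R_mem q₀).1.le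
    have h3 : P.a ∈ Icc P.a (P.R q₀) := left_mem_Icc.2 h2
    have h4 := H.a_eq
    tauto
  by_cases hrI : r ∈ Ioo S.rN S.rS
  · by_cases hle : r ≤ P.R q₀
    · have hq := (H.shape_le hrI hle).trans_lt h0
      have h1 := H.mk_mem_manifold (u := u) (v := v) (ζ := ζ) hq
      rw [H.R_shape hrI] at h1
      rw [h1]
      obtain ⟨h2, h3⟩ := H.denominator_ne hrI
      have h4 : P.speedSq r = 2 * P.γ - 2 * P.h / Θ r := by
        rw [speedSq, h3, mul_div_mul_right _ _ h2]
      have h5 : r ∈ Icc P.a (P.R q₀) := ⟨H.a_eq ▸ hrI.1.le, hle⟩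
      rw [h4]
      tauto
    · constructor
      · rintro ⟨-, h⟩; exact absurd h hle
      · rintro ⟨h, -⟩; exact absurd h.2 hle
  · constructor
    · rintro ⟨h, -⟩
      rcases (mk_mem_energyManifold.1 h).2 with h1 | h1
      · exact absurd (h1.1.trans H.a_eq.symm) hr
      · exact absurd h1.1 hrI
    · rintro ⟨h, -⟩
      refine absurd ⟨lt_of_le_of_ne (H.a_eq ▸ h.1) fun e => hr ?_, h.2.trans_lt (H.R_mem q₀).2⟩ hrI
      rw [← e, H.a_eq]

theorem Models.isCompact_block (H : P.Models S Θ) (hT : P.IsThreshold q₀) :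
    IsCompact (P.block S Θ q₀) := by
  have hden : ∀ r ∈ Icc P.a (P.R q₀),
      P.C * Real.sin (P.κ * (r - P.a)) - P.κ / P.β ^ 2 * Real.cos (P.κ * (r - P.a)) ≠ 0 := by
    intro r hr
    rcases hr.1.eq_or_lt with h | h
    · rw [← h]
      have h1 : P.κ / P.β ^ 2 ≠ 0 := (div_pos P.κ_pos (pow_pos P.β_pos 2)).ne'
      simpa using h1
    · have hrI : r ∈ Ioo S.rN S.rS := ⟨H.a_eq ▸ h, hr.2.trans_lt (H.R_mem q₀).2⟩
      have hq := (H.shape_le hrI hr.2).trans_lt hT.neg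
      obtain ⟨h2, h3⟩ := H.denominator_ne hrI
      rw [h3]
      exact mul_ne_zero hq.ne h2
  have hcont : ContinuousOn P.speedSq (Icc P.a (P.R q₀)) := by
    refine continuousOn_const.sub (ContinuousOn.div ?_ ?_ hden)
    · exact Continuous.continuousOn (by fun_prop)
    · exact Continuous.continuousOn (by fun_prop)
  obtain ⟨A, hA⟩ := (isCompact_Icc.image_of_continuousOn hcont).bddAbove
  have hclosed : IsClosed (P.block S Θ q₀) := by
    have hs : IsClosed {x : KeplerState | x.1 ∈ Icc P.a (P.R q₀)} :=
      isClosed_Icc.preimage continuous_fst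
    have h1 : ContinuousOn (fun x : KeplerState => x.2.2.1 ^ 2 + x.2.2.2 ^ 2 - P.speedSq x.1)
        {x : KeplerState | x.1 ∈ Icc P.a (P.R q₀)} := by
      refine ContinuousOn.sub (Continuous.continuousOn (by fun_prop)) ?_
      exact hcont.comp continuous_fst.continuousOn fun x hx => hx
    have h2 := h1.preimage_isClosed_of_isClosed hs (isClosed_singleton (x := (0 : ℝ)))
    have h3 : IsClosed {x : KeplerState | ‖x.2.1‖ = 1} :=
      isClosed_eq (by fun_prop) continuous_const
    convert h2.inter h3 using 1
    rw [H.block_eq hT]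
    ext x
    simp only [mem_ofPred_eq, mem_inter_iff, mem_preimage, mem_singleton_iff, sub_eq_zero]
    tauto
  have hbig : IsCompact (Icc P.a (P.R q₀) ×ˢ Metric.closedBall (0 : ℂ) 1 ×ˢ
      Icc (-(A + 1)) (A + 1) ×ˢ Icc (-(A + 1)) (A + 1)) :=
    isCompact_Icc.prod ((isCompact_closedBall 0 1).prod (isCompact_Icc.prod isCompact_Icc))
  refine hbig.of_isClosed_subset hclosed ?_
  rw [H.block_eq hT]
  rintro ⟨r, ζ, u, v⟩ ⟨h1, h2, h3⟩
  simp only at h1 h2 h3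
  have h4 : u ^ 2 + v ^ 2 ≤ A := h3 ▸ hA (mem_image_of_mem _ h1)
  refine ⟨h1, ?_, ?_, ?_⟩
  · simp [h2]
  · constructor <;> nlinarith [sq_nonneg (u - 1), sq_nonneg (u + 1), sq_nonneg v]
  · constructor <;> nlinarith [sq_nonneg (v - 1), sq_nonneg (v + 1), sq_nonneg u]

theorem Models.collisions_subset (H : P.Models S Θ) :
    P.collisions S Θ ⊆ {x ∈ P.block S Θ q₀ | x.1 < P.R q₀} := by
  intro x hx
  have h1 : x.1 < P.R q₀ := by rw [hx.2]; exact (H.R_mem q₀).1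
  exact ⟨⟨hx.1, h1.le⟩, h1⟩

theorem Models.relInterior_block (H : P.Models S Θ) (hT : P.IsThreshold q₀) :
    relInterior (P.manifold S Θ) (P.block S Θ q₀) = {x ∈ P.block S Θ q₀ | x.1 < P.R q₀} := by
  ext x
  constructor
  · rintro ⟨hx, hnhds⟩
    refine ⟨hx, lt_of_le_of_ne hx.2 fun heq => ?_⟩
    obtain ⟨r, ζ, u, v⟩ := x
    simp only at heq
    subst heq
    obtain ⟨hζ, huv⟩ := (H.mk_mem_manifold hT.neg).1 hx.1
    have hpos := hT.radius_pos
    -- Scaling (u, v) by √g(q) keeps the state on the energy manifold while q moves past q₀, so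
    -- boundary states are limits of states outside the block.
    let g : ℝ → ℝ := fun q => (2 * P.γ - 2 * P.h / q) / (2 * P.γ - 2 * P.h / q₀)
    have hg : ContinuousAt g q₀ :=
      (continuousAt_const.sub (continuousAt_const.div continuousAt_id hT.neg.ne)).div_const _
    have hg0 : g q₀ = 1 := div_self hpos.ne'
    let c : ℝ → KeplerState := fun q => (P.R q, ζ, u * √(g q), v * √(g q))
    have hc : ContinuousAt c q₀ :=
      P.continuous_R.continuousAt.prodMk (continuousAt_const.prodMk
        ((continuousAt_const.mul hg.sqrt).prodMk (continuousAt_const.mul hg.sqrt)))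
    have hc0 : c q₀ = (P.R q₀, ζ, u, v) := by simp [c, hg0]
    have hcM : ∀ᶠ q in 𝓝 q₀, c q ∈ P.manifold S Θ := by
      have hgpos : ∀ᶠ q in 𝓝 q₀, 0 < g q := hg.eventually (lt_mem_nhds (by rw [hg0]; exact one_pos))
      filter_upwards [hgpos, gt_mem_nhds hT.neg] with q h1 h2
      refine (H.mk_mem_manifold h2).2 ⟨hζ, ?_⟩
      rw [mul_pow, mul_pow, Real.sq_sqrt h1.le, ← add_mul, huv, mul_div_cancel₀ _ hpos.ne']
    have h1 : Tendsto c (𝓝[>] q₀) (𝓝[P.manifold S Θ] (P.R q₀, ζ, u, v)) := by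
      refine tendsto_nhdsWithin_iff.2 ⟨?_, hcM.filter_mono nhdsWithin_le_nhds⟩
      rw [← hc0]
      exact hc.tendsto.mono_left nhdsWithin_le_nhds
    obtain ⟨q, hq1, hq2⟩ := ((h1.eventually hnhds).and self_mem_nhdsWithin).exists
    exact absurd hq1.2 (not_le.2 (P.strictMono_R hq2))
  · rintro ⟨hx, hlt⟩
    refine ⟨hx, ?_⟩
    have h1 : {x : KeplerState | x.1 < P.R q₀} ∈ 𝓝 x :=
      (isOpen_lt continuous_fst continuous_const).mem_nhds hlt
    filter_upwards [mem_nhdsWithin_of_mem_nhds h1, self_mem_nhdsWithin] with y hy hyM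
    exact ⟨hyM, hy.le⟩

theorem Models.relBoundary_block (H : P.Models S Θ) (hT : P.IsThreshold q₀) :
    relBoundary (P.manifold S Θ) (P.block S Θ q₀) =
      {x : KeplerState | x.1 = P.R q₀ ∧ ‖x.2.1‖ = 1 ∧
        x.2.2.1 ^ 2 + x.2.2.2 ^ 2 = 2 * P.γ - 2 * P.h / q₀} := by
  rw [relBoundary, H.relInterior_block hT]
  ext ⟨r, ζ, u, v⟩
  constructor
  · rintro ⟨h1, h2⟩
    have h3 : r = P.R q₀ := le_antisymm h1.2 (not_lt.1 fun h => h2 ⟨h1, h⟩)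
    subst h3
    exact ⟨rfl, (H.mk_mem_manifold hT.neg).1 h1.1⟩
  · rintro ⟨h1, h2⟩
    simp only at h1
    subst h1
    exact ⟨⟨(H.mk_mem_manifold hT.neg).2 h2, le_rfl⟩, fun h => lt_irrefl _ h.2⟩

theorem finrank_keplerState : Module.finrank ℝ KeplerState = 5 := by
  simp [KeplerState, Module.finrank_prod, Complex.finrank_real_complex]

theorem fderiv_surjective_of_curves {E F : Type*} [NormedAddCommGroup E] [NormedSpace ℝ E]
    [NormedAddCommGroup F] [NormedSpace ℝ F] {G : E → F} {y : E} (hG : DifferentiableAt ℝ G y)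
    (h : ∀ e : F, ∃ w : E, HasDerivAt (fun t : ℝ => G (y + t • w)) e 0) :
    Function.Surjective (fderiv ℝ G y) := by
  intro e
  obtain ⟨w, hw⟩ := h e
  refine ⟨w, ?_⟩
  have h1 : HasDerivAt (fun t : ℝ => y + t • w) w 0 := by
    simpa using ((hasDerivAt_id (0 : ℝ)).smul_const w).const_add y
  have h2 : HasFDerivAt G (fderiv ℝ G y) (y + (0 : ℝ) • w) := by simpa using hG.hasFDerivAt
  exact (h2.comp_hasDerivAt 0 h1).unique hw

theorem norm_eq_one_iff_sq (ζ : ℂ) : ‖ζ‖ = 1 ↔ ζ.re ^ 2 + ζ.im ^ 2 = 1 := by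
  rw [← sq_eq_sq₀ (norm_nonneg _) zero_le_one, ← Complex.normSq_eq_norm_sq, Complex.normSq_apply,
    one_pow, sq, sq]

theorem isSmoothSubmanifold_torus (r₀ : ℝ) {s : ℝ} (hs : 0 < s) :
    IsSmoothSubmanifold 2 {x : KeplerState | x.1 = r₀ ∧ ‖x.2.1‖ = 1 ∧
      x.2.2.1 ^ 2 + x.2.2.2 ^ 2 = s} := by
  intro x _
  let G : KeplerState → (Fin 3 → ℝ) := fun x =>
    ![x.1 - r₀, x.2.1.re ^ 2 + x.2.1.im ^ 2 - 1, x.2.2.1 ^ 2 + x.2.2.2 ^ 2 - s]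
  have hre : ContDiff ℝ ∞ fun x : KeplerState => x.2.1.re :=
    Complex.reCLM.contDiff.comp (by fun_prop : ContDiff ℝ ∞ fun x : KeplerState => x.2.1)
  have him : ContDiff ℝ ∞ fun x : KeplerState => x.2.1.im :=
    Complex.imCLM.contDiff.comp (by fun_prop : ContDiff ℝ ∞ fun x : KeplerState => x.2.1)
  have hG : ContDiff ℝ ∞ G := by
    rw [contDiff_pi]
    intro i
    fin_cases i
    · exact (by fun_prop : ContDiff ℝ ∞ fun x : KeplerState => x.1 - r₀)
    · exact ((hre.pow 2).add (him.pow 2)).sub contDiff_const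
    · exact (by fun_prop : ContDiff ℝ ∞ fun x : KeplerState => x.2.2.1 ^ 2 + x.2.2.2 ^ 2 - s)
  refine ⟨univ, isOpen_univ, mem_univ _, 3, G, ?_, hG.contDiffOn, ?_, ?_⟩
  · rw [finrank_keplerState]
  · rintro ⟨r, ζ, u, v⟩ ⟨⟨h1, h2, h3⟩, -⟩
    simp only [norm_eq_one_iff_sq] at h1 h2 h3
    refine fderiv_surjective_of_curves (hG.contDiffAt.differentiableAt (by simp)) fun e => ?_
    -- Dilating each circle factor changes its defining function at a nonzero rate; the denominators
    -- normalize the rates.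
    refine ⟨(e 0, ((e 1 / 2 : ℝ) : ℂ) * ζ, e 2 * u / (2 * s), e 2 * v / (2 * s)), ?_⟩
    rw [hasDerivAt_pi]
    have hl : ∀ a b : ℝ, HasDerivAt (fun t : ℝ => a + t * b) b 0 := fun a b => by
      simpa using ((hasDerivAt_id (0 : ℝ)).mul_const b).const_add a
    intro i
    fin_cases i
    · simpa [G] using (hl r (e 0)).sub_const r₀
    · have h4 := (((hl ζ.re (e 1 / 2 * ζ.re)).pow 2).add
        ((hl ζ.im (e 1 / 2 * ζ.im)).pow 2)).sub_const 1
      convert h4 using 1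
      · funext t; simp [G]
      · simp
        linear_combination -(e 1) * h2
    · have h4 := (((hl u (e 2 * u / (2 * s))).pow 2).add
        ((hl v (e 2 * v / (2 * s))).pow 2)).sub_const s
      have h5 : e 2 * (u ^ 2 + v ^ 2) / s = e 2 := by rw [h3, mul_div_cancel_right₀ _ hs.ne']
      convert h4 using 1
      · funext t; simp [G]
      · simp
        linear_combination -h5
  · ext ⟨r, ζ, u, v⟩
    simp only [inter_univ, mem_ofPred_eq, norm_eq_one_iff_sq, mem_univ, true_and, G]
    simp [sub_eq_zero]

theorem isSmoothSubmanifold_circles (r₀ : ℝ) {s : ℝ} (hs : 0 < s) :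
    IsSmoothSubmanifold 1 {x : KeplerState | (x.1 = r₀ ∧ ‖x.2.1‖ = 1 ∧
      x.2.2.1 ^ 2 + x.2.2.2 ^ 2 = s) ∧ x.2.2.2 = 0} := by
  intro x _
  let G : KeplerState → (Fin 4 → ℝ) := fun x =>
    ![x.1 - r₀, x.2.1.re ^ 2 + x.2.1.im ^ 2 - 1, x.2.2.1 ^ 2 + x.2.2.2 ^ 2 - s, x.2.2.2]
  have hre : ContDiff ℝ ∞ fun x : KeplerState => x.2.1.re :=
    Complex.reCLM.contDiff.comp (by fun_prop : ContDiff ℝ ∞ fun x : KeplerState => x.2.1)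
  have him : ContDiff ℝ ∞ fun x : KeplerState => x.2.1.im :=
    Complex.imCLM.contDiff.comp (by fun_prop : ContDiff ℝ ∞ fun x : KeplerState => x.2.1)
  have hG : ContDiff ℝ ∞ G := by
    rw [contDiff_pi]
    intro i
    fin_cases i
    · exact (by fun_prop : ContDiff ℝ ∞ fun x : KeplerState => x.1 - r₀)
    · exact ((hre.pow 2).add (him.pow 2)).sub contDiff_const
    · exact (by fun_prop : ContDiff ℝ ∞ fun x : KeplerState => x.2.2.1 ^ 2 + x.2.2.2 ^ 2 - s)
    · exact (by fun_prop : ContDiff ℝ ∞ fun x : KeplerState => x.2.2.2)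
  refine ⟨univ, isOpen_univ, mem_univ _, 4, G, ?_, hG.contDiffOn, ?_, ?_⟩
  · rw [finrank_keplerState]
  · rintro ⟨r, ζ, u, v⟩ ⟨⟨⟨h1, h2, h3⟩, h0⟩, -⟩
    simp only [norm_eq_one_iff_sq] at h0 h1 h2 h3
    subst h0
    refine fderiv_surjective_of_curves (hG.contDiffAt.differentiableAt (by simp)) fun e => ?_
    refine ⟨(e 0, ((e 1 / 2 : ℝ) : ℂ) * ζ, e 2 * u / (2 * s), e 3), ?_⟩
    rw [hasDerivAt_pi]
    have hl : ∀ a b : ℝ, HasDerivAt (fun t : ℝ => a + t * b) b 0 := fun a b => by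
      simpa using ((hasDerivAt_id (0 : ℝ)).mul_const b).const_add a
    intro i
    fin_cases i
    · simpa [G] using (hl r (e 0)).sub_const r₀
    · have h4 := (((hl ζ.re (e 1 / 2 * ζ.re)).pow 2).add
        ((hl ζ.im (e 1 / 2 * ζ.im)).pow 2)).sub_const 1
      convert h4 using 1
      · funext t; simp [G]
      · simp
        linear_combination -(e 1) * h2
    · have h4 := (((hl u (e 2 * u / (2 * s))).pow 2).add ((hl 0 (e 3)).pow 2)).sub_const s
      have h5 : e 2 * (u ^ 2 + 0 ^ 2) / s = e 2 := by rw [h3, mul_div_cancel_right₀ _ hs.ne']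
      convert h4 using 1
      · funext t; simp [G]
      · simp
        linear_combination -h5
    · simpa [G] using hl 0 (e 3)
  · ext ⟨r, ζ, u, v⟩
    simp only [inter_univ, mem_ofPred_eq, norm_eq_one_iff_sq, mem_univ, true_and, G]
    simp [sub_eq_zero, and_assoc]

theorem Models.keplerField_fst (H : P.Models S Θ) {u v : ℝ} {ζ : ℂ} :
    (S.keplerField Θ P.γ (P.R q₀, ζ, u, v)).1 = v * √|q₀| := by
  simp [SphericalSurface.keplerField, H.shape_R]

/-- The field is tangent to the boundary of the block where the radial velocity vanishes. -/
theorem Models.tangency_block (H : P.Models S Θ) (hT : P.IsThreshold q₀) :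
    tangency (S.keplerField Θ P.γ) (P.manifold S Θ) (P.block S Θ q₀) =
      {x : KeplerState | (x.1 = P.R q₀ ∧ ‖x.2.1‖ = 1 ∧
        x.2.2.1 ^ 2 + x.2.2.2 ^ 2 = 2 * P.γ - 2 * P.h / q₀) ∧ x.2.2.2 = 0} := by
  rw [tangency, H.relBoundary_block hT]
  ext ⟨r, ζ, u, v⟩
  refine and_congr_right fun hb => ?_
  obtain ⟨h1, h2, h3⟩ := hb
  simp only at h1 h2 h3 ⊢
  subst h1
  have hs : √|q₀| ≠ 0 := (Real.sqrt_pos.2 (abs_pos.2 hT.neg.ne)).ne'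
  constructor
  · rintro ⟨c, hc0, hc, hev⟩
    have h4 : HasDerivAt (fun t => (c t).1) (v * √|q₀|) 0 := by
      have h5 := (hasFDerivAt_fst (𝕜 := ℝ) (p := c 0)).comp_hasDerivAt (0 : ℝ) hc
      rw [← H.keplerField_fst (ζ := ζ) (u := u)]
      exact h5
    have h6 : HasDerivAt (fun t => (c t).1) 0 0 := by
      refine (hasDerivAt_const (0 : ℝ) (P.R q₀)).congr_of_eventuallyEq ?_
      filter_upwards [hev] with t ht using ht.1
    simpa [hs] using h4.unique h6
  · rintro rfl
    have hu : u ≠ 0 := by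
      rintro rfl
      have := hT.radius_pos
      norm_num at h3
      linarith
    -- For v = 0 the field has neither an r- nor a u-component, so it is the velocity of a uniform
    -- rotation of both circles. The second angular speed is the v-component divided by u, which is
    -- nonzero by the energy relation.
    set w := S.keplerField Θ P.γ (P.R q₀, ζ, u, 0) with hw
    let α : ℝ := u * (√|q₀| / P.F q₀)
    have hw1 : w = (0, (α : ℂ) * Complex.I * ζ, 0, w.2.2.2) := by
      refine Prod.ext ?_ (Prod.ext ?_ (Prod.ext ?_ rfl))
      · rw [hw, H.keplerField_fst]; simp
      · simp [hw, SphericalSurface.keplerField, H.shape_R, H.f_R, α]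
      · simp [hw, SphericalSurface.keplerField]
    let δ : ℝ := w.2.2.2 / u
    have hl : ∀ a : ℝ, HasDerivAt (fun t : ℝ => a * t) a 0 := fun a => by
      simpa using (hasDerivAt_id (0 : ℝ)).const_mul a
    refine ⟨fun t => (P.R q₀, Complex.exp ((α * t : ℝ) * Complex.I) * ζ, u * Real.cos (δ * t),
      u * Real.sin (δ * t)), by simp, ?_, Eventually.of_forall fun t => ⟨rfl, ?_, ?_⟩⟩
    · rw [hw1]
      refine (hasDerivAt_const (0 : ℝ) (P.R q₀)).prodMk (HasDerivAt.prodMk ?_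
        (HasDerivAt.prodMk ?_ ?_))
      · have h4 : HasDerivAt (fun t : ℝ => ((α * t : ℝ) : ℂ) * Complex.I) (α * Complex.I) 0 :=
          (hl α).ofReal_comp.mul_const Complex.I
        have h5 := h4.cexp.mul_const ζ
        simpa using h5
      · simpa using (hl δ).cos.const_mul u
      · have h6 := (hl δ).sin.const_mul u
        simp only [mul_zero, Real.cos_zero, one_mul] at h6
        rwa [show u * δ = w.2.2.2 by simp only [δ]; field_simp] at h6
    · simp only
      rw [norm_mul, Complex.norm_exp_ofReal_mul_I, one_mul, h2]
    · simp only
      rw [← h3]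
      linear_combination u ^ 2 * Real.sin_sq_add_cos_sq (δ * t)

end KeplerData

/-! ### Leaving a set in regularized time. -/

section Exit

/-- Whether a (partial) flow leaves a set immediately can be decided in any regularized time. -/
theorem exists_forall_notMem_iff_eventually {X : Type*} {B : Set X} {Φ : ℝ → X → Prop}
    (huniq : ∀ t y y', Φ t y → Φ t y' → y = y') {τ : ℝ → ℝ} (hmono : StrictMono τ)
    (hcont : Continuous τ) (h0 : τ 0 = 0) {orb : ℝ → X}
    (hΦ : ∀ᶠ σ in 𝓝[>] 0, Φ (τ σ) (orb σ)) :
    (∃ ε > 0, ∀ t ∈ Ioo (0 : ℝ) ε, ∀ y, Φ t y → y ∉ B) ↔ ∀ᶠ σ in 𝓝[>] 0, orb σ ∉ B := by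
  constructor
  · rintro ⟨ε, hε, h⟩
    have h1 : ∀ᶠ σ in 𝓝[>] (0 : ℝ), τ σ < ε := by
      have : Tendsto τ (𝓝[>] 0) (𝓝 0) := by
        rw [← h0]; exact hcont.continuousAt.tendsto.mono_left (h0.symm ▸ nhdsWithin_le_nhds)
      exact this.eventually (gt_mem_nhds hε)
    filter_upwards [h1, hΦ, self_mem_nhdsWithin] with σ h2 h3 h4
    exact h (τ σ) ⟨by rw [← h0]; exact hmono h4, h2⟩ _ h3
  · intro h
    obtain ⟨δ, hδ, hsub⟩ := mem_nhdsGT_iff_exists_Ioo_subset.1 (h.and hΦ)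
    refine ⟨τ δ, by rw [← h0]; exact hmono hδ, fun t ht y hy => ?_⟩
    rw [← h0] at ht
    obtain ⟨σ, hσ, rfl⟩ := intermediate_value_Ioo (le_of_lt hδ) hcont.continuousOn ht
    obtain ⟨h1, h2⟩ := hsub hσ
    rw [huniq _ _ _ hy h2]
    exact h1

/-- A continuous function which exceeds `q₀ < 0` somewhere reaches a value in `(q₀, 0)` before it
becomes nonnegative. -/
theorem exists_mem_Ioo_of_continuous {Q : ℝ → ℝ} (hQ : Continuous Q) {q₀ : ℝ} (hq : q₀ < 0)
    (h0 : Q 0 ≤ q₀) {σ₁ : ℝ} (h1 : q₀ < Q σ₁) :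
    ∃ σ, q₀ < Q σ ∧ ∀ s ∈ uIcc 0 σ, Q s < 0 := by
  wlog hpos : 0 < σ₁ generalizing Q σ₁
  · have hne : σ₁ ≠ 0 := by rintro rfl; exact absurd h1 (not_lt.2 h0)
    have hneg : σ₁ < 0 := lt_of_le_of_ne (not_lt.1 hpos) hne
    obtain ⟨σ, h2, h3⟩ := this (Q := fun s => Q (-s)) (σ₁ := -σ₁) (by fun_prop) (by simpa using h0)
      (by simpa using h1) (by linarith)
    refine ⟨-σ, h2, fun s hs => ?_⟩
    have := h3 (-s) ?_
    · simpa using this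
    · rw [mem_uIcc] at hs ⊢
      rcases hs with h | h
      · right; constructor <;> linarith
      · left; constructor <;> linarith
  -- A level strictly above q₀ and below 0. At the first time it is reached the function has not
  -- been nonnegative yet, since it would have crossed this level before.
  set L := min (Q σ₁) (q₀ / 2) with hL
  have hL0 : L < 0 := (min_le_right _ _).trans_lt (by linarith)
  have hLq : q₀ < L := lt_min h1 (by linarith)
  have hK : IsCompact (Icc 0 σ₁ ∩ Q ⁻¹' {L}) :=
    isCompact_Icc.inter_right (isClosed_singleton.preimage hQ)
  have hne : (Icc 0 σ₁ ∩ Q ⁻¹' {L}).Nonempty := by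
    obtain ⟨s, hs, hsL⟩ := intermediate_value_Icc hpos.le hQ.continuousOn
      ⟨h0.trans hLq.le, min_le_left _ _⟩
    exact ⟨s, hs, hsL⟩
  obtain ⟨σ, ⟨hσ, hσL⟩, hleast⟩ := hK.exists_isLeast hne
  have hσL' : Q σ = L := hσL
  refine ⟨σ, hσL'.symm ▸ hLq, fun s hs => ?_⟩
  rw [uIcc_of_le hσ.1] at hs
  by_contra! hs0
  obtain ⟨s', hs', hs'L⟩ := intermediate_value_Icc hs.1 hQ.continuousOn
    ⟨h0.trans hLq.le, hL0.le.trans hs0⟩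
  have h2 := hleast ⟨⟨hs'.1, hs'.2.trans (hs.2.trans hσ.2)⟩, hs'L⟩
  have h3 : s = σ := le_antisymm hs.2 (h2.trans hs'.2)
  rw [h3, hσL'] at hs0
  exact absurd hL0 (not_lt.2 hs0)

end Exit

/-! ### Ingress and egress sets; the block isolates the collisions. -/

namespace KeplerData

variable {P : KeplerData} {S : SphericalSurface} {Θ : ℝ → ℝ} {q₀ : ℝ}

/-- The angular momentum of a boundary state. -/
def angMom (P : KeplerData) (q₀ u : ℝ) : ℝ := u * (P.F q₀ * √(-q₀))

/-- The radial momentum of a boundary state. -/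
def radMom (q₀ v : ℝ) : ℝ := v * √(-q₀)

theorem Models.boundary_state (H : P.Models S Θ) (hT : P.IsThreshold q₀) {u v : ℝ} {ζ : ℂ}
    (hζ : ‖ζ‖ = 1) (huv : u ^ 2 + v ^ 2 = 2 * P.γ - 2 * P.h / q₀) :
    ((P.R q₀, ζ, u, v) : KeplerState) = P.state q₀ (radMom q₀ v) (P.angMom q₀ u) ζ ∧
      P.energy q₀ (radMom q₀ v) (P.angMom q₀ u) = 2 * P.h := by
  have h1 := H.exists_state (r := P.R q₀) (u := u) (v := v) (ζ := ζ) (H.R_mem q₀)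
    (by rw [H.shape_R]; exact hT.neg)
  rw [H.shape_R] at h1
  refine ⟨h1, ?_⟩
  have h2 : ((P.R q₀, ζ, u, v) : KeplerState) ∈ P.manifold S Θ \ P.collisions S Θ :=
    ⟨(H.mk_mem_manifold hT.neg).2 ⟨hζ, huv⟩, fun h => (H.R_mem q₀).1.ne' h.2⟩
  rw [h1] at h2
  exact ((H.state_mem_diff hT.neg).1 h2).2

theorem Models.orbit_mem_block_iff (H : P.Models S Θ) {q p l σ : ℝ} {ζ : ℂ} (hζ : ‖ζ‖ = 1)
    (hE : P.energy q p l = 2 * P.h) (hσ : orbitQ P.C P.γ (P.β * l) q p σ < 0) :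
    P.orbit q p l ζ σ ∈ P.block S Θ q₀ ↔ orbitQ P.C P.γ (P.β * l) q p σ ≤ q₀ := by
  have h1 : P.orbit q p l ζ σ ∈ P.manifold S Θ := by
    refine ((H.state_mem_diff hσ).2 ⟨?_, ?_⟩).1
    · rw [norm_mul, hζ, Complex.norm_exp_ofReal_mul_I, one_mul]
    · rw [energy_orbit, hE]
  have h2 : (P.orbit q p l ζ σ).1 = P.R (orbitQ P.C P.γ (P.β * l) q p σ) := rfl
  rw [block, mem_ofPred_eq, h2, P.strictMono_R.le_iff_le]
  exact and_iff_right h1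

theorem continuous_orbitQ (C γ w q p : ℝ) : Continuous (orbitQ C γ w q p) :=
  continuous_iff_continuousAt.2 fun σ => (hasDerivAt_orbitQ σ).continuousAt

theorem exists_forall_orbitQ_neg {C γ w q p : ℝ} (hq : q < 0) :
    ∃ δ > 0, ∀ σ, |σ| < δ → ∀ s ∈ uIcc 0 σ, orbitQ C γ w q p s < 0 := by
  have h1 : ∀ᶠ σ in 𝓝 (0 : ℝ), orbitQ C γ w q p σ < 0 :=
    (continuous_orbitQ C γ w q p).continuousAt.eventually (gt_mem_nhds (by simpa using hq))
  obtain ⟨δ, hδ, h2⟩ := Metric.eventually_nhds_iff.1 h1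
  refine ⟨δ, hδ, fun σ hσ s hs => h2 ?_⟩
  rw [Real.dist_eq]
  exact (abs_sub_left_of_mem_uIcc hs).trans_lt (by simpa using hσ)

/-- The orbit through a boundary state leaves the block forwards (`e = 1`) or backwards
(`e = -1`) if and only if the height `q` exceeds `q₀` there. -/
theorem Models.leaves_iff (H : P.Models S Θ) (hT : P.IsThreshold q₀) {p l : ℝ} {ζ : ℂ}
    (hζ : ‖ζ‖ = 1) (hE : P.energy q₀ p l = 2 * P.h) {e : ℝ} (he : e = 1 ∨ e = -1) :
    (∃ ε > 0, ∀ t ∈ Ioo (0 : ℝ) ε, ∀ y, FlowsTo (S.keplerField Θ P.γ)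
      (P.manifold S Θ \ P.collisions S Θ) (P.state q₀ p l ζ) (e * t) y → y ∉ P.block S Θ q₀) ↔
      ∀ᶠ σ in 𝓝[>] 0, q₀ < orbitQ P.C P.γ (P.β * l) q₀ p (e * σ) := by
  obtain ⟨τ, h1, h2, h3, h4⟩ := H.exists_flowsTo_orbit hT.neg hζ hE
  obtain ⟨δ, hδ, h5⟩ := exists_forall_orbitQ_neg (C := P.C) (γ := P.γ) (w := P.β * l) (p := p) hT.neg
  have hee : e * e = 1 := by rcases he with h | h <;> rw [h] <;> norm_num
  have habs : |e| = 1 := by rcases he with h | h <;> rw [h] <;> norm_num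
  have hev : ∀ᶠ σ in 𝓝[>] (0 : ℝ), ∀ s ∈ uIcc 0 (e * σ), orbitQ P.C P.γ (P.β * l) q₀ p s < 0 := by
    filter_upwards [Ioo_mem_nhdsGT hδ] with σ hσ
    refine h5 _ ?_
    rw [abs_mul, habs, one_mul, abs_of_pos hσ.1]
    exact hσ.2
  -- Reversing both times turns the backward orbit into a forward one, so a single criterion covers
  -- both directions.
  have hmono : StrictMono fun σ => e * τ (e * σ) := by
    rcases he with rfl | rfl
    · simpa using h1
    · intro a b hab
      have : τ (-b) < τ (-a) := h1 (by linarith)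
      simp only [neg_one_mul]
      linarith
  rw [exists_forall_notMem_iff_eventually (Φ := fun t y => FlowsTo (S.keplerField Θ P.γ)
      (P.manifold S Θ \ P.collisions S Θ) (P.state q₀ p l ζ) (e * t) y)
      (τ := fun σ => e * τ (e * σ)) (orb := fun σ => P.orbit q₀ p l ζ (e * σ))
      (fun t y y' h h' => H.flow_unique h h') hmono (by fun_prop) (by simp [h3])]
  · refine ⟨fun h => ?_, fun h => ?_⟩
    · filter_upwards [h, hev] with σ h6 h7
      rw [H.orbit_mem_block_iff hζ hE (h7 _ right_mem_uIcc)] at h6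
      exact not_le.1 h6
    · filter_upwards [h, hev] with σ h6 h7
      rw [H.orbit_mem_block_iff hζ hE (h7 _ right_mem_uIcc)]
      exact not_le.2 h6
  · filter_upwards [hev] with σ h6
    rw [← mul_assoc, hee, one_mul]
    exact h4 _ h6

/-- The sign of the initial velocity of q decides. If it vanishes, the acceleration is positive by
the choice of q₀, so the orbit touches the block from outside; such points belong to both b⁺ and b⁻.
-/
theorem IsThreshold.leaves_iff_radMom (hT : P.IsThreshold q₀) {p l : ℝ}
    (hE : P.energy q₀ p l = 2 * P.h) {e : ℝ} (he : e = 1 ∨ e = -1) :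
    (∀ᶠ σ in 𝓝[>] 0, q₀ < orbitQ P.C P.γ (P.β * l) q₀ p (e * σ)) ↔ 0 ≤ e * p := by
  have hee : e * e = 1 := by rcases he with h | h <;> rw [h] <;> norm_num
  set Q := orbitQ P.C P.γ (P.β * l) q₀ p with hQ
  set V := orbitP P.C P.γ (P.β * l) q₀ p with hV
  have hl : ∀ σ, HasDerivAt (fun σ : ℝ => e * σ) e σ := fun σ => by
    simpa using (hasDerivAt_id σ).const_mul e
  have hdq : ∀ σ, HasDerivAt (fun σ => Q (e * σ)) (V (e * σ) * e) σ := fun σ =>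
    (hasDerivAt_orbitQ (e * σ)).comp σ (hl σ)
  have hdp : HasDerivAt (fun σ => V (e * σ) * e) (-((P.β * l) ^ 2 * (q₀ - P.C)) - P.γ) 0 := by
    have h1 := ((hasDerivAt_orbitP (C := P.C) (γ := P.γ) (Ω := P.β * l) (q₀ := q₀) (p₀ := p)
      (e * 0)).comp 0 (hl 0)).mul_const e
    rw [mul_assoc, hee, mul_zero, orbitQ_zero, mul_one] at h1
    exact h1
  have hV0 : V (e * 0) * e = e * p := by simp [hV, mul_comm]
  have hQ0 : Q (e * 0) = q₀ := by simp [hQ]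
  rcases lt_trichotomy (e * p) 0 with h | h | h
  · refine iff_of_false (fun hev => ?_) (not_le.2 h)
    obtain ⟨ε, hε, h1⟩ := exists_forall_lt_of_initially_increasing (fun σ => (hdq σ).neg) hdp.neg
      (Or.inl (by simp only [hV0]; linarith))
    obtain ⟨σ, h2, h3⟩ := (hev.and (Ioo_mem_nhdsGT hε)).exists
    have h4 := h1 σ h3
    simp only [Pi.neg_apply, hQ0] at h4
    linarith
  · refine iff_of_true ?_ h.ge
    have hp : p = 0 := by
      have : e * (e * p) = 0 := by rw [h, mul_zero]
      rwa [← mul_assoc, hee, one_mul] at this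
    obtain ⟨ε, hε, h1⟩ := exists_forall_lt_of_initially_increasing hdq hdp
      (Or.inr ⟨hV0.trans h, hT.accel_pos q₀ le_rfl l (hp ▸ hE)⟩)
    filter_upwards [Ioo_mem_nhdsGT hε] with σ hσ
    have := h1 σ hσ
    rwa [hQ0] at this
  · refine iff_of_true ?_ h.le
    obtain ⟨ε, hε, h1⟩ := exists_forall_lt_of_initially_increasing hdq hdp (Or.inl (by rwa [hV0]))
    filter_upwards [Ioo_mem_nhdsGT hε] with σ hσ
    have := h1 σ hσ
    rwa [hQ0] at this

theorem Models.egress_block (H : P.Models S Θ) (hT : P.IsThreshold q₀) :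
    egress (S.keplerField Θ P.γ) (P.manifold S Θ) (P.collisions S Θ) (P.block S Θ q₀) =
      {x : KeplerState | (x.1 = P.R q₀ ∧ ‖x.2.1‖ = 1 ∧
        x.2.2.1 ^ 2 + x.2.2.2 ^ 2 = 2 * P.γ - 2 * P.h / q₀) ∧ 0 ≤ x.2.2.2} := by
  rw [egress, H.relBoundary_block hT]
  ext ⟨r, ζ, u, v⟩
  refine and_congr_right fun hb => ?_
  obtain ⟨h1, h2, h3⟩ := hb
  simp only at h1 h2 h3 ⊢
  subst h1
  obtain ⟨h4, h5⟩ := H.boundary_state hT h2 h3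
  rw [h4]
  have h6 := (H.leaves_iff hT h2 h5 (e := 1) (Or.inl rfl)).trans
    (hT.leaves_iff_radMom h5 (Or.inl rfl))
  simp only [one_mul] at h6
  rw [h6, radMom]
  exact mul_nonneg_iff_of_pos_right (Real.sqrt_pos.2 (by linarith [hT.neg]))

theorem Models.ingress_block (H : P.Models S Θ) (hT : P.IsThreshold q₀) :
    ingress (S.keplerField Θ P.γ) (P.manifold S Θ) (P.collisions S Θ) (P.block S Θ q₀) =
      {x : KeplerState | (x.1 = P.R q₀ ∧ ‖x.2.1‖ = 1 ∧
        x.2.2.1 ^ 2 + x.2.2.2 ^ 2 = 2 * P.γ - 2 * P.h / q₀) ∧ x.2.2.2 ≤ 0} := by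
  rw [ingress, H.relBoundary_block hT]
  ext ⟨r, ζ, u, v⟩
  refine and_congr_right fun hb => ?_
  obtain ⟨h1, h2, h3⟩ := hb
  simp only at h1 h2 h3 ⊢
  subst h1
  obtain ⟨h4, h5⟩ := H.boundary_state hT h2 h3
  rw [h4]
  have h6 := (H.leaves_iff hT h2 h5 (e := -1) (Or.inr rfl)).trans
    (hT.leaves_iff_radMom h5 (Or.inr rfl))
  have h7 : v ≤ 0 ↔ 0 ≤ -1 * radMom q₀ v := by
    have hs : 0 < √(-q₀) := Real.sqrt_pos.2 (by linarith [hT.neg])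
    rw [radMom, neg_one_mul, neg_nonneg]
    refine ⟨fun h => mul_nonpos_of_nonpos_of_nonneg h hs.le, fun h => ?_⟩
    by_contra! hv
    exact absurd (mul_pos hv hs) (not_lt.2 h)
  rw [h7, ← h6]
  refine exists_congr fun ε => and_congr_right fun _ => ⟨fun h t ht => ?_, fun h t ht => ?_⟩
  · exact h (-1 * t) ⟨by linarith [ht.2], by linarith [ht.1]⟩
  · have := h (-t) ⟨by linarith [ht.2], by linarith [ht.1]⟩
    simpa using this

theorem Models.isIsolatingBlock (H : P.Models S Θ) (hT : P.IsThreshold q₀) :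
    IsIsolatingBlock 1 (S.keplerField Θ P.γ) (P.manifold S Θ) (P.collisions S Θ)
      (P.block S Θ q₀) where
  subset := fun x hx => hx.1
  isCompact := H.isCompact_block hT
  nonempty_interior := by
    rw [H.relInterior_block hT]
    have h1 : ((S.rN, 1, √(2 * P.γ), 0) : KeplerState) ∈ P.collisions S Θ := by
      refine ⟨mk_mem_energyManifold.2 ⟨norm_one, Or.inl ⟨rfl, ?_⟩⟩, rfl⟩
      rw [Real.sq_sqrt (by linarith [P.γ_pos])]
      ring
    exact ⟨_, H.collisions_subset h1⟩
  smooth_boundary := by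
    rw [H.relBoundary_block hT]
    exact isSmoothSubmanifold_torus _ hT.radius_pos
  disjoint := by
    rw [H.relBoundary_block hT]
    refine disjoint_left.2 fun x hx hN => (H.R_mem q₀).1.ne' ?_
    rw [← hx.1, hN.2]
  tangency_eq := by
    rw [H.tangency_block hT, H.ingress_block hT, H.egress_block hT]
    ext x
    simp only [mem_ofPred_eq, mem_inter_iff]
    constructor
    · rintro ⟨h1, h2⟩
      exact ⟨⟨h1, h2.le⟩, ⟨h1, h2.ge⟩⟩
    · rintro ⟨⟨h1, h2⟩, ⟨-, h3⟩⟩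
      exact ⟨h1, le_antisymm h2 h3⟩
  smooth_tangency := by
    rw [H.tangency_block hT]
    exact isSmoothSubmanifold_circles _ hT.radius_pos

/-- The oscillator orbit has a rest point with nonpositive acceleration, and below q₀ there is none,
so q exceeds q₀ somewhere. It does so before q becomes nonnegative, hence within the range where the
flow is described by the oscillator. -/
theorem Models.isolates (H : P.Models S Θ) (hT : P.IsThreshold q₀) :
    Isolates (S.keplerField Θ P.γ) (P.manifold S Θ) (P.collisions S Θ) (P.block S Θ q₀) := by
  refine ⟨by rw [H.relInterior_block hT]; exact H.collisions_subset, ?_⟩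
  rintro ⟨r, ζ, u, v⟩ ⟨hB, hN⟩
  have hD : ((r, ζ, u, v) : KeplerState) ∈ P.manifold S Θ \ P.collisions S Θ := ⟨hB.1, hN⟩
  obtain ⟨hζ, hr, -, -⟩ := mk_mem_diff.1 hD
  have hq : Θ r ≤ q₀ := H.shape_le hr hB.2
  have hq0 : Θ r < 0 := hq.trans_lt hT.neg
  rw [H.exists_state hr hq0] at hD ⊢
  have hE := ((H.state_mem_diff hq0).1 hD).2
  set p := v * √(-Θ r)
  set l := u * (P.F (Θ r) * √(-Θ r))
  obtain ⟨τ, -, -, -, h4⟩ := H.exists_flowsTo_orbit hq0 hζ hE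
  obtain ⟨σ₁, h5, h6⟩ := exists_orbit_max (C := P.C) (Ω := P.β * l) (q₀ := Θ r) (p₀ := p) P.γ_pos
  have h7 : q₀ < orbitQ P.C P.γ (P.β * l) (Θ r) p σ₁ := by
    by_contra! hle
    have h8 := energy_orbit (P := P) (Θ r) p l σ₁
    rw [h5, hE] at h8
    exact absurd h6 (not_le.2 (hT.accel_pos _ hle l h8))
  obtain ⟨σ, h8, h9⟩ := exists_mem_Ioo_of_continuous (continuous_orbitQ _ _ _ _ _) hT.neg
    (by simpa using hq) h7
  refine ⟨τ σ, _, h4 σ h9, ?_⟩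
  rw [H.orbit_mem_block_iff hζ hE (h9 _ right_mem_uIcc)]
  exact not_le.2 h8

end KeplerData

/-! ### The map across the block and its smooth extension. -/

namespace KeplerData

variable {P : KeplerData} {S : SphericalSurface} {Θ : ℝ → ℝ} {q₀ : ℝ}

/-- Radially ingoing states end in the collision. -/
theorem Models.mem_asymptoticIngress (H : P.Models S Θ) (hT : P.IsThreshold q₀) {v : ℝ} {ζ : ℂ}
    (hζ : ‖ζ‖ = 1) (huv : (0 : ℝ) ^ 2 + v ^ 2 = 2 * P.γ - 2 * P.h / q₀) (hv : v ≤ 0) :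
    ((P.R q₀, ζ, 0, v) : KeplerState) ∈ asymptoticIngress (S.keplerField Θ P.γ) (P.manifold S Θ)
      (P.collisions S Θ) (P.block S Θ q₀) := by
  refine ⟨by rw [H.ingress_block hT]; exact ⟨⟨rfl, hζ, huv⟩, hv⟩, fun t ht y hy => ?_⟩
  obtain ⟨h4, hE⟩ := H.boundary_state hT hζ huv
  have hl : P.angMom q₀ 0 = 0 := zero_mul _
  rw [hl] at h4 hE
  rw [h4] at hy
  set p := radMom q₀ v with hp
  have hp0 : p ≤ 0 := mul_nonpos_of_nonpos_of_nonneg hv (Real.sqrt_nonneg _)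
  have hQ : ∀ σ, orbitQ P.C P.γ (P.β * 0) q₀ p σ = q₀ + p * σ - P.γ * σ ^ 2 / 2 := fun σ => by
    rw [orbitQ, if_pos (mul_zero _)]
  have hγ := P.γ_pos
  have hQle : ∀ σ, 0 ≤ σ → orbitQ P.C P.γ (P.β * 0) q₀ p σ ≤ q₀ := fun σ hσ => by
    rw [hQ]
    have h1 : p * σ ≤ 0 := mul_nonpos_of_nonpos_of_nonneg hp0 hσ
    have h2 : 0 ≤ P.γ * σ ^ 2 / 2 := by positivity
    linarith
  obtain ⟨τ, hmono, hcont, hτ0, hflow⟩ := H.exists_flowsTo_orbit hT.neg hζ hE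
  have hflow' : ∀ σ, 0 ≤ σ → FlowsTo (S.keplerField Θ P.γ)
      (P.manifold S Θ \ P.collisions S Θ) (P.state q₀ p 0 ζ) (τ σ) (P.orbit q₀ p 0 ζ σ) := by
    intro σ hσ
    refine hflow σ fun s hs => ?_
    rw [uIcc_of_le hσ] at hs
    exact (hQle s hs.1).trans_lt hT.neg
  by_cases hex : ∃ σ, 0 ≤ σ ∧ t ≤ τ σ
  · obtain ⟨σ, hσ, htσ⟩ := hex
    obtain ⟨s, hs, rfl⟩ := intermediate_value_Icc hσ hcont.continuousOn
      (show t ∈ Icc (τ 0) (τ σ) from ⟨hτ0.symm ▸ ht, htσ⟩)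
    rw [H.flow_unique hy (hflow' s hs.1),
      H.orbit_mem_block_iff hζ hE ((hQle s hs.1).trans_lt hT.neg)]
    exact hQle s hs.1
  -- Otherwise t lies beyond all times τ(σ). A trajectory lasting until t would be defined at their
  -- supremum, where its radius must be the limit r_N; but trajectories avoid the collision set.
  exfalso
  push Not at hex
  obtain ⟨J, c, hc, htJ, hc0, -⟩ := hy
  have hlt : ∀ σ, τ σ ≤ t := fun σ =>
    (hmono.monotone (le_max_left σ 0)).trans (hex _ (le_max_right σ 0)).le
  have hlim := tendsto_atTop_ciSup hmono.monotone ⟨t, by rintro _ ⟨σ, rfl⟩; exact hlt σ⟩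
  set T := ⨆ σ, τ σ
  have hTJ : T ∈ J := by
    refine hc.ordConnected.out hc.zero_mem htJ ⟨?_, le_of_tendsto' hlim hlt⟩
    rw [← hτ0]
    exact hmono.monotone.ge_of_tendsto hlim 0
  have h1 : Tendsto (fun σ => (c (τ σ)).1) atTop (𝓝 (c T).1) :=
    ((hc.deriv T hTJ).continuousAt.tendsto.comp hlim).fst_nhds
  have h2 : Tendsto (fun σ => P.R (orbitQ P.C P.γ (P.β * 0) q₀ p σ)) atTop (𝓝 P.a) := by
    refine P.tendsto_R_atBot.comp (tendsto_atBot_mono' _ (f₁ := fun σ => -(P.γ / 2 * σ)) ?_ ?_)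
    · filter_upwards [eventually_ge_atTop 1] with σ hσ
      rw [hQ]
      have h3 : p * σ ≤ 0 := mul_nonpos_of_nonpos_of_nonneg hp0 (by linarith)
      have h4 : P.γ * σ ≤ P.γ * σ ^ 2 := by
        have : σ ≤ σ ^ 2 := by nlinarith
        exact mul_le_mul_of_nonneg_left this hγ.le
      linarith [hT.neg]
    · exact tendsto_neg_atTop_atBot.comp (tendsto_id.const_mul_atTop (by linarith))
  have h3 : (fun σ => (c (τ σ)).1) =ᶠ[atTop] fun σ => P.R (orbitQ P.C P.γ (P.β * 0) q₀ p σ) := by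
    filter_upwards [eventually_ge_atTop 0] with σ hσ
    have hJ : τ σ ∈ J := hc.ordConnected.out hc.zero_mem htJ
      ⟨by rw [← hτ0]; exact hmono.monotone hσ, hlt σ⟩
    have := H.flow_unique ⟨J, c, hc, hJ, hc0, rfl⟩ (hflow' σ hσ)
    rw [this]
    rfl
  have h5 : (c T).1 = P.a := tendsto_nhds_unique h1 (h2.congr' h3.symm)
  have h6 := hc.mem T hTJ
  exact h6.2 ⟨h6.1, h5.trans H.a_eq⟩

/-- The rotation of the longitude along the passage through the block is by the `n`-th power of
`conj Z / Z` for this complex function `Z` of the velocities. -/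
def phase (P : KeplerData) (q₀ u v : ℝ) : ℂ :=
  (((P.β * P.angMom q₀ u) ^ 2 * (q₀ - P.C) + P.γ : ℝ) : ℂ)
    - (radMom q₀ v * (P.β * P.angMom q₀ u) : ℝ) * Complex.I

/-- The map across the block. -/
def across (P : KeplerData) (q₀ : ℝ) (n : ℕ) (x : KeplerState) : KeplerState :=
  (x.1, x.2.1 * ((starRingEnd ℂ) (P.phase q₀ x.2.2.1 x.2.2.2) / P.phase q₀ x.2.2.1 x.2.2.2) ^ n,
    x.2.2.1, -x.2.2.2)

theorem phase_neg (u v : ℝ) : P.phase q₀ u (-v) = (starRingEnd ℂ) (P.phase q₀ u v) := by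
  simp only [phase, radMom, map_sub, map_mul, Complex.conj_ofReal, Complex.conj_I]
  push_cast
  ring

/-- The imaginary part vanishes only if p = 0 or l = 0. In the first case the real part is negative
by the choice of q₀, in the second it equals γ > 0. -/
theorem Models.phase_ne_zero (H : P.Models S Θ) (hT : P.IsThreshold q₀) {u v : ℝ}
    (huv : u ^ 2 + v ^ 2 = 2 * P.γ - 2 * P.h / q₀) : P.phase q₀ u v ≠ 0 := by
  intro h0
  have hs : 0 < √(-q₀) := Real.sqrt_pos.2 (by linarith [hT.neg])
  have hF := P.F_pos q₀
  have hβ := P.β_pos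
  have him := congrArg Complex.im h0
  have hre := congrArg Complex.re h0
  rw [phase, Complex.sub_im, Complex.ofReal_im, Complex.im_ofReal_mul, Complex.I_im, zero_sub,
    mul_one, Complex.zero_im, neg_eq_zero, mul_eq_zero] at him
  rw [phase, Complex.sub_re, Complex.ofReal_re, Complex.re_ofReal_mul, Complex.I_re, mul_zero,
    sub_zero, Complex.zero_re] at hre
  rcases him with h | h
  · have hE := (H.boundary_state hT (ζ := 1) norm_one huv).2
    rw [h] at hE
    have := hT.accel_pos q₀ le_rfl _ hE
    linarith
  · rw [h] at hre
    have := P.γ_pos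
    norm_num at hre
    linarith

/-- Reversing v conjugates the phase, so the second rotation undoes the first. The inverse of the
map is thus given by the same smooth formula. -/
theorem across_across (n : ℕ) {x : KeplerState} (hx : P.phase q₀ x.2.2.1 x.2.2.2 ≠ 0) :
    P.across q₀ n (P.across q₀ n x) = x := by
  obtain ⟨r, ζ, u, v⟩ := x
  have hc : (starRingEnd ℂ) (P.phase q₀ u v) ≠ 0 := by simpa using hx
  simp only [across, phase_neg, Complex.conj_conj, neg_neg]
  rw [mul_assoc, ← mul_pow, div_mul_div_cancel₀ hx, div_self hc, one_pow, mul_one]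

theorem across_mem (n : ℕ) {r₀ s : ℝ} {x : KeplerState}
    (hx0 : P.phase q₀ x.2.2.1 x.2.2.2 ≠ 0)
    (hx : x.1 = r₀ ∧ ‖x.2.1‖ = 1 ∧ x.2.2.1 ^ 2 + x.2.2.2 ^ 2 = s) :
    (P.across q₀ n x).1 = r₀ ∧ ‖(P.across q₀ n x).2.1‖ = 1 ∧
      (P.across q₀ n x).2.2.1 ^ 2 + (P.across q₀ n x).2.2.2 ^ 2 = s := by
  obtain ⟨h1, h2, h3⟩ := hx
  refine ⟨h1, ?_, by simpa [across] using h3⟩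
  have h4 : ‖P.phase q₀ x.2.2.1 x.2.2.2‖ ≠ 0 := norm_ne_zero_iff.2 hx0
  simp only [across]
  rw [norm_mul, norm_pow, norm_div, RCLike.norm_conj, div_self h4, one_pow, mul_one, h2]

theorem contDiffOn_across (n : ℕ) :
    IsOpen {x : KeplerState | P.phase q₀ x.2.2.1 x.2.2.2 ≠ 0} ∧
    ContDiffOn ℝ ∞ (P.across q₀ n) {x : KeplerState | P.phase q₀ x.2.2.1 x.2.2.2 ≠ 0} := by
  have hZ : ContDiff ℝ ∞ fun x : KeplerState => P.phase q₀ x.2.2.1 x.2.2.2 := by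
    unfold phase angMom radMom
    refine ContDiff.sub ?_ (ContDiff.mul ?_ contDiff_const)
    · exact Complex.ofRealCLM.contDiff.comp (by fun_prop :
        ContDiff ℝ ∞ fun x : KeplerState => (P.β * (x.2.2.1 * (P.F q₀ * √(-q₀)))) ^ 2 * (q₀ - P.C) + P.γ)
    · exact Complex.ofRealCLM.contDiff.comp (by fun_prop :
        ContDiff ℝ ∞ fun x : KeplerState =>
          x.2.2.2 * √(-q₀) * (P.β * (x.2.2.1 * (P.F q₀ * √(-q₀)))))
  have hZc : ContDiff ℝ ∞ fun x : KeplerState => (starRingEnd ℂ) (P.phase q₀ x.2.2.1 x.2.2.2) :=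
    Complex.conjCLE.contDiff.comp hZ
  refine ⟨isOpen_ne_fun hZ.continuous continuous_const, ?_⟩
  have h1 : ContDiffOn ℝ ∞ (fun x : KeplerState => (starRingEnd ℂ) (P.phase q₀ x.2.2.1 x.2.2.2) /
      P.phase q₀ x.2.2.1 x.2.2.2) {x : KeplerState | P.phase q₀ x.2.2.1 x.2.2.2 ≠ 0} := by
    simp only [div_eq_mul_inv]
    exact hZc.contDiffOn.mul (hZ.contDiffOn.inv fun x hx => hx)
  have h2 : ContDiff ℝ ∞ fun x : KeplerState => x.1 := by fun_prop
  have h3 : ContDiff ℝ ∞ fun x : KeplerState => x.2.1 := by fun_prop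
  have h4 : ContDiff ℝ ∞ fun x : KeplerState => x.2.2.1 := by fun_prop
  have h5 : ContDiff ℝ ∞ fun x : KeplerState => -x.2.2.2 := by fun_prop
  exact h2.contDiffOn.prodMk ((h3.contDiffOn.mul (h1.pow n)).prodMk
    (h4.contDiffOn.prodMk h5.contDiffOn))

/-- A state with nonzero angular momentum which enters the block leaves it as described by
`across`, and this is the end of its time in the block. -/
theorem Models.flowsTo_across (H : P.Models S Θ) (hT : P.IsThreshold q₀) {n : ℕ} (hn : 0 < n)
    (hβ : P.β = 1 / n) {u v : ℝ} {ζ : ℂ} (hζ : ‖ζ‖ = 1)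
    (huv : u ^ 2 + v ^ 2 = 2 * P.γ - 2 * P.h / q₀) (hu : u ≠ 0) (hv : v ≤ 0) :
    FlowsTo (S.keplerField Θ P.γ) (P.manifold S Θ \ P.collisions S Θ) (P.R q₀, ζ, u, v)
        (exitTime (S.keplerField Θ P.γ) (P.manifold S Θ) (P.collisions S Θ) (P.block S Θ q₀)
          (P.R q₀, ζ, u, v))
        (P.across q₀ n (P.R q₀, ζ, u, v)) ∧
      (P.R q₀, ζ, u, v) ∉ asymptoticIngress (S.keplerField Θ P.γ) (P.manifold S Θ)
        (P.collisions S Θ) (P.block S Θ q₀) := by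
  obtain ⟨hst, hE⟩ := H.boundary_state hT hζ huv
  have hs : 0 < √(-q₀) := Real.sqrt_pos.2 (by linarith [hT.neg])
  have hF := P.F_pos q₀
  set p := radMom q₀ v with hp
  set l := P.angMom q₀ u with hl
  have hl0 : l ≠ 0 := mul_ne_zero hu (mul_pos hF hs).ne'
  have hw0 : P.β * l ≠ 0 := mul_ne_zero P.β_pos.ne' hl0
  have hp0 : p ≤ 0 := mul_nonpos_of_nonpos_of_nonneg hv hs.le
  obtain ⟨τ, hmono, hcont, hτ0, hflow⟩ := H.exists_flowsTo_orbit hT.neg hζ hE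
  obtain ⟨T, hT0, hle, hqT, hpT, ⟨ε, hε, hout⟩, hexp⟩ := exists_orbit_return (C := P.C) (γ := P.γ)
    (q₀ := q₀) (p₀ := p) hw0 hp0 (fun h0 => by
      have := hT.accel_pos q₀ le_rfl l (h0 ▸ hE)
      linarith)
  set Q := orbitQ P.C P.γ (P.β * l) q₀ p with hQ
  have hin : ∀ σ ∈ Icc 0 T, Q σ < 0 := fun σ hσ => (hle σ hσ).trans_lt hT.neg
  have hflowT : ∀ σ ∈ Icc 0 T, FlowsTo (S.keplerField Θ P.γ) (P.manifold S Θ \ P.collisions S Θ)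
      (P.state q₀ p l ζ) (τ σ) (P.orbit q₀ p l ζ σ) := fun σ hσ => hflow σ fun s hs => by
    rw [uIcc_of_le hσ.1] at hs
    exact hin s ⟨hs.1, hs.2.trans hσ.2⟩
  -- Just after T the orbit is above q₀ but still in q < 0, so the flow is defined there and has
  -- left the block.
  have hexit : ∀ᶠ σ in 𝓝[>] T, ∃ y, FlowsTo (S.keplerField Θ P.γ)
      (P.manifold S Θ \ P.collisions S Θ) (P.state q₀ p l ζ) (τ σ) y ∧ y ∉ P.block S Θ q₀ := by
    have h1 : ∀ᶠ σ in 𝓝 T, Q σ < 0 := (continuous_orbitQ _ _ _ _ _).continuousAt.eventually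
      (gt_mem_nhds (by rw [← hQ, hqT]; exact hT.neg))
    obtain ⟨δ, hδ, h2⟩ := Metric.eventually_nhds_iff.1 h1
    filter_upwards [Ioo_mem_nhdsGT (show T < T + min ε δ by linarith [lt_min hε hδ])] with σ hσ
    have h3 : σ < T + ε := hσ.2.trans_le (by linarith [min_le_left ε δ])
    have h4 : σ < T + δ := hσ.2.trans_le (by linarith [min_le_right ε δ])
    have h5 : ∀ s ∈ uIcc 0 σ, Q s < 0 := by
      intro s hs
      rw [uIcc_of_le (hT0.trans hσ.1.le)] at hs
      rcases le_total s T with h | h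
      · exact hin s ⟨hs.1, h⟩
      · refine h2 ?_
        rw [Real.dist_eq, abs_of_nonneg (by linarith)]
        linarith [hs.2]
    refine ⟨_, hflow σ h5, ?_⟩
    rw [H.orbit_mem_block_iff hζ hE (h5 _ right_mem_uIcc)]
    exact not_le.2 (hout σ ⟨hσ.1, h3⟩)
  have hacross : P.across q₀ n (P.R q₀, ζ, u, v) = P.orbit q₀ p l ζ T := by
    have h1 : P.orbit q₀ p l ζ T
        = P.state q₀ (-p) l (ζ * Complex.exp ((l * T : ℝ) * Complex.I)) := by
      rw [orbit, ← hQ, hqT, hpT]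
    -- Here the orbifold condition enters: l = nβl, so the rotation of the longitude is an integer
    -- power of exp(iβlT), which is a smooth function of the velocities.
    have h2 : Complex.exp ((l * T : ℝ) * Complex.I)
        = Complex.exp ((P.β * l * T : ℝ) * Complex.I) ^ n := by
      rw [← Complex.exp_nat_mul, hβ]
      congr 1
      have : (n : ℂ) ≠ 0 := by exact_mod_cast hn.ne'
      push_cast
      field_simp
    rw [h1, h2, hexp, state]
    simp only [across, Prod.mk.injEq, true_and]
    refine ⟨rfl, ?_, ?_⟩
    · rw [hl, angMom, mul_div_cancel_right₀ _ (mul_pos hF hs).ne']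
    · rw [hp, radMom, neg_div, mul_div_cancel_right₀ _ hs.ne']
  have htime : exitTime (S.keplerField Θ P.γ) (P.manifold S Θ) (P.collisions S Θ)
      (P.block S Θ q₀) (P.R q₀, ζ, u, v) = τ T := by
    have hτT : 0 ≤ τ T := by rw [← hτ0]; exact hmono.monotone hT0
    rw [exitTime, hst]
    -- The exit time is an infimum that is not attained, since at τ(T) the orbit is still on the
    -- boundary; it equals 0 at tangency points.
    refine csInf_eq_of_forall_ge_of_forall_gt_exists_lt ?_ ?_ ?_
    · obtain ⟨σ, ⟨y, h1, h2⟩, h3⟩ := (hexit.and self_mem_nhdsWithin).exists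
      exact ⟨τ σ, hτT.trans_lt (hmono h3), y, h1, h2⟩
    · rintro t ⟨ht, y, h1, h2⟩
      by_contra! hlt
      obtain ⟨σ, hσ, rfl⟩ := intermediate_value_Icc hT0 hcont.continuousOn
        (show t ∈ Icc (τ 0) (τ T) from ⟨hτ0.symm ▸ ht.le, hlt.le⟩)
      rw [H.flow_unique h1 (hflowT σ hσ), H.orbit_mem_block_iff hζ hE (hin σ hσ)] at h2
      exact h2 (hle σ hσ)
    · intro t ht
      have h1 : ∀ᶠ σ in 𝓝[>] T, τ σ < t :=
        (hcont.continuousAt.eventually (gt_mem_nhds ht)).filter_mono nhdsWithin_le_nhds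
      obtain ⟨σ, ⟨⟨y, h2, h3⟩, h4⟩, h5⟩ := ((hexit.and h1).and self_mem_nhdsWithin).exists
      exact ⟨τ σ, ⟨hτT.trans_lt (hmono h5), y, h2, h3⟩, h4⟩
  refine ⟨?_, fun ha => ?_⟩
  · rw [htime, hacross, hst]
    exact hflowT T (right_mem_Icc.2 hT0)
  · obtain ⟨σ, ⟨y, h1, h2⟩, h3⟩ := (hexit.and self_mem_nhdsWithin).exists
    refine h2 (ha.2 (τ σ) ?_ y ?_)
    · rw [← hτ0]
      exact hmono.monotone (hT0.trans (le_of_lt h3))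
    · rw [hst]
      exact h1

theorem _root_.IsSmoothMap.eq_of_tendsto {E : Type*} [NormedAddCommGroup E] [NormedSpace ℝ E]
    {X Y : Set E} {φ ψ : X → Y} (hφ : IsSmoothMap φ) (hψ : IsSmoothMap ψ) {c : ℝ → E} (x : X)
    (hc : Tendsto c (𝓝[>] 0) (𝓝 x))
    (h : ∀ᶠ s in 𝓝[>] 0, ∃ hX : c s ∈ X, φ ⟨c s, hX⟩ = ψ ⟨c s, hX⟩) : φ x = ψ x := by
  obtain ⟨U, G, hU, hxU, hG, hGe⟩ := hφ x
  obtain ⟨V, G', hV, hxV, hG', hGe'⟩ := hψ x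
  have h1 : Tendsto (G ∘ c) (𝓝[>] 0) (𝓝 (G x)) :=
    ((hG.contDiffAt (hU.mem_nhds hxU)).continuousAt.tendsto).comp hc
  have h2 : Tendsto (G' ∘ c) (𝓝[>] 0) (𝓝 (G' x)) :=
    ((hG'.contDiffAt (hV.mem_nhds hxV)).continuousAt.tendsto).comp hc
  have h3 : G ∘ c =ᶠ[𝓝[>] 0] G' ∘ c := by
    filter_upwards [h, hc.eventually (hU.mem_nhds hxU), hc.eventually (hV.mem_nhds hxV)]
      with s ⟨hX, h4⟩ h5 h6
    have e1 := hGe ⟨c s, hX⟩ h5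
    have e2 := hGe' ⟨c s, hX⟩ h6
    simp only [Function.comp_apply]
    rw [e1, e2, h4]
  have h4 := tendsto_nhds_unique h1 (h2.congr' h3.symm)
  exact Subtype.ext ((hGe x hxU).symm.trans (h4.trans (hGe' x hxV)))

/-- Ingress points with u = 0 fall into the collision and those with u ≠ 0 do not. On the latter the
flow prescribes the map; continuity then determines it on the former, where the formula is still
smooth. -/
theorem Models.isTrivializable (H : P.Models S Θ) (hT : P.IsThreshold q₀) {n : ℕ} (hn : 0 < n)
    (hβ : P.β = 1 / n) :
    IsTrivializable (S.keplerField Θ P.γ) (P.manifold S Θ) (P.collisions S Θ)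
      (P.block S Θ q₀) := by
  have hmem_in : ∀ x : KeplerState, x ∈ ingress (S.keplerField Θ P.γ) (P.manifold S Θ)
      (P.collisions S Θ) (P.block S Θ q₀) ↔ (x.1 = P.R q₀ ∧ ‖x.2.1‖ = 1 ∧
        x.2.2.1 ^ 2 + x.2.2.2 ^ 2 = 2 * P.γ - 2 * P.h / q₀) ∧ x.2.2.2 ≤ 0 := fun x => by
    rw [H.ingress_block hT]; rfl
  have hmem_eg : ∀ x : KeplerState, x ∈ egress (S.keplerField Θ P.γ) (P.manifold S Θ)
      (P.collisions S Θ) (P.block S Θ q₀) ↔ (x.1 = P.R q₀ ∧ ‖x.2.1‖ = 1 ∧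
        x.2.2.1 ^ 2 + x.2.2.2 ^ 2 = 2 * P.γ - 2 * P.h / q₀) ∧ 0 ≤ x.2.2.2 := fun x => by
    rw [H.egress_block hT]; rfl
  have hne : ∀ x : KeplerState, x.2.2.1 ^ 2 + x.2.2.2 ^ 2 = 2 * P.γ - 2 * P.h / q₀ →
      P.phase q₀ x.2.2.1 x.2.2.2 ≠ 0 := fun x hx => H.phase_ne_zero hT hx
  let e : ingress (S.keplerField Θ P.γ) (P.manifold S Θ) (P.collisions S Θ) (P.block S Θ q₀) ≃
      egress (S.keplerField Θ P.γ) (P.manifold S Θ) (P.collisions S Θ) (P.block S Θ q₀) :=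
    { toFun := fun x => ⟨P.across q₀ n x, by
        have h := (hmem_in x).1 x.2
        exact (hmem_eg _).2 ⟨across_mem n (hne _ h.1.2.2) h.1, neg_nonneg.2 h.2⟩⟩
      invFun := fun x => ⟨P.across q₀ n x, by
        have h := (hmem_eg x).1 x.2
        exact (hmem_in _).2 ⟨across_mem n (hne _ h.1.2.2) h.1, neg_nonpos.2 h.2⟩⟩
      left_inv := fun x => Subtype.ext (across_across n (hne _ ((hmem_in x).1 x.2).1.2.2))
      right_inv := fun x => Subtype.ext (across_across n (hne _ ((hmem_eg x).1 x.2).1.2.2)) }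
  obtain ⟨hopen, hsmooth⟩ := contDiffOn_across (P := P) (q₀ := q₀) n
  have he : IsSmoothMap e := fun x =>
    ⟨_, _, hopen, hne _ ((hmem_in x).1 x.2).1.2.2, hsmooth, fun y _ => rfl⟩
  have hes : IsSmoothMap e.symm := fun x =>
    ⟨_, _, hopen, hne _ ((hmem_eg x).1 x.2).1.2.2, hsmooth, fun y _ => rfl⟩
  refine ⟨e, ⟨he, hes, ?_⟩, ?_⟩
  · rintro ⟨⟨r, ζ, u, v⟩, hx⟩ hna
    obtain ⟨⟨h1, h2, h3⟩, h4⟩ := (hmem_in _).1 hx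
    simp only at h1 h2 h3 h4 hna
    subst h1
    have hu : u ≠ 0 := by
      rintro rfl
      exact hna (H.mem_asymptoticIngress hT h2 h3 h4)
    exact (H.flowsTo_across hT hn hβ h2 h3 hu h4).1
  · rintro e' ⟨he', -, hflow⟩
    have hoff : ∀ x : ingress (S.keplerField Θ P.γ) (P.manifold S Θ) (P.collisions S Θ)
        (P.block S Θ q₀), (x : KeplerState).2.2.1 ≠ 0 → e' x = e x := by
      rintro ⟨⟨r, ζ, u, v⟩, hx⟩ hu
      obtain ⟨⟨h1, h2, h3⟩, h4⟩ := (hmem_in _).1 hx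
      simp only at h1 h2 h3 h4 hu
      subst h1
      obtain ⟨h5, h6⟩ := H.flowsTo_across hT hn hβ h2 h3 hu h4
      exact Subtype.ext (H.flow_unique (hflow _ h6) h5)
    refine Equiv.ext fun x => ?_
    by_cases hu : (x : KeplerState).2.2.1 ≠ 0
    · exact hoff x hu
    obtain ⟨⟨r, ζ, u, v⟩, hx⟩ := x
    obtain ⟨⟨h1, h2, h3⟩, h4⟩ := (hmem_in _).1 hx
    simp only [not_not] at h1 h2 h3 h4 hu
    subst hu
    have hv : v < 0 := by
      refine lt_of_le_of_ne h4 ?_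
      rintro rfl
      have := hT.radius_pos
      norm_num at h3
      linarith
    -- Turning (0, v) along its circle keeps the energy and makes u nonzero, so the radial state is
    -- a limit of ingress points where both maps are known.
    let c : ℝ → KeplerState := fun s => (r, ζ, v * Real.sin s, v * Real.cos s)
    have hc : Tendsto c (𝓝[>] 0) (𝓝 (r, ζ, 0, v)) := by
      have h5 : Continuous c := by fun_prop
      have h6 := (h5.tendsto 0).mono_left (nhdsWithin_le_nhds (s := Ioi 0))
      simpa [c] using h6
    refine he'.eq_of_tendsto he (c := c) ⟨(r, ζ, 0, v), hx⟩ hc ?_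
    filter_upwards [Ioo_mem_nhdsGT (show (0 : ℝ) < Real.pi / 2 by positivity)] with s hs
    have hsin : 0 < Real.sin s := Real.sin_pos_of_pos_of_lt_pi hs.1 (by linarith [hs.2, Real.pi_pos])
    have hcos : 0 < Real.cos s := Real.cos_pos_of_mem_Ioo ⟨by linarith [hs.1, Real.pi_pos], hs.2⟩
    have hX : c s ∈ ingress (S.keplerField Θ P.γ) (P.manifold S Θ) (P.collisions S Θ)
        (P.block S Θ q₀) := by
      refine (hmem_in _).2 ⟨⟨h1, h2, ?_⟩, mul_nonpos_of_nonpos_of_nonneg hv.le hcos.le⟩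
      rw [← h3]
      simp only [c]
      linear_combination v ^ 2 * Real.sin_sq_add_cos_sq s
    exact ⟨hX, hoff ⟨c s, hX⟩ (mul_ne_zero hv.ne hsin.ne')⟩

theorem Models.isBlockRegularizable (H : P.Models S Θ) {n : ℕ} (hn : 0 < n) (hβ : P.β = 1 / n) :
    IsBlockRegularizable 1 (S.keplerField Θ P.γ) (P.manifold S Θ) (P.collisions S Θ) := by
  obtain ⟨q₀, hT⟩ := P.exists_isThreshold
  exact ⟨P.block S Θ q₀, H.isIsolatingBlock hT, H.isolates hT, H.isTrivializable hT hn hβ⟩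

end KeplerData

end

theorem theorem7 (S : SphericalSurface) (K : ℝ) (hK : 0 < K) (hcurv : S.HasConstantCurvature K)
    (horb : S.IsOrbifold) :
    (∀ n : ℕ, 0 < n → IsIsometricToPlaneQuotient S.tangentConeNorth n →
      (∃ β : ℝ, S.IsBeta β) ∧
      ∀ β : ℝ, S.IsBeta β →
        |β| = S.f' S.rN ∧ S.f' S.rN = 1 / (n : ℝ) ∧ |β| = 2 / (2 * (n : ℝ))) ∧
    ∀ (Θ : ℝ → ℝ), S.IsPotentialShape Θ → ∀ γ : ℝ, 0 < γ → ∀ h : ℝ,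
      IsBlockRegularizable 1 (S.keplerField Θ γ) (S.energyManifold Θ γ h)
        (S.northSingularity Θ γ h) := by
  have hround := SphericalSurface.isRound_of_hasConstantCurvature hK hcurv
  constructor
  · intro n hn hcone
    have hb := hround.beta_eq_one_div hn hcone
    refine ⟨⟨S.f' S.rN, hround.isBeta_iff.2 rfl⟩, fun β hβ => ?_⟩
    have h1 : |β| = S.f' S.rN := by
      rw [← abs_of_pos hround.beta_pos]
      exact (sq_eq_sq_iff_abs_eq_abs _ _).1 (hround.isBeta_iff.1 hβ)
    refine ⟨h1, hb, ?_⟩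
    have : (n : ℝ) ≠ 0 := by exact_mod_cast hn.ne'
    rw [h1, hb]
    field_simp
  · intro Θ hΘ γ hγ h
    obtain ⟨n, hn, hcone⟩ := horb.1
    obtain ⟨P, H, -, hPβ, rfl, rfl⟩ := KeplerData.exists_models (h := h) hround hΘ hγ
    exact H.isBlockRegularizable hn (hPβ.trans (hround.beta_eq_one_div hn hcone))
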